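/- Let $q\in\mathbb{C}$ with $0<|q|<1$. Write $(x;q)_\infty=\prod_{n\ge 0}(1-xq^n)$, let $(x;q)_n$ ($n\in\mathbb{Z}$) be the $q$-shifted factorial, i.e. $(x;q)_n=\prod_{k=0}^{n-1}(1-xq^k)$ for $n\ge 0$ and $(x;q)_{-n}=1/\prod_{k=1}^{n}(1-xq^{-k})$ for $n\ge1$ (so $(x;q)_n=(x;q)_\infty/(xq^n;q)_\infty$ whenever the quotient is defined), and let $(x_1,\dots,x_m;q)_n=\prod_i(x_i;q)_n$ for $n\in\mathbb{Z}\cup\{\infty\}$. Put $$\Omega(x_1,\dots,x_n;a_1,\dots,a_m)=\prod_{i=1}^n\prod_{j=1}^m(x_i/a_j;q)_\infty .$$ The very-well-poised bilateral series is $${}_8\psi_8[a;a_3,\dots,a_8;q,w]=\sum_{n=-\infty}^{\infty}\frac{(a_1,\dots,a_8;q)_n}{(b_1,\dots,b_8;q)_n}\,w^n,\qquad a_1=q\sqrt a,\ a_2=-q\sqrt a,\ b_i=aq/a_i .$$ **Theorem.** Let $a,b,c,d,e,f,g$ be nonzero complex numbers and $z=bcde/(aq)$, such that $|a^2q/(fgz)|<1$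 and $|aq/(fg)|<1$, and such that no denominator below (in the terms of the three series and in the coefficients) is zero. Then the three series converge absolutely, and $$\begin{aligned} &{}_8\psi_8\left[a;b,c,d,e,f,g;q,\tfrac{a^2q}{fgz}\right]\\ &=\left(1-\tfrac1z\right)\frac{(aq,q/a;q)_\infty}{\Omega(q;f,g)}\, \frac{\Omega(aq;bc,bd,be,cd,ce,de,fg,fz,gz)}{\Omega(aq;b,c,d,e)\,\Omega(1/z;1/b,1/c,1/d,1/e,fg/(a^2q))}\\ &\quad\times{}_8\psi_8\left[z;b,c,d,e,\tfrac{fz}{a},\tfrac{gz}{a};q,\tfrac{aq}{fg}\right]\\ &+\frac1z\,\frac{(aq,q/a;q)_\infty}{(aq/z^2,z^2q/a;q)_\infty}\, \frac{\Omega(aq/z,zq;f,g)}{\Omega(q,aq;f,g)}\, \frac{(b,c,d,e;q)_\infty\,\Omega(aq/z;b,c,d,e)}{\Omega(1/z;1/b,1/c,1/d,1/e)\,\Omega(aq;b,c,d,e)}\\ &\quad\times{}_8\psi_8\left[\tfrac{z^2}{a};\tfrac{bz}{a},\tfrac{cz}{a},\tfrac{dz}{a},\tfrac{ez}{a},\tfrac{fz}{a},\tfrac{gz}{a};q,\tfrac{a^2q}{fgz}\right].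 \end{aligned}$$ -/

import Mathlib

noncomputable section

namespace QSeries

/-- The infinite `q`-shifted factorial `(x;q)_∞ = ∏_{n ≥ 0} (1 - x qⁿ)`. -/
def qInf (q x : ℂ) : ℂ := ∏' n : ℕ, (1 - x * q ^ n)

/-- The `q`-shifted factorial `(x;q)_n` for an integer `n`:
`(x;q)_n = ∏_{k=0}^{n-1} (1 - x q^k)` for `n ≥ 0` and
`(x;q)_{-n} = 1 / ∏_{k=1}^{n} (1 - x q^{-k})` for `n ≥ 1`.
This is the quotient `(x;q)_∞ / (x qⁿ;q)_∞` whenever the latter is defined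
(see `qPoch_eq_div`), and its value by continuity at `x = q^{-m}`. -/
def qPoch (q x : ℂ) : ℤ → ℂ
  | Int.ofNat n => ∏ k ∈ Finset.range n, (1 - x * q ^ k)
  | Int.negSucc n => (∏ k ∈ Finset.range (n + 1), (1 - x / q ^ (k + 1)))⁻¹

/-- `(x₁,…,x_m;q)_∞`. -/
def qInfs (q : ℂ) (xs : List ℂ) : ℂ := (xs.map (qInf q)).prod

/-- `(x₁,…,x_m;q)_n`. -/
def qPochs (q : ℂ) (xs : List ℂ) (n : ℤ) : ℂ := (xs.map fun x => qPoch q x n).prod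

/-- `Ω(x₁,…,x_n; a₁,…,a_m) = ∏_i ∏_j (x_i / a_j; q)_∞`. -/
def Omega (q : ℂ) (xs as : List ℂ) : ℂ :=
  (xs.map fun x => (as.map fun a => qInf q (x / a)).prod).prod

/-- The `n`-th term of the bilateral series `_rψ_r[as; bs; q, w]`. -/
def psiTerm (q : ℂ) (as bs : List ℂ) (w : ℂ) (n : ℤ) : ℂ :=
  qPochs q as n / qPochs q bs n * w ^ n

/-- No term of `_rψ_r[as; bs; q, w]` has a zero denominator: for `n < 0` the factor
`(α;q)_n` of an upper parameter `α` has a pole only at `α = q^k`, `k ≥ 1`, and for `n ≥ 0` the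
factor `(β;q)_n` of a lower parameter `β` vanishes only at `β = q^{-k}`, `k ≥ 0`. -/
def PsiDefined (q : ℂ) (as bs : List ℂ) : Prop :=
  (∀ α ∈ as, ∀ k : ℕ, α ≠ q ^ (k + 1)) ∧ (∀ β ∈ bs, ∀ k : ℕ, β * q ^ k ≠ 1)

/-- The upper parameters `q√a, -q√a, a₃, …, a_r` of a very-well-poised series. As both signs of
the root occur, the choice of the root is immaterial. -/
def vwpUpper (q a : ℂ) (xs : List ℂ) : List ℂ :=
  (q * Complex.sqrt a) :: (-(q * Complex.sqrt a)) :: xs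

/-- The lower parameters `b_i = aq / a_i` of a very-well-poised series. -/
def vwpLower (q a : ℂ) (xs : List ℂ) : List ℂ :=
  (vwpUpper q a xs).map fun α => a * q / α

/-- The `n`-th term of the very-well-poised series `_rψ_r[a; a₃,…,a_r; q, w]`. -/
def vwpTerm (q a : ℂ) (xs : List ℂ) (w : ℂ) (n : ℤ) : ℂ :=
  psiTerm q (vwpUpper q a xs) (vwpLower q a xs) w n

/-- The very-well-poised bilateral series `_rψ_r[a; a₃,…,a_r; q, w]`; here `xs = [a₃,…,a_r]`, so
a list of six parameters gives an `₈ψ₈` series. -/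
def vwpPsi (q a : ℂ) (xs : List ℂ) (w : ℂ) : ℂ := ∑' n : ℤ, vwpTerm q a xs w n

/-- No term of `_rψ_r[a; a₃,…,a_r; q, w]` has a zero denominator. -/
def VwpDefined (q a : ℂ) (xs : List ℂ) : Prop :=
  PsiDefined q (vwpUpper q a xs) (vwpLower q a xs)

theorem qInf_eq_mul (q x : ℂ) (hq : ‖q‖ < 1) : qInf q x = (1 - x) * qInf q (x * q) := by
  have hs : Summable fun n : ℕ => ‖-(x * q ^ (n + 1))‖ := by
    have h := (summable_geometric_of_lt_one (norm_nonneg q) hq).mul_left (‖x‖ * ‖q‖)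
    have e : (fun n : ℕ => ‖-(x * q ^ (n + 1))‖) = fun n : ℕ => ‖x‖ * ‖q‖ * ‖q‖ ^ n := by
      funext n
      rw [norm_neg, norm_mul, norm_pow, pow_succ]
      ring
    rw [e]
    exact h
  have hm : Multipliable fun n : ℕ => (1 - x * q ^ (n + 1)) := by
    have h := multipliable_one_add_of_summable hs
    simp only [← sub_eq_add_neg] at h
    exact h
  have h0 := tprod_eq_zero_mul' (f := fun n : ℕ => 1 - x * q ^ n) hm
  have h1 : (fun n : ℕ => 1 - x * q ^ (n + 1)) = fun n : ℕ => 1 - x * q * q ^ n := by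
    funext n
    rw [pow_succ]
    ring
  rw [h1, pow_zero, mul_one] at h0
  exact h0

theorem qPoch_mul_qInf_nat (q x : ℂ) (hq : ‖q‖ < 1) (n : ℕ) :
    (∏ k ∈ Finset.range n, (1 - x * q ^ k)) * qInf q (x * q ^ n) = qInf q x := by
  induction n with
  | zero => simp
  | succ n ih =>
    rw [← ih, qInf_eq_mul q (x * q ^ n) hq, Finset.prod_range_succ]
    ring_nf

theorem qPoch_eq_div (q x : ℂ) (hq0 : q ≠ 0) (hq : ‖q‖ < 1) (n : ℤ)
    (hx : qInf q (x * q ^ n) ≠ 0) : qPoch q x n = qInf q x / qInf q (x * q ^ n) := by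
  rcases n with n | n
  · rw [eq_div_iff hx]
    simpa [qPoch] using qPoch_mul_qInf_nat q x hq n
  · have h := qPoch_mul_qInf_nat q (x * q ^ (Int.negSucc n)) hq (n + 1)
    have e : x * q ^ (Int.negSucc n) * q ^ (n + 1) = x := by
      rw [zpow_negSucc]
      field_simp
    have e2 : ∏ k ∈ Finset.range (n + 1), (1 - x * q ^ (Int.negSucc n) * q ^ k)
        = ∏ k ∈ Finset.range (n + 1), (1 - x / q ^ (k + 1)) := by
      rw [← Finset.prod_range_reflect]
      refine Finset.prod_congr rfl fun k hk => ?_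
      have hk' : k ≤ n := by
        have := Finset.mem_range.mp hk
        omega
      obtain ⟨m, rfl⟩ := Nat.exists_eq_add_of_le hk'
      have : k + m + 1 - 1 - k = m := by omega
      rw [this, zpow_negSucc]
      field_simp
      ring
    rw [e, e2] at h
    have hP : (∏ k ∈ Finset.range (n + 1), (1 - x / q ^ (k + 1))) * qInf q x =
        qInf q (x * q ^ (Int.negSucc n)) := h
    have hne := hP ▸ hx
    have h1 := left_ne_zero_of_mul hne
    have h2 := right_ne_zero_of_mul hne
    rw [← hP]
    simp only [qPoch]
    rw [inv_eq_one_div, div_eq_div_iff h1 hne]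
    ring

end QSeries

end

open QSeries

noncomputable section

namespace QSeries

open Filter Topology

variable {q : ℂ}

/-! Write the parameters of an ₈ψ₈ as `1/uᵢ`. After clearing denominators its general term is
`term6`: a very-well-poised factor, a Gaussian `a^{3n} q^{3n²}`, and six kernels `ker q a uᵢ n`. The
reflection `n ↦ -n` exchanges the bases `z²/a` and `a/z²`, so the theorem becomes a linear relation
between normalised sums `sum6` with bases `a`, `a/z²` and `z`.

The kernel has a duality (`ker_mul_ker_swap`). The kernels of base `z`, index `m` and parameters `s
qⁿ`, `t q⁻ⁿ` have the same product as those of base `s/t`, index `n` and parameters `z t q^m`, `t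
q^{-m}`. Hence, if an ₈ψ₈ with these last two parameters is weighted by `head4 q z x y m` and summed
over `m`, the sum over `m` is a ₆ψ₆. Bailey's formula `sum4_eq` evaluates it, and the result is an
₈ψ₈ whose last two parameters are free (`sum6_average`). The same weights work for the bases `a` and
`a/z²`, so it is enough to treat the discrete family `u = (z/a) q^m`, `v = a⁻¹ q^{-m}` and to show
that there the combination of the two sums is, up to a factor free of `m`, the missing part of the
`m`-th term of base `z` (`comb6_eq`). The coefficient in the combination must not depend on `m`, and
it does not.

For this family quasi-periodicity moves one kernel into the denominator, and the relation defining
`z` becomes the balancing condition of `sum51`. A contiguous relation for `sum51` telescopes. Its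
boundary term vanishes at `-∞` and is a quotient of theta functions at `+∞`. The boundary terms of
the bases `a` and `a/z²` are proportional, so a suitable combination `comb51` obeys a homogeneous
first-order recursion whose limit is a pair of ₆ψ₆ sums (`comb51_eq`). The value contains a
difference of two theta products, which Weierstrass' formula `theta_addition` factors.

The ₆ψ₆ sum comes from a telescoping recursion sending each parameter to zero. The remaining
constant is found from a case in which the series has a single nonzero term. That constant is also
the triple product identity, from which Weierstrass' formula follows as a Plücker relation.
Exceptional parameter values are reached at the end by continuity along a rotation of `z`. -/

/-! ### Continuity, zeros and bounds of the infinite product -/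

theorem summable_norm_mul_pow (hq : ‖q‖ < 1) (x : ℂ) : Summable fun n : ℕ => ‖-(x * q ^ n)‖ := by
  simpa [norm_mul, norm_pow] using
    (summable_geometric_of_lt_one (norm_nonneg q) hq).mul_left ‖x‖

theorem continuous_qInf (hq : ‖q‖ < 1) : Continuous (qInf q) := by
  refine continuous_iff_continuousAt.2 fun x => ?_
  have h := tendsto_tprod_one_add_of_dominated_convergence (𝓕 := 𝓝 x)
    (f := fun (y : ℂ) (n : ℕ) => -(y * q ^ n)) (g := fun n => -(x * q ^ n))
    (bound := fun n => (‖x‖ + 1) * ‖q‖ ^ n)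
    ((summable_geometric_of_lt_one (norm_nonneg q) hq).mul_left _)
    (fun n => (Continuous.tendsto (by fun_prop) x)) ?_
  · simp only [← sub_eq_add_neg] at h
    exact h
  · filter_upwards [Metric.ball_mem_nhds x one_pos] with y hy n
    rw [norm_neg, norm_mul, norm_pow]
    gcongr
    have := norm_sub_norm_le y x
    rw [Metric.mem_ball, dist_eq_norm] at hy
    linarith

@[simp]
theorem qInf_zero (q : ℂ) : qInf q 0 = 1 := by simp [qInf]

theorem qInf_ne_zero (hq : ‖q‖ < 1) {x : ℂ} (hx : ∀ k : ℕ, x * q ^ k ≠ 1) : qInf q x ≠ 0 := by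
  have h := tprod_one_add_ne_zero_of_summable (f := fun n : ℕ => -(x * q ^ n))
    (fun n => by
      rw [← sub_eq_add_neg]
      exact sub_ne_zero.2 (hx n).symm) (summable_norm_mul_pow hq x)
  simp only [← sub_eq_add_neg] at h
  exact h

theorem qInf_ne_zero_of_norm_lt (hq : ‖q‖ < 1) {x : ℂ} (hx : ‖x‖ < 1) : qInf q x ≠ 0 := by
  refine qInf_ne_zero hq fun k h => ?_
  have h1 : ‖x * q ^ k‖ < 1 := by
    rw [norm_mul, norm_pow]
    exact mul_lt_one_of_nonneg_of_lt_one_left (norm_nonneg _) hx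
      (pow_le_one₀ (norm_nonneg _) hq.le)
  rw [h] at h1
  simp at h1

theorem qInf_eq_zero (hq : ‖q‖ < 1) {x : ℂ} {k : ℕ} (hx : x * q ^ k = 1) : qInf q x = 0 := by
  rw [← qPoch_mul_qInf_nat q x hq (k + 1), Finset.prod_range_succ, hx]
  simp

theorem exists_norm_qInf_le (hq : ‖q‖ < 1) (R : ℝ) :
    ∃ C, 0 ≤ C ∧ ∀ x : ℂ, ‖x‖ ≤ R → ‖qInf q x‖ ≤ C := by
  obtain ⟨C, hC⟩ := (isCompact_closedBall (0 : ℂ) R).exists_bound_of_continuousOn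
    (continuous_qInf hq).continuousOn
  exact ⟨max C 0, le_max_right _ _, fun x hx => (hC x (by simpa using hx)).trans (le_max_left _ _)⟩

theorem tendsto_qInf_mul_pow (hq : ‖q‖ < 1) (x : ℂ) :
    Tendsto (fun n : ℕ => qInf q (x * q ^ n)) atTop (𝓝 1) := by
  have h := ((continuous_qInf hq).tendsto (x * 0)).comp
    ((tendsto_pow_atTop_nhds_zero_of_norm_lt_one hq).const_mul x)
  simpa [Function.comp_def] using h

/-! ### Quasi-periodicity and zeros of the theta function -/

/-- The modified Jacobi theta function `(x, q/x; q)_∞`. -/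
def theta (q x : ℂ) : ℂ := qInf q x * qInf q (q / x)

theorem continuousAt_theta (hq : ‖q‖ < 1) {x : ℂ} (hx : x ≠ 0) : ContinuousAt (theta q) x :=
  (continuous_qInf hq).continuousAt.mul
    ((continuous_qInf hq).continuousAt.comp (by fun_prop (disch := exact hx)))

theorem theta_mul_q (hq0 : q ≠ 0) (hq : ‖q‖ < 1) {x : ℂ} (hx : x ≠ 0) :
    theta q (x * q) = -theta q x / x := by
  have h1 := qInf_eq_mul q x hq
  have h2 := qInf_eq_mul q (q / (x * q)) hq
  have e : q / (x * q) * q = q / x := by field_simp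
  have e' : q / (x * q) = 1 / x := by field_simp
  rw [e, e'] at h2
  rw [theta, theta, e', h1, h2]
  field_simp
  ring

theorem theta_div_q (hq0 : q ≠ 0) (hq : ‖q‖ < 1) {x : ℂ} (hx : x ≠ 0) :
    theta q (x / q) = -(x / q) * theta q x := by
  have h := theta_mul_q hq0 hq (x := x / q) (div_ne_zero hx hq0)
  rw [div_mul_cancel₀ _ hq0] at h
  rw [h]
  field_simp

theorem theta_inv (hq : ‖q‖ < 1) {x : ℂ} (hx : x ≠ 0) :
    theta q x⁻¹ = -theta q x / x := by
  have h1 := qInf_eq_mul q x hq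
  have h2 := qInf_eq_mul q x⁻¹ hq
  have e : q / x⁻¹ = x * q := by field_simp
  have e' : x⁻¹ * q = q / x := by field_simp
  rw [e'] at h2
  rw [theta, theta, e, h1, h2]
  field_simp
  ring

theorem theta_ne_zero (hq0 : q ≠ 0) (hq : ‖q‖ < 1) {x : ℂ} (hx : x ≠ 0)
    (h : ∀ n : ℤ, x ≠ q ^ n) : theta q x ≠ 0 := by
  refine mul_ne_zero (qInf_ne_zero hq fun k hk => ?_) (qInf_ne_zero hq fun k hk => ?_)
  · apply h (-k)
    rw [zpow_neg, zpow_natCast]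
    exact eq_inv_of_mul_eq_one_left hk
  · apply h (k + 1)
    rw [div_mul_eq_mul_div, div_eq_one_iff_eq hx] at hk
    rw [← hk, zpow_add₀ hq0, zpow_natCast, zpow_one, mul_comm]

theorem ne_zpow_of_theta_ne_zero (hq0 : q ≠ 0) (hq : ‖q‖ < 1) {x : ℂ} (h : theta q x ≠ 0) (n : ℤ) :
    x ≠ q ^ n := by
  rintro rfl
  apply h
  obtain ⟨k, rfl | rfl⟩ := n.eq_nat_or_neg
  · rcases k with _ | k
    · rw [theta, qInf_eq_zero (k := 0) hq (by simp), zero_mul]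
    · rw [theta, qInf_eq_zero (x := q / _) (k := k) hq, mul_zero]
      rw [zpow_natCast, pow_succ]
      field_simp
  · rw [theta, qInf_eq_zero (k := k) hq, zero_mul]
    rw [zpow_neg, zpow_natCast, inv_mul_cancel₀ (pow_ne_zero _ hq0)]

/-- Opposite shifts make the quadratic exponents of `q` add up to `-n²`, and the signs cancel. This
is the Gaussian that passes between `sum6` and `sum51`, and that later cancels from both sides of
the condition on the coefficient of `comb6_eq`. -/
theorem theta_mul_theta_zpow (hq0 : q ≠ 0) (hq : ‖q‖ < 1) {x y : ℂ} (hx : x ≠ 0) (hy : y ≠ 0)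
    (n : ℤ) : theta q (x * q ^ (-n)) * theta q (y * q ^ n) =
      (x / y) ^ n * q ^ (-n ^ 2) * (theta q x * theta q y) := by
  have step : ∀ n : ℤ, theta q (x * q ^ (-(n + 1))) * theta q (y * q ^ (n + 1)) =
      (x / y) * q ^ (-(2 * n + 1)) * (theta q (x * q ^ (-n)) * theta q (y * q ^ n)) := by
    intro n
    have hn : q ^ n ≠ 0 := zpow_ne_zero _ hq0
    have e1 : x * q ^ (-(n + 1)) = x * q ^ (-n) / q := by
      rw [neg_add, ← sub_eq_add_neg, zpow_sub_one₀ hq0]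
      ring
    have e2 : y * q ^ (n + 1) = y * q ^ n * q := by
      rw [zpow_add_one₀ hq0]
      ring
    rw [e1, e2, theta_div_q hq0 hq (by positivity), theta_mul_q hq0 hq (by positivity),
      show (-(2 * n + 1)) = -n + -n + -1 by ring, zpow_add₀ hq0, zpow_add₀ hq0, zpow_neg, zpow_neg]
    field_simp
  have e3 : ∀ n : ℤ, (x / y) ^ (n + 1) * q ^ (-(n + 1) ^ 2) =
      (x / y) * q ^ (-(2 * n + 1)) * ((x / y) ^ n * q ^ (-n ^ 2)) := by
    intro n
    rw [zpow_add_one₀ (div_ne_zero hx hy),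
      show -(n + 1) ^ 2 = -(2 * n + 1) + -n ^ 2 by ring, zpow_add₀ hq0]
    ring
  have c : ∀ n : ℤ, (x / y) * q ^ (-(2 * n + 1)) ≠ 0 := fun n =>
    mul_ne_zero (div_ne_zero hx hy) (zpow_ne_zero _ hq0)
  induction n with
  | zero => simp
  | succ n ih => rw [step, ih, e3]; ring
  | pred n ih =>
    have h := step (-n - 1)
    have h' := e3 (-n - 1)
    rw [sub_add_cancel] at h h'
    rw [ih, h'] at h
    refine mul_left_cancel₀ (c (-n - 1)) ?_
    rw [← h]
    ring

/-! ### The kernel and its growth -/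

/-- The kernel `(u q^{1-n}, a u q^{1+n}; q)_∞`. -/
def ker (q a u : ℂ) (n : ℤ) : ℂ := qInf q (u * q ^ (1 - n)) * qInf q (a * u * q ^ (1 + n))

@[simp]
theorem ker_zero (q a : ℂ) (n : ℤ) : ker q a 0 n = 1 := by simp [ker]

theorem ker_neg {a : ℂ} (ha : a ≠ 0) (u : ℂ) (n : ℤ) :
    ker q a u (-n) = ker q a⁻¹ (a * u) n := by
  rw [ker, ker, mul_comm, inv_mul_cancel_left₀ ha, sub_neg_eq_add, ← sub_eq_add_neg]

theorem ker_div_q (hq0 : q ≠ 0) (hq : ‖q‖ < 1) (a u : ℂ) (n : ℤ) :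
    ker q a (u / q) n = (1 - u / q ^ n) * (1 - a * u * q ^ n) * ker q a u n := by
  have e1 : u / q * q ^ (1 - n) = u / q ^ n := by
    rw [zpow_sub₀ hq0]
    field_simp
  have e2 : a * (u / q) * q ^ (1 + n) = a * u * q ^ n := by
    rw [zpow_add₀ hq0]
    field_simp
  have e3 : u / q ^ n * q = u * q ^ (1 - n) := by
    rw [zpow_sub₀ hq0]
    field_simp
  have e4 : a * u * q ^ n * q = a * u * q ^ (1 + n) := by
    rw [zpow_add₀ hq0]
    field_simp
  rw [ker, ker, e1, e2, qInf_eq_mul q (u / q ^ n) hq, qInf_eq_mul q (a * u * q ^ n) hq, e3, e4]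
  ring

theorem tendsto_ker (hq : ‖q‖ < 1) {X : Type*} {l : Filter X} {f g : X → ℂ} {a u : ℂ}
    (hf : Tendsto f l (𝓝 a)) (hg : Tendsto g l (𝓝 u)) (n : ℤ) :
    Tendsto (fun x => ker q (f x) (g x) n) l (𝓝 (ker q a u n)) :=
  (((continuous_qInf hq).tendsto _).comp (hg.mul_const _)).mul
    (((continuous_qInf hq).tendsto _).comp ((hf.mul hg).mul_const _))

/-- Each step of `n` adds a factor of modulus at most `1 + X|q|⁻ⁿ = X|q|⁻ⁿ (1 + X⁻¹|q|ⁿ)`. The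
leading parts multiply to the stated exponential, and the corrections have a product bounded through
a geometric series. The bound is uniform on a disc, as dominated convergence requires. -/
theorem exists_norm_qInf_zpow_le (hq0 : q ≠ 0) (hq : ‖q‖ < 1) (U : ℝ) :
    ∃ C, 0 ≤ C ∧ ∀ x : ℂ, ‖x‖ ≤ Real.exp U → ∀ n : ℕ, ‖qInf q (x * q ^ (1 - n : ℤ))‖ ≤
      C * Real.exp (n * U - n * (n - 1) / 2 * Real.log ‖q‖) := by
  obtain ⟨M, hM0, hM⟩ := exists_norm_qInf_le hq (Real.exp U * ‖q‖)
  have hQ : 0 < ‖q‖ := norm_pos_iff.2 hq0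
  set X := Real.exp U with hX
  have hX0 : 0 < X := Real.exp_pos U
  have key : ∀ x : ℂ, ‖x‖ ≤ X → ∀ n : ℕ, ‖qInf q (x * q ^ (1 - n : ℤ))‖ ≤
      M * Real.exp (∑ k ∈ Finset.range n, X⁻¹ * ‖q‖ ^ k) *
        Real.exp (n * U - n * (n - 1) / 2 * Real.log ‖q‖) := by
    intro x hx n
    induction n with
    | zero =>
      simp only [Nat.cast_zero, sub_zero, zpow_one, Finset.range_zero, Finset.sum_empty,
        Real.exp_zero, mul_one, zero_mul, zero_div]
      apply hM
      rw [norm_mul]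
      gcongr
    | succ n ih =>
      have e : x * q ^ (1 - (n + 1 : ℕ) : ℤ) * q = x * q ^ (1 - n : ℤ) := by
        rw [mul_assoc, ← zpow_add_one₀ hq0]
        push_cast
        ring_nf
      rw [qInf_eq_mul q _ hq, e, norm_mul, Finset.sum_range_succ, Real.exp_add]
      have h1 : ‖1 - x * q ^ (1 - (n + 1 : ℕ) : ℤ)‖ ≤
          Real.exp (X⁻¹ * ‖q‖ ^ n) * Real.exp (U - n * Real.log ‖q‖) := by
        have e1 : Real.exp (U - n * Real.log ‖q‖) = X * (‖q‖ ^ n)⁻¹ := by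
          rw [Real.exp_sub, mul_comm (n : ℝ), Real.exp_mul, Real.exp_log hQ, Real.rpow_natCast]
          rfl
        have e2 : x * q ^ (1 - (n + 1 : ℕ) : ℤ) = x * (q ^ n)⁻¹ := by
          rw [← zpow_natCast, ← zpow_neg]
          congr 2
          push_cast
          ring
        rw [e1, e2]
        calc ‖1 - x * (q ^ n)⁻¹‖ ≤ 1 + X * (‖q‖ ^ n)⁻¹ := by
              refine (norm_sub_le _ _).trans ?_
              rw [norm_one, norm_mul, norm_inv, norm_pow]
              gcongr
          _ = (X⁻¹ * ‖q‖ ^ n + 1) * (X * (‖q‖ ^ n)⁻¹) := by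
              field_simp
          _ ≤ _ := by
              gcongr
              exact Real.add_one_le_exp _
      calc _ ≤ _ := mul_le_mul h1 ih (norm_nonneg _) (by positivity)
        _ = M * (Real.exp (∑ k ∈ Finset.range n, X⁻¹ * ‖q‖ ^ k) * Real.exp (X⁻¹ * ‖q‖ ^ n)) *
            (Real.exp (U - n * Real.log ‖q‖) *
              Real.exp (n * U - n * (n - 1) / 2 * Real.log ‖q‖)) := by ring
        _ = _ := by
            rw [← Real.exp_add (U - _)]
            congr 2
            push_cast
            ring
  refine ⟨M * Real.exp (X⁻¹ * (1 - ‖q‖)⁻¹), by positivity, fun x hx n => (key x hx n).trans ?_⟩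
  gcongr
  rw [← Finset.mul_sum]
  gcongr
  rw [← tsum_geometric_of_lt_one (norm_nonneg q) hq]
  exact (summable_geometric_of_lt_one (norm_nonneg q) hq).sum_le_tsum _ (fun _ _ => by positivity)

/-- For `n ≥ 0` only the first factor of the kernel grows, for `n ≤ 0` only the second. Writing both
cases with `|n|` isolates the part `-nA/2 - n²/2 · log|q|`, which is additive over kernels and
cancels exactly against the powers of `a` and `q` in the series. -/
theorem exists_norm_ker_le (hq0 : q ≠ 0) (hq : ‖q‖ < 1) (A U : ℝ) :
    ∃ C, 0 ≤ C ∧ ∀ a u : ℂ, ‖a‖ = Real.exp A → ‖u‖ ≤ Real.exp U → ∀ n : ℤ,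
      ‖ker q a u n‖ ≤ C * Real.exp (|(n : ℝ)| * (U + (A + Real.log ‖q‖) / 2)
        - n * A / 2 - n ^ 2 / 2 * Real.log ‖q‖) := by
  obtain ⟨C₁, hC₁, h₁⟩ := exists_norm_qInf_zpow_le hq0 hq U
  obtain ⟨C₂, hC₂, h₂⟩ := exists_norm_qInf_zpow_le hq0 hq (A + U)
  obtain ⟨M₁, hM₁, k₁⟩ := exists_norm_qInf_le hq (Real.exp U)
  obtain ⟨M₂, hM₂, k₂⟩ := exists_norm_qInf_le hq (Real.exp (A + U))
  refine ⟨C₁ * M₂ + C₂ * M₁, by positivity, fun a u ha hu n => ?_⟩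
  have hau : ‖a * u‖ ≤ Real.exp (A + U) := by
    rw [norm_mul, ha, Real.exp_add]
    gcongr
  have small : ∀ (x : ℂ) (R : ℝ) (k : ℕ), ‖x‖ ≤ R → ‖x * q ^ (1 + k : ℤ)‖ ≤ R := by
    intro x R k hx
    refine le_trans ?_ hx
    have : q ^ (1 + k : ℤ) = q ^ (1 + k) := by norm_cast
    rw [this, norm_mul, norm_pow]
    exact mul_le_of_le_one_right (norm_nonneg _) (pow_le_one₀ (norm_nonneg _) hq.le)
  obtain ⟨k, rfl | rfl⟩ := n.eq_nat_or_neg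
  · rw [ker, norm_mul]
    have e : |((k : ℤ) : ℝ)| * (U + (A + Real.log ‖q‖) / 2) - ((k : ℤ) : ℝ) * A / 2
        - ((k : ℤ) : ℝ) ^ 2 / 2 * Real.log ‖q‖ = k * U - k * (k - 1) / 2 * Real.log ‖q‖ := by
      push_cast
      rw [abs_of_nonneg (by positivity)]
      ring
    rw [e]
    calc _ ≤ _ := mul_le_mul (h₁ u hu k) (k₂ _ (small _ _ k hau)) (norm_nonneg _) (by positivity)
      _ ≤ _ := by
        rw [add_mul]
        have : 0 ≤ C₂ * M₁ * Real.exp (k * U - k * (k - 1) / 2 * Real.log ‖q‖) := by positivity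
        linarith
  · rw [ker, norm_mul, sub_neg_eq_add, ← sub_eq_add_neg]
    have e : |((-k : ℤ) : ℝ)| * (U + (A + Real.log ‖q‖) / 2) - ((-k : ℤ) : ℝ) * A / 2
        - ((-k : ℤ) : ℝ) ^ 2 / 2 * Real.log ‖q‖ =
        k * (A + U) - k * (k - 1) / 2 * Real.log ‖q‖ := by
      push_cast
      rw [abs_neg, abs_of_nonneg (by positivity)]
      ring
    rw [e]
    calc _ ≤ _ := mul_le_mul (k₁ _ (small _ _ k hu)) (h₂ _ hau k) (norm_nonneg _) (by positivity)
      _ ≤ _ := by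
        rw [add_mul]
        have : 0 ≤ C₁ * M₂ * Real.exp (k * (A + U) - k * (k - 1) / 2 * Real.log ‖q‖) := by
          positivity
        linarith

theorem summable_exp_neg_abs {δ : ℝ} (hδ : δ < 0) :
    Summable fun n : ℤ => Real.exp (δ * |(n : ℝ)|) := by
  have h : Summable fun n : ℕ => Real.exp (δ * n) := by
    have := summable_geometric_of_lt_one (Real.exp_pos δ).le (Real.exp_lt_one_iff.2 hδ)
    refine this.congr fun n => ?_
    rw [mul_comm, Real.exp_nat_mul]
  refine Summable.of_nat_of_neg ?_ ?_ <;> simpa using h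

theorem norm_zpow_eq_exp {x : ℂ} {X : ℝ} (hx : ‖x‖ = Real.exp X) (n : ℤ) :
    ‖x ^ n‖ = Real.exp (n * X) := by
  rw [norm_zpow, hx, mul_comm, Real.exp_mul, Real.rpow_intCast]

theorem norm_eq_exp_log {x : ℂ} (hx : x ≠ 0) : ‖x‖ = Real.exp (Real.log ‖x‖) :=
  (Real.exp_log (norm_pos_iff.2 hx)).symm

theorem norm_mul_le_exp {x y : ℂ} {C D X Y : ℝ} (hC : 0 ≤ C) (hx : ‖x‖ ≤ C * Real.exp X)
    (hy : ‖y‖ ≤ D * Real.exp Y) : ‖x * y‖ ≤ C * D * Real.exp (X + Y) := by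
  rw [norm_mul, Real.exp_add]
  calc _ ≤ _ := mul_le_mul hx hy (norm_nonneg _) (by positivity)
    _ = _ := by ring

theorem norm_vwp_factor_le (hq0 : q ≠ 0) (hq : ‖q‖ < 1) {a : ℂ} {A : ℝ} (ha : ‖a‖ = Real.exp A)
    (n : ℤ) : ‖(1 - a * q ^ (2 * n)) * q ^ (-n)‖ ≤
      (1 + Real.exp A) * Real.exp (-(|(n : ℝ)| * Real.log ‖q‖)) := by
  have hl : Real.log ‖q‖ ≤ 0 := Real.log_nonpos (norm_nonneg _) hq.le
  have e : (1 - a * q ^ (2 * n)) * q ^ (-n) = q ^ (-n) - a * q ^ n := by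
    rw [sub_mul, one_mul, mul_assoc, ← zpow_add₀ hq0]
    congr 3
    ring
  have h1 := norm_zpow_eq_exp (norm_eq_exp_log hq0) (-n)
  have h2 := norm_zpow_eq_exp (norm_eq_exp_log hq0) n
  have b1 : ‖q ^ (-n)‖ ≤ Real.exp (-(|(n : ℝ)| * Real.log ‖q‖)) := by
    rw [h1]
    apply Real.exp_le_exp.2
    push_cast
    nlinarith [le_abs_self (n : ℝ)]
  have b2 : ‖q ^ n‖ ≤ Real.exp (-(|(n : ℝ)| * Real.log ‖q‖)) := by
    rw [h2]
    apply Real.exp_le_exp.2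
    nlinarith [neg_abs_le (n : ℝ)]
  rw [e]
  refine (norm_sub_le _ _).trans ?_
  rw [norm_mul, ha, add_mul, one_mul]
  gcongr

/-! ### Bailey's ₆ψ₆ summation -/

/-- The general term of the normalised `₆ψ₆` series. -/
def term4 (q a u₁ u₂ u₃ u₄ : ℂ) (n : ℤ) : ℂ :=
  (1 - a * q ^ (2 * n)) * q ^ (-n) * (a ^ (2 * n) * q ^ (2 * n ^ 2)) *
    (ker q a u₁ n * ker q a u₂ n * ker q a u₃ n * ker q a u₄ n)

/-- The very-well-poised `₆ψ₆` series with parameters `1/uᵢ`, normalised to be entire in `uᵢ`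
near the origin. -/
def sum4 (q a u₁ u₂ u₃ u₄ : ℂ) : ℂ := ∑' n : ℤ, term4 q a u₁ u₂ u₃ u₄ n

/-- The Gaussian `a^{2n} q^{2n²}` absorbs the quadratic growth of exactly four kernels, leaving a
pure exponential in `|n|`. The very-well-poised factor is left out because the telescoping quantity
of the contiguous relation does not contain it. -/
theorem exists_norm_core4_le (hq0 : q ≠ 0) (hq : ‖q‖ < 1) (A U₁ U₂ U₃ U₄ : ℝ) :
    ∃ C, 0 ≤ C ∧ ∀ a u₁ u₂ u₃ u₄ : ℂ, ‖a‖ = Real.exp A → ‖u₁‖ ≤ Real.exp U₁ →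
      ‖u₂‖ ≤ Real.exp U₂ → ‖u₃‖ ≤ Real.exp U₃ → ‖u₄‖ ≤ Real.exp U₄ → ∀ n : ℤ,
      ‖a ^ (2 * n) * q ^ (2 * n ^ 2) *
        (ker q a u₁ n * ker q a u₂ n * ker q a u₃ n * ker q a u₄ n)‖ ≤
      C * Real.exp ((U₁ + U₂ + U₃ + U₄ + 2 * A + 2 * Real.log ‖q‖) * |(n : ℝ)|) := by
  obtain ⟨C₁, p₁, h₁⟩ := exists_norm_ker_le hq0 hq A U₁
  obtain ⟨C₂, p₂, h₂⟩ := exists_norm_ker_le hq0 hq A U₂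
  obtain ⟨C₃, p₃, h₃⟩ := exists_norm_ker_le hq0 hq A U₃
  obtain ⟨C₄, p₄, h₄⟩ := exists_norm_ker_le hq0 hq A U₄
  refine ⟨1 * 1 * (C₁ * C₂ * C₃ * C₄), by positivity, fun a u₁ u₂ u₃ u₄ ha k₁ k₂ k₃ k₄ n => ?_⟩
  have b1 := (norm_zpow_eq_exp ha (2 * n)).le.trans_eq (one_mul _).symm
  have b2 := (norm_zpow_eq_exp (norm_eq_exp_log hq0) (2 * n ^ 2)).le.trans_eq (one_mul _).symm
  have b3 := norm_mul_le_exp (by positivity) (norm_mul_le_exp (by positivity)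
    (norm_mul_le_exp p₁ (h₁ a u₁ ha k₁ n) (h₂ a u₂ ha k₂ n))
    (h₃ a u₃ ha k₃ n)) (h₄ a u₄ ha k₄ n)
  refine (norm_mul_le_exp (by positivity) (norm_mul_le_exp (by positivity) b1 b2) b3).trans_eq ?_
  congr 2
  push_cast
  ring

theorem exists_norm_term4_le (hq0 : q ≠ 0) (hq : ‖q‖ < 1) (A U₁ U₂ U₃ U₄ : ℝ) :
    ∃ C, 0 ≤ C ∧ ∀ a u₁ u₂ u₃ u₄ : ℂ, ‖a‖ = Real.exp A → ‖u₁‖ ≤ Real.exp U₁ →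
      ‖u₂‖ ≤ Real.exp U₂ → ‖u₃‖ ≤ Real.exp U₃ → ‖u₄‖ ≤ Real.exp U₄ → ∀ n : ℤ,
      ‖term4 q a u₁ u₂ u₃ u₄ n‖ ≤
      C * Real.exp ((U₁ + U₂ + U₃ + U₄ + 2 * A + Real.log ‖q‖) * |(n : ℝ)|) := by
  obtain ⟨C, p, h⟩ := exists_norm_core4_le hq0 hq A U₁ U₂ U₃ U₄
  refine ⟨(1 + Real.exp A) * C, by positivity, fun a u₁ u₂ u₃ u₄ ha k₁ k₂ k₃ k₄ n => ?_⟩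
  rw [term4, mul_assoc]
  refine (norm_mul_le_exp (by positivity) (norm_vwp_factor_le hq0 hq ha n)
    (h a u₁ u₂ u₃ u₄ ha k₁ k₂ k₃ k₄ n)).trans_eq ?_
  congr 2
  ring

/-- Some `uᵢ` may be zero, where `log ‖uᵢ‖` is useless. Since the convergence condition is strict,
every `‖uᵢ‖` can be enlarged by a small `ε`. -/
theorem exists_log_bounds4 {a u₁ u₂ u₃ u₄ : ℂ} (ha : a ≠ 0) (hq0 : q ≠ 0)
    (h : ‖a ^ 2 * q * (u₁ * u₂ * u₃ * u₄)‖ < 1) :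
    ∃ U₁ U₂ U₃ U₄ : ℝ, ‖u₁‖ ≤ Real.exp U₁ ∧ ‖u₂‖ ≤ Real.exp U₂ ∧ ‖u₃‖ ≤ Real.exp U₃ ∧
      ‖u₄‖ ≤ Real.exp U₄ ∧ U₁ + U₂ + U₃ + U₄ + 2 * Real.log ‖a‖ + Real.log ‖q‖ < 0 := by
  have hc : Continuous fun ε : ℝ => ‖a‖ ^ 2 * ‖q‖ *
      ((‖u₁‖ + ε) * (‖u₂‖ + ε) * (‖u₃‖ + ε) * (‖u₄‖ + ε)) := by fun_prop
  have hev : ∀ᶠ ε in 𝓝[>] (0 : ℝ), ‖a‖ ^ 2 * ‖q‖ *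
      ((‖u₁‖ + ε) * (‖u₂‖ + ε) * (‖u₃‖ + ε) * (‖u₄‖ + ε)) < 1 := by
    refine (hc.tendsto 0).mono_left nhdsWithin_le_nhds |>.eventually_lt_const ?_
    simpa [norm_mul, norm_pow] using h
  obtain ⟨ε, h1, h2⟩ := (hev.and self_mem_nhdsWithin).exists
  have hε : 0 < ε := h2
  have ha' := norm_pos_iff.2 ha
  have hq' := norm_pos_iff.2 hq0
  have key : ∀ u : ℂ, 0 < ‖u‖ + ε ∧ ‖u‖ ≤ Real.exp (Real.log (‖u‖ + ε)) := fun u => by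
    have : 0 < ‖u‖ + ε := by positivity
    refine ⟨this, ?_⟩
    rw [Real.exp_log this]
    linarith
  refine ⟨_, _, _, _, (key u₁).2, (key u₂).2, (key u₃).2, (key u₄).2, ?_⟩
  have p₁ := (key u₁).1
  have p₂ := (key u₂).1
  have p₃ := (key u₃).1
  have p₄ := (key u₄).1
  have := Real.log_neg (by positivity) h1
  rw [Real.log_mul (by positivity) (by positivity), Real.log_mul (by positivity) (by positivity),
    Real.log_mul (by positivity) (by positivity), Real.log_mul (by positivity) (by positivity),
    Real.log_mul (by positivity) (by positivity), Real.log_pow] at this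
  push_cast at this
  linarith

theorem summable_term4 (hq0 : q ≠ 0) (hq : ‖q‖ < 1) {a u₁ u₂ u₃ u₄ : ℂ} (ha : a ≠ 0)
    (h : ‖a ^ 2 * q * (u₁ * u₂ * u₃ * u₄)‖ < 1) : Summable (term4 q a u₁ u₂ u₃ u₄) := by
  obtain ⟨U₁, U₂, U₃, U₄, k₁, k₂, k₃, k₄, hU⟩ := exists_log_bounds4 ha hq0 h
  obtain ⟨C, -, hC⟩ := exists_norm_term4_le hq0 hq (Real.log ‖a‖) U₁ U₂ U₃ U₄
  exact Summable.of_norm_bounded ((summable_exp_neg_abs hU).mul_left C)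
    (hC a u₁ u₂ u₃ u₄ (norm_eq_exp_log ha) k₁ k₂ k₃ k₄)

theorem tendsto_sum4_zero (hq0 : q ≠ 0) (hq : ‖q‖ < 1) {a u₁ u₂ u₃ u₄ : ℂ} (ha : a ≠ 0)
    (h : ‖a ^ 2 * q * (u₁ * u₂ * u₃ * u₄)‖ < 1) :
    Tendsto (fun N : ℕ => sum4 q a (u₁ * q ^ N) u₂ u₃ u₄) atTop (𝓝 (sum4 q a 0 u₂ u₃ u₄)) := by
  obtain ⟨U₁, U₂, U₃, U₄, k₁, k₂, k₃, k₄, hU⟩ := exists_log_bounds4 ha hq0 h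
  obtain ⟨C, -, hC⟩ := exists_norm_term4_le hq0 hq (Real.log ‖a‖) U₁ U₂ U₃ U₄
  refine tendsto_tsum_of_dominated_convergence ((summable_exp_neg_abs hU).mul_left C) ?_ ?_
  · intro n
    have := (tendsto_pow_atTop_nhds_zero_of_norm_lt_one hq).const_mul u₁
    rw [mul_zero] at this
    exact ((((tendsto_ker hq tendsto_const_nhds this n).mul_const _).mul_const _).mul_const
      _).const_mul _
  · refine Eventually.of_forall fun N n => hC a _ u₂ u₃ u₄ (norm_eq_exp_log ha) ?_ k₂ k₃ k₄ n
    refine le_trans ?_ k₁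
    rw [norm_mul, norm_pow]
    exact mul_le_of_le_one_right (norm_nonneg _) (pow_le_one₀ (norm_nonneg _) hq.le)

theorem ker_mul_q_div_q (hq0 : q ≠ 0) (hq : ‖q‖ < 1) (a u : ℂ) (n : ℤ) :
    ker q (a * q) (u / q) n = (1 - u / q ^ n) * ker q a u n := by
  have e1 : u / q * q ^ (1 - n) = u / q ^ n := by
    rw [zpow_sub₀ hq0]
    field_simp
  have e2 : a * q * (u / q) = a * u := by field_simp
  have e3 : u / q ^ n * q = u * q ^ (1 - n) := by
    rw [zpow_sub₀ hq0]
    field_simp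
  rw [ker, ker, e1, e2, qInf_eq_mul q (u / q ^ n) hq, e3]
  ring

theorem ker_mul_q_div_q_sub_one (hq0 : q ≠ 0) (hq : ‖q‖ < 1) (a u : ℂ) (n : ℤ) :
    ker q (a * q) (u / q) (n - 1) = (1 - a * u * q ^ n) * ker q a u n := by
  have e1 : u / q * q ^ (1 - (n - 1)) = u * q ^ (1 - n) := by
    rw [show 1 - (n - 1) = 1 - n + 1 by ring, zpow_add_one₀ hq0]
    field_simp
  have e2 : a * q * (u / q) * q ^ (1 + (n - 1)) = a * u * q ^ n := by
    rw [add_sub_cancel]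
    field_simp
  have e3 : a * u * q ^ n * q = a * u * q ^ (1 + n) := by
    rw [zpow_add₀ hq0]
    field_simp
  rw [ker, ker, e1, e2, qInf_eq_mul q (a * u * q ^ n) hq, e3]
  ring

theorem tsum_sub_shift_eq_zero {T : ℤ → ℂ} (hT : Summable T) : ∑' n, (T n - T (n - 1)) = 0 := by
  have h1 : Summable fun n => T (n - 1) := (Equiv.subRight (1 : ℤ)).summable_iff.2 hT
  rw [hT.tsum_sub h1, sub_eq_zero]
  exact ((Equiv.subRight (1 : ℤ)).tsum_eq T).symm

/-- A suitable combination of the two summands is the difference `T n - T (n - 1)`, where `T` is the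
core of a ₆ψ₆ with base `aq` and parameters `uᵢ/q`. Summed over all integers, the difference
contributes nothing. -/
theorem sum4_contiguous (hq0 : q ≠ 0) (hq : ‖q‖ < 1) {a u₁ u₂ u₃ u₄ : ℂ} (ha : a ≠ 0)
    (h : ‖a ^ 2 * (u₁ * u₂ * u₃ * u₄)‖ < 1) :
    (1 - a ^ 2 * (u₁ * u₂ * u₃ * u₄)) * sum4 q a (u₁ / q) u₂ u₃ u₄ =
      (1 - a * u₁ * u₂) * (1 - a * u₁ * u₃) * (1 - a * u₁ * u₄) * sum4 q a u₁ u₂ u₃ u₄ := by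
  set T : ℤ → ℂ := fun n => (a * q) ^ (2 * n) * q ^ (2 * n ^ 2) *
    (ker q (a * q) (u₁ / q) n * ker q (a * q) (u₂ / q) n * ker q (a * q) (u₃ / q) n *
      ker q (a * q) (u₄ / q) n) with hTdef
  have haq : a * q ≠ 0 := mul_ne_zero ha hq0
  have e0 : a ^ 2 * q * (u₁ / q * u₂ * u₃ * u₄) = a ^ 2 * (u₁ * u₂ * u₃ * u₄) := by
    field_simp
  have e1 : (a * q) ^ 2 * q * (u₁ / q * (u₂ / q) * (u₃ / q) * (u₄ / q)) * q =
      a ^ 2 * (u₁ * u₂ * u₃ * u₄) := by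
    field_simp
  have hs1 : Summable (term4 q a (u₁ / q) u₂ u₃ u₄) :=
    summable_term4 hq0 hq ha (by rwa [e0])
  have hs2 : Summable (term4 q a u₁ u₂ u₃ u₄) := by
    refine summable_term4 hq0 hq ha ?_
    rw [show a ^ 2 * q * (u₁ * u₂ * u₃ * u₄) = a ^ 2 * (u₁ * u₂ * u₃ * u₄) * q by ring, norm_mul]
    exact mul_lt_one_of_nonneg_of_lt_one_left (norm_nonneg _) h hq.le
  -- Replacing `a` by `aq` and each `uᵢ` by `uᵢ/q` changes the exponent of `exists_norm_core4_le` to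
  -- the one controlled by `hV`; the bound `V₁` already belongs to `u₁/q`.
  have hT : Summable T := by
    obtain ⟨V₁, V₂, V₃, V₄, k₁, k₂, k₃, k₄, hV⟩ :=
      exists_log_bounds4 (u₁ := u₁ / q) (u₂ := u₂) (u₃ := u₃) (u₄ := u₄) ha hq0 (by rwa [e0])
    have hl : ∀ u V, ‖u‖ ≤ Real.exp V → ‖u / q‖ ≤ Real.exp (V - Real.log ‖q‖) := by
      intro u V hu
      rw [norm_div, Real.exp_sub, Real.exp_log (norm_pos_iff.2 hq0)]
      gcongr
    obtain ⟨C, -, hC⟩ := exists_norm_core4_le hq0 hq (Real.log ‖a * q‖) V₁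
      (V₂ - Real.log ‖q‖) (V₃ - Real.log ‖q‖) (V₄ - Real.log ‖q‖)
    refine Summable.of_norm_bounded ((summable_exp_neg_abs (δ := _) ?_).mul_left C)
      (hC (a * q) _ _ _ _ (norm_eq_exp_log haq) k₁ (hl _ _ k₂) (hl _ _ k₃) (hl _ _ k₄))
    rw [norm_mul, Real.log_mul (norm_ne_zero_iff.2 ha) (norm_ne_zero_iff.2 hq0)]
    linarith
  have key : ∀ n, a ^ 2 * u₁ * (T n - T (n - 1)) =
      (1 - a ^ 2 * (u₁ * u₂ * u₃ * u₄)) * term4 q a (u₁ / q) u₂ u₃ u₄ n -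
      (1 - a * u₁ * u₂) * (1 - a * u₁ * u₃) * (1 - a * u₁ * u₄) * term4 q a u₁ u₂ u₃ u₄ n := by
    intro n
    have hn : q ^ n ≠ 0 := zpow_ne_zero _ hq0
    have p1 : (a * q) ^ (2 * n) = a ^ (2 * n) * (q ^ n) ^ 2 := by
      rw [mul_zpow, mul_comm 2 n, zpow_mul q, zpow_ofNat]
    have p2 : (a * q) ^ (2 * (n - 1)) = a ^ (2 * n) * (q ^ n) ^ 2 / (a ^ 2 * q ^ 2) := by
      rw [mul_sub, mul_one, zpow_sub₀ haq, p1, zpow_ofNat, mul_pow]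
    have p3 : q ^ (2 * (n - 1) ^ 2) = q ^ (2 * n ^ 2) * q ^ 2 / (q ^ n) ^ 4 := by
      rw [show 2 * (n - 1) ^ 2 = 2 * n ^ 2 + 2 - n * 4 by ring, zpow_sub₀ hq0, zpow_add₀ hq0,
        zpow_mul q n 4, zpow_ofNat, zpow_ofNat]
    have p4 : q ^ (2 * n) = (q ^ n) ^ 2 := by rw [mul_comm 2 n, zpow_mul, zpow_ofNat]
    simp only [hTdef, term4, ker_mul_q_div_q_sub_one hq0 hq, p2, p3]
    simp only [ker_mul_q_div_q hq0 hq, ker_div_q hq0 hq, p1, p4, zpow_neg]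
    field_simp
    ring
  have := tsum_sub_shift_eq_zero hT
  have h2 : ∑' n, a ^ 2 * u₁ * (T n - T (n - 1)) = 0 := by rw [tsum_mul_left, this, mul_zero]
  rw [tsum_congr key, (hs1.mul_left _).tsum_sub (hs2.mul_left _), tsum_mul_left, tsum_mul_left,
    sub_eq_zero] at h2
  exact h2

theorem tendsto_prod_qInf (hq : ‖q‖ < 1) (x : ℂ) :
    Tendsto (fun N => ∏ k ∈ Finset.range N, (1 - x * q ^ k)) atTop (𝓝 (qInf q x)) := by
  have h := multipliable_one_add_of_summable (summable_norm_mul_pow hq x)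
  simp only [← sub_eq_add_neg] at h
  exact h.tendsto_prod_tprod_nat

/-- Iterating the contiguous relation drives `u₁` to `0` along `u₁ q^N`, and the linear factors
accumulate to infinite products. This removes one parameter from the sum. -/
theorem sum4_mul_qInf (hq0 : q ≠ 0) (hq : ‖q‖ < 1) {a u₁ u₂ u₃ u₄ : ℂ} (ha : a ≠ 0)
    (h : ‖a ^ 2 * q * (u₁ * u₂ * u₃ * u₄)‖ < 1) :
    sum4 q a u₁ u₂ u₃ u₄ * qInf q (a ^ 2 * q * (u₁ * u₂ * u₃ * u₄)) =
      qInf q (a * q * u₁ * u₂) * qInf q (a * q * u₁ * u₃) * qInf q (a * q * u₁ * u₄) *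
        sum4 q a 0 u₂ u₃ u₄ := by
  have step : ∀ N : ℕ, sum4 q a u₁ u₂ u₃ u₄ *
      (∏ k ∈ Finset.range N, (1 - a ^ 2 * q * (u₁ * u₂ * u₃ * u₄) * q ^ k)) =
      (∏ k ∈ Finset.range N, (1 - a * q * u₁ * u₂ * q ^ k)) *
      (∏ k ∈ Finset.range N, (1 - a * q * u₁ * u₃ * q ^ k)) *
      (∏ k ∈ Finset.range N, (1 - a * q * u₁ * u₄ * q ^ k)) * sum4 q a (u₁ * q ^ N) u₂ u₃ u₄ := by
    intro N
    induction N with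
    | zero => simp
    | succ N ih =>
      have hc := sum4_contiguous hq0 hq (u₁ := u₁ * q ^ (N + 1)) (u₂ := u₂) (u₃ := u₃) (u₄ := u₄)
        ha (by
          rw [show a ^ 2 * (u₁ * q ^ (N + 1) * u₂ * u₃ * u₄) =
            a ^ 2 * q * (u₁ * u₂ * u₃ * u₄) * q ^ N by ring, norm_mul, norm_pow]
          exact mul_lt_one_of_nonneg_of_lt_one_left (norm_nonneg _) h
            (pow_le_one₀ (norm_nonneg _) hq.le))
      have e : u₁ * q ^ (N + 1) / q = u₁ * q ^ N := by
        rw [pow_succ]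
        field_simp
      rw [e] at hc
      simp only [Finset.prod_range_succ]
      rw [← mul_assoc, ih]
      linear_combination ((∏ k ∈ Finset.range N, (1 - a * q * u₁ * u₂ * q ^ k)) *
      (∏ k ∈ Finset.range N, (1 - a * q * u₁ * u₃ * q ^ k)) *
      (∏ k ∈ Finset.range N, (1 - a * q * u₁ * u₄ * q ^ k))) * hc
  refine tendsto_nhds_unique ((tendsto_prod_qInf hq _).const_mul _) ?_
  simp only [step]
  exact (((tendsto_prod_qInf hq _).mul (tendsto_prod_qInf hq _)).mul
    (tendsto_prod_qInf hq _)).mul (tendsto_sum4_zero hq0 hq ha h)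

theorem sum4_perm (q a u₁ u₂ u₃ u₄ : ℂ) : sum4 q a u₁ u₂ u₃ u₄ = sum4 q a u₂ u₃ u₄ u₁ :=
  tsum_congr fun n => by
    rw [term4, term4]
    ring

/-- The kernel of `u = a⁻¹` vanishes for `n < 0` and that of `u = 1` for `n > 0`, so only the term
`n = 0` survives. -/
theorem sum4_inv_one (hq0 : q ≠ 0) (hq : ‖q‖ < 1) {a : ℂ} (ha : a ≠ 0) :
    sum4 q a a⁻¹ 1 0 0 = qInf q q * qInf q q * theta q a := by
  have hpos : ∀ k : ℕ, qInf q (q ^ (1 - ((k : ℤ) + 1))) = 0 := fun k => by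
    refine qInf_eq_zero (k := k) hq ?_
    rw [← zpow_natCast, ← zpow_add₀ hq0]
    simp
  rw [sum4, tsum_eq_single 0]
  · simp only [term4, ker, theta]
    rw [qInf_eq_mul q a hq]
    simp [ha]
    ring_nf
  · intro n hn
    rcases lt_or_gt_of_ne hn with h | h
    · obtain ⟨k, rfl⟩ : ∃ k : ℕ, n = -((k : ℤ) + 1) := ⟨(-n - 1).toNat, by omega⟩
      have : ker q a a⁻¹ (-((k : ℤ) + 1)) = 0 := by
        rw [ker, mul_inv_cancel₀ ha, one_mul, ← sub_eq_add_neg, hpos, mul_zero]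
      rw [term4, this]
      simp
    · obtain ⟨k, rfl⟩ : ∃ k : ℕ, n = (k : ℤ) + 1 := ⟨(n - 1).toNat, by omega⟩
      have : ker q a 1 ((k : ℤ) + 1) = 0 := by
        rw [ker, one_mul, hpos, zero_mul]
      rw [term4, this]
      simp

/-- The one-term sum of `sum4_inv_one` is reduced to the parameter-free sum by sending first `a⁻¹`,
then `1`, to zero. The first reduction costs the factor `(q;q)_∞`, the second costs nothing. -/
theorem sum4_zero (hq0 : q ≠ 0) (hq : ‖q‖ < 1) {a : ℂ} (ha : a ≠ 0) :
    sum4 q a 0 0 0 0 = qInf q q * theta q a := by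
  have h1 := sum4_mul_qInf hq0 hq (u₁ := a⁻¹) (u₂ := 1) (u₃ := 0) (u₄ := 0) ha (by simp)
  have h2 := sum4_mul_qInf hq0 hq (u₁ := 1) (u₂ := 0) (u₃ := 0) (u₄ := 0) ha (by simp)
  rw [sum4_inv_one hq0 hq ha, sum4_perm q a 0 1 0 0] at h1
  have e : a * q * a⁻¹ * 1 = q := by field_simp
  simp only [mul_zero, qInf_zero, mul_one, one_mul, e] at h1 h2
  rw [h2] at h1
  have hqq : qInf q q ≠ 0 := qInf_ne_zero_of_norm_lt hq hq
  refine mul_left_cancel₀ hqq ?_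
  rw [← h1, mul_assoc]

/-- Bailey's `₆ψ₆` summation. -/
theorem sum4_eq (hq0 : q ≠ 0) (hq : ‖q‖ < 1) {a u₁ u₂ u₃ u₄ : ℂ} (ha : a ≠ 0)
    (h : ‖a ^ 2 * q * (u₁ * u₂ * u₃ * u₄)‖ < 1) :
    sum4 q a u₁ u₂ u₃ u₄ * qInf q (a ^ 2 * q * (u₁ * u₂ * u₃ * u₄)) =
      qInf q q * theta q a * (qInf q (a * q * u₁ * u₂) * qInf q (a * q * u₁ * u₃) *
        qInf q (a * q * u₁ * u₄) * qInf q (a * q * u₂ * u₃) * qInf q (a * q * u₂ * u₄) *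
        qInf q (a * q * u₃ * u₄)) := by
  -- After `u₁` has been removed, the other parameters go to zero in turn. Each elimination yields
  -- the pair products with the parameters still present and, as one of the four slots is now `0`,
  -- no further factor on the left.
  have h2 := sum4_mul_qInf hq0 hq (u₁ := u₂) (u₂ := u₃) (u₃ := u₄) (u₄ := 0) ha (by simp)
  have h3 := sum4_mul_qInf hq0 hq (u₁ := u₃) (u₂ := u₄) (u₃ := 0) (u₄ := 0) ha (by simp)
  have h4 := sum4_mul_qInf hq0 hq (u₁ := u₄) (u₂ := 0) (u₃ := 0) (u₄ := 0) ha (by simp)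
  simp only [mul_zero, qInf_zero, mul_one, one_mul] at h2 h3 h4
  rw [sum4_mul_qInf hq0 hq ha h, sum4_perm q a 0, h2, sum4_perm q a 0, h3, sum4_perm q a 0, h4,
    sum4_zero hq0 hq ha]
  ring

/-! ### Triple product and Weierstrass addition formula -/

theorem tsum_eq_add_of_compl {α β : Type*} {f : α → ℂ} (hf : Summable f) {e₀ e₁ : β → α}
    (h₀ : Function.Injective e₀) (h₁ : Function.Injective e₁) (hd : ∀ b c, e₀ b ≠ e₁ c)
    (hc : ∀ a, (∃ b, e₀ b = a) ∨ ∃ b, e₁ b = a) :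
    ∑' a, f a = ∑' b, f (e₀ b) + ∑' b, f (e₁ b) := by
  have hcompl : IsCompl (Set.range e₀) (Set.range e₁) := by
    refine ⟨Set.disjoint_left.2 ?_, codisjoint_iff.2 (Set.eq_univ_of_forall hc)⟩
    rintro _ ⟨b, rfl⟩ ⟨c, hc⟩
    exact hd b c hc.symm
  exact ((h₀.hasSum_range_iff.2 (hf.comp_injective h₀).hasSum).add_isCompl hcompl
    (h₁.hasSum_range_iff.2 (hf.comp_injective h₁).hasSum)).tsum_eq

theorem summable_exp_quadratic {μ : ℝ} (hμ : μ < 0) (B : ℝ) :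
    Summable fun n : ℤ => Real.exp (μ * (n : ℝ) ^ 2 + B * |(n : ℝ)|) := by
  refine Summable.of_nonneg_of_le (fun _ => (Real.exp_pos _).le) (fun n => ?_)
    ((summable_exp_neg_abs (δ := -1) (by norm_num)).mul_left
      (Real.exp ((B + 1) ^ 2 / (-4 * μ))))
  rw [← Real.exp_add]
  apply Real.exp_le_exp.2
  have h : (B + 1) ^ 2 / (-4 * μ) - (B + 1) * |(n : ℝ)| - μ * |(n : ℝ)| ^ 2 =
      (B + 1 + 2 * μ * |(n : ℝ)|) ^ 2 / (-4 * μ) := by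
    have := hμ.ne
    field_simp
    ring
  have h2 : 0 ≤ (B + 1 + 2 * μ * |(n : ℝ)|) ^ 2 / (-4 * μ) :=
    div_nonneg (sq_nonneg _) (by linarith)
  rw [sq_abs] at h
  linarith

theorem summable_norm_zpow_quadratic (hq0 : q ≠ 0) (hq : ‖q‖ < 1) {x : ℂ} (hx : x ≠ 0)
    (e l : ℤ → ℤ) (c : ℝ) (hc : 0 < c) (B D : ℝ)
    (he : ∀ n : ℤ, c * (n : ℝ) ^ 2 - B * |(n : ℝ)| ≤ e n) (hl : ∀ n, |(l n : ℝ)| ≤ 2 * |(n : ℝ)| + D) :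
    Summable fun n : ℤ => ‖q ^ e n * x ^ l n‖ := by
  have hlog : Real.log ‖q‖ < 0 := Real.log_neg (norm_pos_iff.2 hq0) hq
  refine Summable.of_nonneg_of_le (fun _ => norm_nonneg _) (fun n => ?_)
    ((summable_exp_quadratic (μ := c * Real.log ‖q‖) (mul_neg_of_pos_of_neg hc hlog)
      (-B * Real.log ‖q‖ + 2 * |Real.log ‖x‖|)).mul_left (Real.exp (D * |Real.log ‖x‖|)))
  rw [norm_mul, norm_zpow_eq_exp (norm_eq_exp_log hq0), norm_zpow_eq_exp (norm_eq_exp_log hx),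
    ← Real.exp_add, ← Real.exp_add]
  apply Real.exp_le_exp.2
  have h1 := mul_le_mul_of_nonpos_right (he n) hlog.le
  have h2 : (l n : ℝ) * Real.log ‖x‖ ≤ (2 * |(n : ℝ)| + D) * |Real.log ‖x‖| := by
    refine (le_abs_self _).trans ?_
    rw [abs_mul]
    gcongr
    exact hl n
  linarith

/-- The triangular number `n(n-1)/2`. -/
def tri (n : ℤ) : ℤ := n * (n - 1) / 2

theorem two_mul_tri (n : ℤ) : 2 * tri n = n * (n - 1) :=
  Int.mul_ediv_cancel' (Int.even_mul_pred_self n).two_dvd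

attribute [irreducible] tri

theorem summable_norm_theta (hq0 : q ≠ 0) (hq : ‖q‖ < 1) {x : ℂ} (hx : x ≠ 0) :
    Summable fun n : ℤ => ‖(-1) ^ n * (q ^ tri n * x ^ n)‖ := by
  have h := summable_norm_zpow_quadratic hq0 hq hx tri id (1 / 2) (by norm_num) 1 0
    (fun n => by
      have : (2 : ℝ) * tri n = n * (n - 1) := by exact_mod_cast two_mul_tri n
      have := le_abs_self (n : ℝ)
      nlinarith [abs_nonneg (n : ℝ)])
    (fun n => by
      have := abs_nonneg (n : ℝ)
      simp only [id]
      linarith)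
  refine h.congr fun n => ?_
  rw [norm_mul ((-1) ^ n), norm_zpow, norm_neg, norm_one, one_zpow, one_mul]
  rfl

/-- The Jacobi triple product identity. -/
theorem tsum_theta (hq0 : q ≠ 0) (hq : ‖q‖ < 1) {x : ℂ} (hx : x ≠ 0) :
    ∑' n : ℤ, (-1) ^ n * (q ^ tri n * x ^ n) = qInf q q * theta q x := by
  have hs := (summable_norm_theta hq0 hq hx).of_norm
  have i0 : Function.Injective fun n : ℤ => 2 * n := fun m n h => by simpa using h
  have i1 : Function.Injective fun n : ℤ => 2 * n + 1 := fun m n h => by simpa using h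
  have h0 : Summable fun n : ℤ => (-1) ^ (2 * n) * (q ^ tri (2 * n) * x ^ (2 * n)) :=
    hs.comp_injective i0
  have h1 : Summable fun n : ℤ =>
      (-1) ^ (2 * n + 1) * (q ^ tri (2 * n + 1) * x ^ (2 * n + 1)) := hs.comp_injective i1
  rw [tsum_eq_add_of_compl hs i0 i1 (fun b c => by omega)
    (fun a => by rcases Int.even_or_odd' a with ⟨k, h | h⟩ <;> simp [h]),
    ← h0.tsum_add h1, ← sum4_zero hq0 hq hx]
  -- The terms of index `2n` and `2n + 1` combine into `(1 - x q^{2n}) q^{-n}` times the Gaussian,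
  -- which is the term of `sum4 q x 0 0 0 0`.
  refine tsum_congr fun n => ?_
  have t0 : tri (2 * n) = 2 * n ^ 2 + -n := by
    have := two_mul_tri (2 * n)
    linarith
  have t1 : tri (2 * n + 1) = 2 * n ^ 2 + -n + 2 * n := by
    have := two_mul_tri (2 * n + 1)
    linarith
  simp only [term4, ker_zero, t0, t1, mul_one]
  rw [zpow_add₀ hq0 _ (2 * n), zpow_add₀ hq0, zpow_add_one₀ (by norm_num), zpow_add_one₀ hx,
    zpow_mul (-1) 2 n]
  norm_num
  ring

/-- The even part `∑ q^{i²} x^{2i}`. -/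
def thetaEven (q x : ℂ) : ℂ := ∑' i : ℤ, q ^ (i ^ 2) * x ^ (2 * i)

/-- The odd part `∑ q^{i²+i} x^{2i+1}`. -/
def thetaOdd (q x : ℂ) : ℂ := ∑' i : ℤ, q ^ (i ^ 2 + i) * x ^ (2 * i + 1)

theorem summable_norm_thetaEven (hq0 : q ≠ 0) (hq : ‖q‖ < 1) {x : ℂ} (hx : x ≠ 0) :
    Summable fun i : ℤ => ‖q ^ (i ^ 2) * x ^ (2 * i)‖ :=
  summable_norm_zpow_quadratic hq0 hq hx (fun i => i ^ 2) (fun i => 2 * i) 1 one_pos 0 0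
    (fun n => by push_cast; linarith) (fun n => by push_cast; simp [abs_mul])

theorem summable_norm_thetaOdd (hq0 : q ≠ 0) (hq : ‖q‖ < 1) {x : ℂ} (hx : x ≠ 0) :
    Summable fun i : ℤ => ‖q ^ (i ^ 2 + i) * x ^ (2 * i + 1)‖ :=
  summable_norm_zpow_quadratic hq0 hq hx (fun i => i ^ 2 + i) (fun i => 2 * i + 1) 1 one_pos 1 1
    (fun n => by
      push_cast
      have := neg_abs_le (n : ℝ)
      linarith)
    (fun n => by
      push_cast
      refine (abs_add_le _ _).trans ?_
      simp [abs_mul])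

/-- Splitting by the parity of the sum of the indices allows half-sum and half-difference as new
indices. The extra `+ 1` in the first family leaves a factor `x` in front of the odd series in both
theta identities below. -/
theorem tsum_int_prod_parity {F : ℤ × ℤ → ℂ} (hF : Summable F) :
    ∑' p, F p = ∑' p : ℤ × ℤ, F (p.1 + 1 + p.2, p.1 + 1 - p.2) +
      ∑' p : ℤ × ℤ, F (p.1 + p.2 + 1, p.1 - p.2) := by
  refine tsum_eq_add_of_compl hF (e₀ := fun p : ℤ × ℤ => (p.1 + 1 + p.2, p.1 + 1 - p.2))
    (e₁ := fun p : ℤ × ℤ => (p.1 + p.2 + 1, p.1 - p.2)) ?_ ?_ ?_ ?_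
  · rintro ⟨a, b⟩ ⟨c, d⟩ h
    simp only [Prod.mk.injEq] at h ⊢
    omega
  · rintro ⟨a, b⟩ ⟨c, d⟩ h
    simp only [Prod.mk.injEq] at h ⊢
    omega
  · rintro ⟨a, b⟩ ⟨c, d⟩ h
    simp only [Prod.mk.injEq] at h
    omega
  · rintro ⟨a, b⟩
    rcases Int.even_or_odd' (a + b) with ⟨k, h | h⟩
    · left
      refine ⟨(k - 1, a - k), ?_⟩
      simp only [Prod.mk.injEq]
      omega
    · right
      refine ⟨(k, a - k - 1), ?_⟩
      simp only [Prod.mk.injEq]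
      omega

theorem neg_one_zpow_two_mul (n : ℤ) : (-1 : ℂ) ^ (2 * n) = 1 := by
  rw [zpow_mul]
  norm_num

theorem theta_term_mul_even (hq0 : q ≠ 0) {x y : ℂ} (hx : x ≠ 0) (hy : y ≠ 0) (i j : ℤ) :
    ((-1) ^ (i + 1 + j) * (q ^ tri (i + 1 + j) * (x * y) ^ (i + 1 + j))) *
      ((-1) ^ (i + 1 - j) * (q ^ tri (i + 1 - j) * (x / y) ^ (i + 1 - j))) =
    x * ((q ^ (i ^ 2 + i) * x ^ (2 * i + 1)) * (q ^ (j ^ 2) * y ^ (2 * j))) := by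
  have ht : tri (i + 1 + j) + tri (i + 1 - j) = i ^ 2 + i + j ^ 2 := by
    have := two_mul_tri (i + 1 + j)
    have := two_mul_tri (i + 1 - j)
    linarith
  calc _ = ((-1) ^ (i + 1 + j) * (-1) ^ (i + 1 - j)) * (q ^ tri (i + 1 + j) *
        q ^ tri (i + 1 - j)) * (x ^ (i + 1 + j) * x ^ (i + 1 - j)) *
        (y ^ (i + 1 + j) / y ^ (i + 1 - j)) := by
        rw [mul_zpow, div_zpow]
        ring
    _ = _ := by
        rw [← zpow_add₀ (by norm_num), ← zpow_add₀ hq0, ← zpow_add₀ hx, ← zpow_sub₀ hy, ht,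
          show i + 1 + j + (i + 1 - j) = 2 * (i + 1) by ring, neg_one_zpow_two_mul,
          show i + 1 + j - (i + 1 - j) = 2 * j by ring, show 2 * (i + 1) = 2 * i + 1 + 1 by ring,
          zpow_add_one₀ hx (2 * i + 1), zpow_add₀ hq0]
        ring

theorem theta_term_mul_odd (hq0 : q ≠ 0) {x y : ℂ} (hx : x ≠ 0) (hy : y ≠ 0) (i j : ℤ) :
    ((-1) ^ (i + j + 1) * (q ^ tri (i + j + 1) * (x * y) ^ (i + j + 1))) *
      ((-1) ^ (i - j) * (q ^ tri (i - j) * (x / y) ^ (i - j))) =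
    -x * ((q ^ (i ^ 2) * x ^ (2 * i)) * (q ^ (j ^ 2 + j) * y ^ (2 * j + 1))) := by
  have ht : tri (i + j + 1) + tri (i - j) = i ^ 2 + (j ^ 2 + j) := by
    have := two_mul_tri (i + j + 1)
    have := two_mul_tri (i - j)
    linarith
  calc _ = ((-1) ^ (i + j + 1) * (-1) ^ (i - j)) * (q ^ tri (i + j + 1) *
        q ^ tri (i - j)) * (x ^ (i + j + 1) * x ^ (i - j)) *
        (y ^ (i + j + 1) / y ^ (i - j)) := by
        rw [mul_zpow, div_zpow]
        ring
    _ = _ := by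
        rw [← zpow_add₀ (by norm_num), ← zpow_add₀ hq0, ← zpow_add₀ hx, ← zpow_sub₀ hy, ht,
          show i + j + 1 + (i - j) = 2 * i + 1 by ring, zpow_add_one₀ (by norm_num),
          neg_one_zpow_two_mul, show i + j + 1 - (i - j) = 2 * j + 1 by ring,
          zpow_add_one₀ hx (2 * i), zpow_add₀ hq0 (i ^ 2)]
        ring

/-- Multiplying two triple product series and passing to half-sums and half-differences separates
`x` from `y`. The outcome is `x` times the determinant of the vectors (`thetaOdd`, `thetaEven`) at
`x` and at `y`, so three-term theta relations reduce to linear algebra in dimension two. -/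
theorem theta_mul_theta_div (hq0 : q ≠ 0) (hq : ‖q‖ < 1) {x y : ℂ} (hx : x ≠ 0) (hy : y ≠ 0) :
    qInf q q ^ 2 * (theta q (x * y) * theta q (x / y)) =
      x * (thetaOdd q x * thetaEven q y - thetaEven q x * thetaOdd q y) := by
  have hxy := mul_ne_zero hx hy
  have hxy' := div_ne_zero hx hy
  have s1 := summable_norm_theta hq0 hq hxy
  have s2 := summable_norm_theta hq0 hq hxy'
  have h1 := tsum_theta hq0 hq hxy
  have h2 := tsum_theta hq0 hq hxy'
  have h3 : ∑' p : ℤ × ℤ, ((-1) ^ p.1 * (q ^ tri p.1 * (x * y) ^ p.1)) *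
      ((-1) ^ p.2 * (q ^ tri p.2 * (x / y) ^ p.2)) =
      qInf q q * theta q (x * y) * (qInf q q * theta q (x / y)) := by
    rw [← h1, ← h2]
    exact (tsum_mul_tsum_of_summable_norm s1 s2).symm
  rw [tsum_int_prod_parity (summable_mul_of_summable_norm s1 s2)] at h3
  simp only [theta_term_mul_even hq0 hx hy, theta_term_mul_odd hq0 hx hy] at h3
  rw [tsum_mul_left, tsum_mul_left,
    ← tsum_mul_tsum_of_summable_norm (summable_norm_thetaOdd hq0 hq hx)
      (summable_norm_thetaEven hq0 hq hy),
    ← tsum_mul_tsum_of_summable_norm (summable_norm_thetaEven hq0 hq hx)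
      (summable_norm_thetaOdd hq0 hq hy)] at h3
  rw [thetaOdd, thetaEven, thetaOdd, thetaEven]
  linear_combination -h3

/-- The three-term (Weierstrass) addition formula for the theta function. -/
theorem theta_addition (hq0 : q ≠ 0) (hq : ‖q‖ < 1) {z u₁ u₂ u₃ : ℂ} (hz : z ≠ 0) (h₁ : u₁ ≠ 0)
    (h₂ : u₂ ≠ 0) (h₃ : u₃ ≠ 0) :
    theta q (z * u₁) * theta q (z * u₂) * theta q (z * u₃) * theta q (z * (u₁ * u₂ * u₃)) -
      z * (theta q u₁ * theta q u₂ * theta q u₃ * theta q (z ^ 2 * (u₁ * u₂ * u₃))) =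
    theta q z * theta q (z * (u₁ * u₂)) * theta q (z * (u₁ * u₃)) * theta q (z * (u₂ * u₃)) := by
  -- With `s² = u₂u₃`, the twelve theta functions group into six pairs of the form `θ(xy) θ(x/y)`,
  -- with `x`, `y` taken from the four points `z u₁ s`, `s`, `z s`, `u₂/s`.
  obtain ⟨s, hs⟩ := IsAlgClosed.exists_pow_nat_eq (u₂ * u₃) two_pos
  have hs0 : s ≠ 0 := by
    rintro rfl
    exact mul_ne_zero h₂ h₃ (by rw [← hs]; simp)
  have hX : z * u₁ * s ≠ 0 := by positivity
  have hV : z * s ≠ 0 := by positivity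
  have hW : u₂ / s ≠ 0 := by positivity
  have hqq : qInf q q ≠ 0 := qInf_ne_zero_of_norm_lt hq hq
  have b1 := theta_mul_theta_div hq0 hq hX hs0
  have b2 := theta_mul_theta_div hq0 hq hV hW
  have b3 := theta_mul_theta_div hq0 hq hX hV
  have b4 := theta_mul_theta_div hq0 hq hs0 hW
  have b5 := theta_mul_theta_div hq0 hq hX hW
  have b6 := theta_mul_theta_div hq0 hq hs0 hV
  have r1 : z * u₁ * s * s = z * (u₁ * u₂ * u₃) := by linear_combination z * u₁ * hs
  have r2 : z * u₁ * s / s = z * u₁ := by field_simp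
  have r3 : z * s * (u₂ / s) = z * u₂ := by field_simp
  have r4 : z * s / (u₂ / s) = z * u₃ := by
    field_simp
    linear_combination hs
  have r5 : z * u₁ * s * (z * s) = z ^ 2 * (u₁ * u₂ * u₃) := by
    linear_combination z ^ 2 * u₁ * hs
  have r6 : z * u₁ * s / (z * s) = u₁ := by field_simp
  have r7 : s * (u₂ / s) = u₂ := by field_simp
  have r8 : s / (u₂ / s) = u₃ := by
    field_simp
    linear_combination hs
  have r9 : z * u₁ * s * (u₂ / s) = z * (u₁ * u₂) := by field_simp
  have r10 : z * u₁ * s / (u₂ / s) = z * (u₁ * u₃) := by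
    field_simp
    linear_combination hs
  have r11 : s * (z * s) = z * (u₂ * u₃) := by linear_combination z * hs
  have r12 : s / (z * s) = z⁻¹ := by field_simp
  rw [r1, r2] at b1
  rw [r3, r4] at b2
  rw [r5, r6] at b3
  rw [r7, r8] at b4
  rw [r9, r10] at b5
  rw [r11, r12, theta_inv hq hz] at b6
  have b6' : qInf q q ^ 2 * (theta q (z * (u₂ * u₃)) * theta q z) =
      -z * s * (thetaOdd q s * thetaEven q (z * s) - thetaEven q s * thetaOdd q (z * s)) := by
    have e : qInf q q ^ 2 * (theta q (z * (u₂ * u₃)) * theta q z) =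
        -z * (qInf q q ^ 2 * (theta q (z * (u₂ * u₃)) * (-theta q z / z))) := by
      generalize theta q (z * (u₂ * u₃)) = t
      field_simp
    rw [e, b6]
    ring
  refine mul_left_cancel₀ (pow_ne_zero 4 hqq) ?_
  generalize thetaOdd q (z * u₁ * s) = X₁ at *
  generalize thetaEven q (z * u₁ * s) = X₀ at *
  generalize thetaOdd q s = Y₁ at *
  generalize thetaEven q s = Y₀ at *
  generalize thetaOdd q (z * s) = V₁ at *
  generalize thetaEven q (z * s) = V₀ at *
  generalize thetaOdd q (u₂ / s) = W₁ at *
  generalize thetaEven q (u₂ / s) = W₀ at *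
  -- The remaining identity is the Plücker relation between the six `2 × 2` minors of four vectors.
  calc _ = (qInf q q ^ 2 * (theta q (z * (u₁ * u₂ * u₃)) * theta q (z * u₁))) *
        (qInf q q ^ 2 * (theta q (z * u₂) * theta q (z * u₃))) -
        z * ((qInf q q ^ 2 * (theta q (z ^ 2 * (u₁ * u₂ * u₃)) * theta q u₁)) *
        (qInf q q ^ 2 * (theta q u₂ * theta q u₃))) := by ring
    _ = (qInf q q ^ 2 * (theta q (z * (u₁ * u₂)) * theta q (z * (u₁ * u₃)))) *
        (qInf q q ^ 2 * (theta q (z * (u₂ * u₃)) * theta q z)) := by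
        rw [b1, b2, b3, b4, b5, b6']
        ring
    _ = _ := by ring

/-! ### Asymptotics of infinite products and their quotients -/

theorem qInf_div_pow (hq0 : q ≠ 0) (hq : ‖q‖ < 1) {x : ℂ} (hx : x ≠ 0) (n : ℕ) :
    qInf q (x / q ^ n) * q ^ (∑ i ∈ Finset.range (n + 1), i) =
      (-x) ^ n * (∏ k ∈ Finset.range n, (1 - q / x * q ^ k)) * qInf q x := by
  induction n with
  | zero => simp
  | succ n ih =>
    have hn : q ^ n ≠ 0 := pow_ne_zero _ hq0
    have e : x / q ^ (n + 1) * q = x / q ^ n := by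
      rw [pow_succ]
      field_simp
    rw [qInf_eq_mul q _ hq, e, Finset.sum_range_succ, pow_add, Finset.prod_range_succ, pow_succ (-x)]
    calc _ = (1 - x / q ^ (n + 1)) * q ^ (n + 1) *
          (qInf q (x / q ^ n) * q ^ (∑ i ∈ Finset.range (n + 1), i)) := by ring
      _ = _ := by
        rw [ih, pow_succ]
        field_simp
        ring

theorem tendsto_qInf_div_pow (hq0 : q ≠ 0) (hq : ‖q‖ < 1) {x : ℂ} (hx : x ≠ 0) :
    Tendsto (fun n : ℕ => qInf q (x / q ^ n) * q ^ (∑ i ∈ Finset.range (n + 1), i) / (-x) ^ n)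
      atTop (𝓝 (theta q x)) := by
  have h := (tendsto_prod_qInf hq (q / x)).mul_const (qInf q x)
  rw [mul_comm, ← theta] at h
  refine h.congr fun n => ?_
  rw [qInf_div_pow hq0 hq hx, mul_assoc, mul_div_cancel_left₀ _ (pow_ne_zero _ (neg_ne_zero.2 hx))]

/-- For `j → -∞` numerator and denominator both tend to `1`. For `j → +∞` both grow with the same
power of `q`; after dividing by it and by `(-x)^j`, `(-y)^j` they tend to theta values. The limit of
the denominator is nonzero because `y` is not a power of `q`. -/
theorem exists_norm_qInf_div_qInf_le (hq0 : q ≠ 0) (hq : ‖q‖ < 1) {x y : ℂ} (hx : x ≠ 0)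
    (hy : y ≠ 0) (h : ∀ k : ℤ, y ≠ q ^ k) :
    ∃ C, 0 ≤ C ∧ ∀ j : ℤ, ‖qInf q (x * q ^ (-j)) / qInf q (y * q ^ (-j))‖ ≤
      C * Real.exp (max (j : ℝ) 0 * Real.log ‖x / y‖) := by
  have hbdd : ∀ f : ℕ → ℂ, (∃ l, Tendsto f atTop (𝓝 l)) → ∃ C, 0 ≤ C ∧ ∀ k, ‖f k‖ ≤ C := by
    rintro f ⟨l, hf⟩
    obtain ⟨C, hC⟩ := hf.norm.bddAbove_range
    exact ⟨max C 0, le_max_right _ _, fun k => (hC ⟨k, rfl⟩).trans (le_max_left _ _)⟩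
  have hth := theta_ne_zero hq0 hq hy h
  obtain ⟨C₁, p₁, h₁⟩ := hbdd (fun k => qInf q (x * q ^ k) / qInf q (y * q ^ k))
    ⟨_, (tendsto_qInf_mul_pow hq x).div (tendsto_qInf_mul_pow hq y) one_ne_zero⟩
  obtain ⟨C₂, p₂, h₂⟩ := hbdd _
    ⟨_, (tendsto_qInf_div_pow hq0 hq hx).div (tendsto_qInf_div_pow hq0 hq hy) hth⟩
  refine ⟨C₁ + C₂, by positivity, fun j => ?_⟩
  obtain ⟨k, rfl | rfl⟩ := j.eq_nat_or_neg
  · have e : ∀ x : ℂ, x * q ^ (-(k : ℤ)) = x / q ^ k := fun x => by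
      rw [zpow_neg, zpow_natCast]
      rfl
    have h3 := h₂ k
    simp only [Pi.div_apply] at h3
    have hqk : q ^ (∑ i ∈ Finset.range (k + 1), i) ≠ 0 := pow_ne_zero _ hq0
    have e2 : qInf q (x / q ^ k) / qInf q (y / q ^ k) =
        (qInf q (x / q ^ k) * q ^ (∑ i ∈ Finset.range (k + 1), i) / (-x) ^ k /
        (qInf q (y / q ^ k) * q ^ (∑ i ∈ Finset.range (k + 1), i) / (-y) ^ k)) * (x / y) ^ k := by
      rw [neg_pow x, neg_pow y, div_pow]
      have : (-1 : ℂ) ^ k ≠ 0 := pow_ne_zero _ (by norm_num)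
      field_simp
    rw [e, e, e2, norm_mul, norm_pow]
    have e3 : Real.exp (max ((k : ℤ) : ℝ) 0 * Real.log ‖x / y‖) = ‖x / y‖ ^ k := by
      rw [max_eq_left (by positivity), Int.cast_natCast, Real.exp_nat_mul,
        Real.exp_log (norm_pos_iff.2 (div_ne_zero hx hy))]
    rw [e3]
    gcongr
    linarith
  · have h3 := h₁ k
    rw [neg_neg, zpow_natCast, max_eq_right (by simp), zero_mul, Real.exp_zero]
    linarith

/-! ### The balanced series with one denominator parameter -/

/-- The general term of the very-well-poised `₈ψ₈` series with one parameter `b` in the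
denominator and five parameters `1/uᵢ`, normalised to be entire in the `uᵢ`. -/
def term51 (q a b u₁ u₂ u₃ u₄ u₅ : ℂ) (n : ℤ) : ℂ :=
  (1 - a * q ^ (2 * n)) * q ^ (-n) * (a ^ (2 * n) * q ^ (2 * n ^ 2)) *
    (ker q a u₁ n * ker q a u₂ n * ker q a u₃ n * ker q a u₄ n * ker q a u₅ n) /
    (qInf q (b * q ^ n) * qInf q (b / a * q ^ (-n)))

/-- The sum of `term51` over all integers. -/
def sum51 (q a b u₁ u₂ u₃ u₄ u₅ : ℂ) : ℂ := ∑' n : ℤ, term51 q a b u₁ u₂ u₃ u₄ u₅ n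

theorem term51_eq (q a b u₁ u₂ u₃ u₄ u₅ : ℂ) (n : ℤ) : term51 q a b u₁ u₂ u₃ u₄ u₅ n =
    term4 q a u₂ u₃ u₄ u₅ n * (qInf q (u₁ * q ^ (1 - n)) / qInf q (b / a * q ^ (-n)) *
      (qInf q (a * u₁ * q ^ (1 + n)) / qInf q (b * q ^ n))) := by
  rw [term51, term4, ker]
  ring

/-- The bound is uniform in the simultaneous shift `b q^N`, `u₁ q^N`. For `|n| ≤ N` the quotients
containing `b` and `u₁` stay bounded and the term behaves like a ₆ψ₆ term in `u₂, …, u₅`; only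
beyond `N` do they contribute their own exponential. -/
theorem exists_norm_term51_le (hq0 : q ≠ 0) (hq : ‖q‖ < 1) {a b u₁ u₂ u₃ u₄ u₅ : ℂ} (ha : a ≠ 0)
    (hb0 : b ≠ 0) (h₁ : u₁ ≠ 0) (h₂ : u₂ ≠ 0) (h₃ : u₃ ≠ 0) (h₄ : u₄ ≠ 0) (h₅ : u₅ ≠ 0)
    (hb : ∀ k : ℤ, b ≠ q ^ k) (hba : ∀ k : ℤ, b / a ≠ q ^ k) :
    ∃ C, 0 ≤ C ∧ ∀ (N : ℕ) (n : ℤ), ‖term51 q a (b * q ^ N) (u₁ * q ^ N) u₂ u₃ u₄ u₅ n‖ ≤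
      C * Real.exp (Real.log ‖a ^ 2 * q * (u₂ * u₃ * u₄ * u₅)‖ * |(n : ℝ)| +
        (max ((n : ℝ) - N) 0 + max (-(n : ℝ) - N) 0) * Real.log ‖a * q * u₁ / b‖) := by
  obtain ⟨C₁, p₁, k₁⟩ := exists_norm_term4_le hq0 hq (Real.log ‖a‖) (Real.log ‖u₂‖)
    (Real.log ‖u₃‖) (Real.log ‖u₄‖) (Real.log ‖u₅‖)
  obtain ⟨C₂, p₂, k₂⟩ := exists_norm_qInf_div_qInf_le hq0 hq (x := u₁ * q) (mul_ne_zero h₁ hq0)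
    (div_ne_zero hb0 ha) hba
  obtain ⟨C₃, p₃, k₃⟩ := exists_norm_qInf_div_qInf_le hq0 hq (x := a * u₁ * q)
    (mul_ne_zero (mul_ne_zero ha h₁) hq0) hb0 hb
  refine ⟨C₁ * (C₂ * C₃), by positivity, fun N n => ?_⟩
  have b1 := k₁ a u₂ u₃ u₄ u₅ (norm_eq_exp_log ha) (norm_eq_exp_log h₂).le
    (norm_eq_exp_log h₃).le (norm_eq_exp_log h₄).le (norm_eq_exp_log h₅).le n
  have b2 := k₂ (n - N)
  have b3 := k₃ (-n - N)
  have hN : q ^ N ≠ 0 := pow_ne_zero _ hq0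
  have e1 : u₁ * q * q ^ (-(n - N : ℤ)) = u₁ * q ^ N * q ^ (1 - n) := by
    rw [show -(n - N : ℤ) = N - n by ring, zpow_sub₀ hq0, zpow_sub₀ hq0, zpow_natCast, zpow_one]
    ring
  have e2 : b / a * q ^ (-(n - N : ℤ)) = b * q ^ N / a * q ^ (-n) := by
    rw [show -(n - N : ℤ) = N + -n by ring, zpow_add₀ hq0, zpow_natCast]
    ring
  have e3 : a * u₁ * q * q ^ (-(-n - N : ℤ)) = a * (u₁ * q ^ N) * q ^ (1 + n) := by
    rw [show -(-n - N : ℤ) = n + N by ring, zpow_add₀ hq0, zpow_add₀ hq0, zpow_natCast, zpow_one]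
    ring
  have e4 : b * q ^ (-(-n - N : ℤ)) = b * q ^ N * q ^ n := by
    rw [show -(-n - N : ℤ) = n + N by ring, zpow_add₀ hq0, zpow_natCast]
    ring
  rw [e1, e2] at b2
  rw [e3, e4] at b3
  rw [term51_eq]
  refine (norm_mul_le_exp p₁ b1 (norm_mul_le_exp p₂ b2 b3)).trans_eq ?_
  congr 2
  have l1 : Real.log ‖u₁ * q / (b / a)‖ = Real.log ‖a * q * u₁ / b‖ := by
    congr 2
    field_simp
  have l2 : Real.log ‖a * u₁ * q / b‖ = Real.log ‖a * q * u₁ / b‖ := by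
    congr 2
    ring
  have l3 : Real.log ‖a ^ 2 * q * (u₂ * u₃ * u₄ * u₅)‖ = 2 * Real.log ‖a‖ + Real.log ‖q‖ +
      (Real.log ‖u₂‖ + Real.log ‖u₃‖ + Real.log ‖u₄‖ + Real.log ‖u₅‖) := by
    simp only [norm_mul, norm_pow]
    have := norm_ne_zero_iff.2 ha
    have := norm_ne_zero_iff.2 hq0
    have := norm_ne_zero_iff.2 h₂
    have := norm_ne_zero_iff.2 h₃
    have := norm_ne_zero_iff.2 h₄
    have := norm_ne_zero_iff.2 h₅
    rw [Real.log_mul (by positivity) (by positivity), Real.log_mul (by positivity) (by positivity),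
      Real.log_mul (by positivity) (by positivity), Real.log_mul (by positivity) (by positivity),
      Real.log_mul (by positivity) (by positivity), Real.log_pow]
    push_cast
    ring
  rw [l1, l2, l3]
  push_cast
  ring

theorem summable_term51 (hq0 : q ≠ 0) (hq : ‖q‖ < 1) {a b u₁ u₂ u₃ u₄ u₅ : ℂ} (ha : a ≠ 0)
    (h₁ : u₁ ≠ 0) (h₂ : u₂ ≠ 0) (h₃ : u₃ ≠ 0) (h₄ : u₄ ≠ 0) (h₅ : u₅ ≠ 0)
    (hbu : b = a ^ 3 * q * (u₁ * u₂ * u₃ * u₄ * u₅))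
    (hb : ∀ k : ℤ, b ≠ q ^ k) (hba : ∀ k : ℤ, b / a ≠ q ^ k) :
    Summable (term51 q a b u₁ u₂ u₃ u₄ u₅) := by
  have hb0 : b ≠ 0 := by
    rw [hbu]
    positivity
  obtain ⟨C, -, hC⟩ := exists_norm_term51_le hq0 hq ha hb0 h₁ h₂ h₃ h₄ h₅ hb hba
  refine Summable.of_norm_bounded ((summable_exp_neg_abs (δ := Real.log ‖q‖)
    (Real.log_neg (norm_pos_iff.2 hq0) hq)).mul_left C) fun n => ?_
  have h := hC 0 n
  simp only [pow_zero, mul_one, Nat.cast_zero, sub_zero] at h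
  refine h.trans_eq ?_
  have hmax : max (n : ℝ) 0 + max (-(n : ℝ)) 0 = |(n : ℝ)| := by
    rcases le_total 0 (n : ℝ) with h0 | h0
    · rw [max_eq_left h0, max_eq_right (by linarith), abs_of_nonneg h0, add_zero]
    · rw [max_eq_right h0, max_eq_left (by linarith), abs_of_nonpos h0, zero_add]
  -- Under the balancing condition the two rates multiply to `q`, so the series always converges
  -- like `|q|^{|n|}`.
  have e : a ^ 2 * q * (u₂ * u₃ * u₄ * u₅) * (a * q * u₁ / b) = q := by
    rw [hbu]
    field_simp
  have hl : Real.log ‖a ^ 2 * q * (u₂ * u₃ * u₄ * u₅)‖ + Real.log ‖a * q * u₁ / b‖ =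
      Real.log ‖q‖ := by
    rw [← Real.log_mul, ← norm_mul, e]
    · exact norm_ne_zero_iff.2 (by positivity)
    · exact norm_ne_zero_iff.2 (by positivity)
  rw [hmax, ← hl]
  congr 2
  ring

/-! ### The contiguous relation and its boundary term -/

theorem tsum_sub_shift_eq {T : ℤ → ℂ} (hT : Summable fun n => T n - T (n - 1)) {l : ℂ}
    (h₁ : Tendsto (fun n : ℕ => T n) atTop (𝓝 l)) (h₂ : ∀ᶠ n : ℕ in atTop, T (-n) = 0) :
    ∑' n, (T n - T (n - 1)) = l := by
  have hs : ∀ N : ℕ, ∑ n ∈ Finset.Ico (-N : ℤ) N, (T n - T (n - 1)) =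
      T (N - 1) - T (-N - 1) := by
    intro N
    induction N with
    | zero => simp
    | succ N ih =>
      have e : Finset.Ico (-((N + 1 : ℕ) : ℤ)) ((N + 1 : ℕ) : ℤ) =
          insert (-(N : ℤ) - 1) (insert (N : ℤ) (Finset.Ico (-N : ℤ) N)) := by
        ext k
        simp only [Finset.mem_Ico, Finset.mem_insert]
        push_cast
        omega
      rw [e, Finset.sum_insert, Finset.sum_insert, ih]
      · push_cast
        rw [add_sub_cancel_right, show -((N : ℤ) + 1) - 1 = -N - 1 - 1 by ring]
        ring
      · simp
      · simp only [Finset.mem_insert, Finset.mem_Ico]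
        omega
  have h := hT.hasSum.comp (Finset.tendsto_Ico_neg (R := ℤ))
  have h' : Tendsto (fun N : ℕ => T (N - 1) - T (-N - 1)) atTop (𝓝 l) := by
    rw [← sub_zero l]
    refine Tendsto.sub ?_ ?_
    · rw [← tendsto_add_atTop_iff_nat 1]
      simpa using h₁
    · refine tendsto_const_nhds.congr' ?_
      filter_upwards [(tendsto_add_atTop_nat 1).eventually h₂] with n hn
      have e : -(n : ℤ) - 1 = -((n + 1 : ℕ) : ℤ) := by
        push_cast
        ring
      rw [e, hn]
  refine tendsto_nhds_unique h (h'.congr fun N => ?_)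
  rw [← hs N]
  rfl

/-- This is the rational identity behind the telescoping, with `Y = qⁿ` and `eᵢ` the elementary
symmetric functions of `u₂, …, u₅`. Passing to the `eᵢ` keeps the verification small; balancing
enters as `b = a³ u e₄`. -/
theorem contiguous_identity {a u b e₁ e₂ e₃ e₄ Y : ℂ} (ha : a ≠ 0) (he : e₄ ≠ 0)
    (hY : Y ≠ 0) (hb : b = a ^ 3 * u * e₄) :
    a ^ 2 * u * (1 - b * u) * (Y ^ 2 * ((1 - u / Y) *
        (1 - e₁ / Y + e₂ / Y ^ 2 - e₃ / Y ^ 3 + e₄ / Y ^ 4) * (1 - b * Y)) -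
      1 / (a ^ 2 * Y ^ 2) * ((1 - a * u * Y) * (1 - e₁ * (a * Y) + e₂ * (a * Y) ^ 2 -
        e₃ * (a * Y) ^ 3 + e₄ * (a * Y) ^ 4) * (1 - b / a / Y))) =
    (1 - a * Y ^ 2) / Y * ((1 - e₃ / e₄ * (b / a) + e₂ / e₄ * (b / a) ^ 2 - e₁ / e₄ * (b / a) ^ 3 +
        (b / a) ^ 4 / e₄) * ((1 - u / Y) * (1 - a * u * Y)) -
      (1 - e₁ * (a * u) + e₂ * (a * u) ^ 2 - e₃ * (a * u) ^ 3 + e₄ * (a * u) ^ 4) *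
        ((1 - b * Y) * (1 - b / a / Y))) := by
  subst hb
  field_simp
  ring

/-- The telescoping quantity behind the contiguous relation of `sum51`. -/
def tele51 (q a b u₁ u₂ u₃ u₄ u₅ : ℂ) (n : ℤ) : ℂ :=
  (a * q) ^ (2 * n) * q ^ (2 * n ^ 2) *
    (ker q (a * q) (u₁ / q) n * ker q (a * q) (u₂ / q) n * ker q (a * q) (u₃ / q) n *
      ker q (a * q) (u₄ / q) n * ker q (a * q) (u₅ / q) n) /
    (qInf q (b * q ^ (n + 1)) * qInf q (b / a * q ^ (-n)))

/-- The common factor of two consecutive values of `tele51`. -/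
def core51 (q a b u₁ u₂ u₃ u₄ u₅ : ℂ) (n : ℤ) : ℂ :=
  a ^ (2 * n) * q ^ (2 * n ^ 2) * (ker q a u₁ n * ker q a u₂ n * ker q a u₃ n * ker q a u₄ n *
      ker q a u₅ n) * ((qInf q (b * q ^ n))⁻¹ * (qInf q (b / a * q ^ (-n)))⁻¹)

theorem inv_qInf_mul_zpow_add_one (hq0 : q ≠ 0) (hq : ‖q‖ < 1) {b : ℂ}
    (hb : ∀ k : ℤ, b ≠ q ^ k) (n : ℤ) :
    (qInf q (b * q ^ (n + 1)))⁻¹ = (1 - b * q ^ n) * (qInf q (b * q ^ n))⁻¹ := by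
  have h0 : 1 - b * q ^ n ≠ 0 := fun h => hb (-n) (by
    rw [zpow_neg]
    exact eq_inv_of_mul_eq_one_left (sub_eq_zero.1 h).symm)
  rw [qInf_eq_mul q (b * q ^ n) hq, zpow_add_one₀ hq0, ← mul_assoc, mul_inv,
    mul_inv_cancel_left₀ h0]

theorem tele51_eq (hq0 : q ≠ 0) (hq : ‖q‖ < 1) {a b : ℂ} (u₁ u₂ u₃ u₄ u₅ : ℂ)
    (hb : ∀ k : ℤ, b ≠ q ^ k) (n : ℤ) :
    tele51 q a b u₁ u₂ u₃ u₄ u₅ n = core51 q a b u₁ u₂ u₃ u₄ u₅ n *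
        ((q ^ n) ^ 2 * ((1 - u₁ / q ^ n) * ((1 - u₂ / q ^ n) * (1 - u₃ / q ^ n) *
        (1 - u₄ / q ^ n) * (1 - u₅ / q ^ n)) * (1 - b * q ^ n))) := by
  have p1 : (a * q) ^ (2 * n) = a ^ (2 * n) * (q ^ n) ^ 2 := by
    rw [mul_zpow, mul_comm 2 n, zpow_mul q, zpow_ofNat]
  simp only [tele51, core51, ker_mul_q_div_q hq0 hq, p1]
  rw [div_eq_mul_inv, mul_inv, inv_qInf_mul_zpow_add_one hq0 hq hb]
  ring

theorem tele51_sub_one (hq0 : q ≠ 0) (hq : ‖q‖ < 1) {a b : ℂ} (u₁ u₂ u₃ u₄ u₅ : ℂ) (ha : a ≠ 0)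
    (hba : ∀ k : ℤ, b / a ≠ q ^ k) (n : ℤ) :
    tele51 q a b u₁ u₂ u₃ u₄ u₅ (n - 1) = core51 q a b u₁ u₂ u₃ u₄ u₅ n *
        (1 / (a ^ 2 * (q ^ n) ^ 2) * ((1 - a * u₁ * q ^ n) * ((1 - a * u₂ * q ^ n) *
        (1 - a * u₃ * q ^ n) * (1 - a * u₄ * q ^ n) * (1 - a * u₅ * q ^ n)) *
        (1 - b / a / q ^ n))) := by
  have hn : q ^ n ≠ 0 := zpow_ne_zero _ hq0
  have p1 : (a * q) ^ (2 * n) = a ^ (2 * n) * (q ^ n) ^ 2 := by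
    rw [mul_zpow, mul_comm 2 n, zpow_mul q, zpow_ofNat]
  have p2 : (a * q) ^ (2 * (n - 1)) = a ^ (2 * n) * (q ^ n) ^ 2 / (a ^ 2 * q ^ 2) := by
    rw [mul_sub, mul_one, zpow_sub₀ (mul_ne_zero ha hq0), p1, zpow_ofNat, mul_pow]
  have p3 : q ^ (2 * (n - 1) ^ 2) = q ^ (2 * n ^ 2) * q ^ 2 / (q ^ n) ^ 4 := by
    rw [show 2 * (n - 1) ^ 2 = 2 * n ^ 2 + 2 - n * 4 by ring, zpow_sub₀ hq0, zpow_add₀ hq0,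
      zpow_mul q n 4, zpow_ofNat, zpow_ofNat]
  have pp : (a * q) ^ (2 * (n - 1)) * q ^ (2 * (n - 1) ^ 2) =
      a ^ (2 * n) * q ^ (2 * n ^ 2) * (1 / (a ^ 2 * (q ^ n) ^ 2)) := by
    rw [p2, p3]
    field_simp
  have i2 := inv_qInf_mul_zpow_add_one hq0 hq hba (-n)
  rw [show -n + 1 = -(n - 1) by ring] at i2
  simp only [tele51, core51, ker_mul_q_div_q_sub_one hq0 hq, sub_add_cancel]
  rw [pp, div_eq_mul_inv, mul_inv, i2, zpow_neg]
  ring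

theorem term51_div_q (hq0 : q ≠ 0) (hq : ‖q‖ < 1) (a b u₁ u₂ u₃ u₄ u₅ : ℂ) (n : ℤ) :
    term51 q a b (u₁ / q) u₂ u₃ u₄ u₅ n = core51 q a b u₁ u₂ u₃ u₄ u₅ n *
        ((1 - a * (q ^ n) ^ 2) / q ^ n * ((1 - u₁ / q ^ n) * (1 - a * u₁ * q ^ n))) := by
  have p4 : q ^ (2 * n) = (q ^ n) ^ 2 := by rw [mul_comm 2 n, zpow_mul, zpow_ofNat]
  rw [term51, core51, ker_div_q hq0 hq, p4, zpow_neg]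
  ring

theorem term51_mul_q (hq0 : q ≠ 0) (hq : ‖q‖ < 1) {a b : ℂ} (u₁ u₂ u₃ u₄ u₅ : ℂ)
    (hb : ∀ k : ℤ, b ≠ q ^ k) (hba : ∀ k : ℤ, b / a ≠ q ^ k) (n : ℤ) :
    term51 q a (b * q) u₁ u₂ u₃ u₄ u₅ n = core51 q a b u₁ u₂ u₃ u₄ u₅ n *
        ((1 - a * (q ^ n) ^ 2) / q ^ n * ((1 - b * q ^ n) * (1 - b / a / q ^ n))) := by
  have p4 : q ^ (2 * n) = (q ^ n) ^ 2 := by rw [mul_comm 2 n, zpow_mul, zpow_ofNat]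
  have d3 : b * q * q ^ n = b * q ^ (n + 1) := by
    rw [zpow_add_one₀ hq0]
    ring
  have d4 : b * q / a * q ^ (-n) = b / a * q ^ (-n + 1) := by
    rw [zpow_add_one₀ hq0]
    ring
  rw [term51, core51, d3, d4, div_eq_mul_inv, mul_inv, inv_qInf_mul_zpow_add_one hq0 hq hb,
    inv_qInf_mul_zpow_add_one hq0 hq hba, p4, zpow_neg]
  ring

theorem term51_contiguous (hq0 : q ≠ 0) (hq : ‖q‖ < 1) {a b u₁ u₂ u₃ u₄ u₅ : ℂ} (ha : a ≠ 0)
    (h₂ : u₂ ≠ 0) (h₃ : u₃ ≠ 0) (h₄ : u₄ ≠ 0) (h₅ : u₅ ≠ 0)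
    (hbu : b = a ^ 3 * (u₁ * u₂ * u₃ * u₄ * u₅))
    (hb : ∀ k : ℤ, b ≠ q ^ k) (hba : ∀ k : ℤ, b / a ≠ q ^ k) (n : ℤ) :
    a ^ 2 * u₁ * (1 - b * u₁) *
        (tele51 q a b u₁ u₂ u₃ u₄ u₅ n - tele51 q a b u₁ u₂ u₃ u₄ u₅ (n - 1)) =
      (1 - b / (a * u₂)) * (1 - b / (a * u₃)) * (1 - b / (a * u₄)) * (1 - b / (a * u₅)) *
        term51 q a b (u₁ / q) u₂ u₃ u₄ u₅ n -
      (1 - a * u₁ * u₂) * (1 - a * u₁ * u₃) * (1 - a * u₁ * u₄) * (1 - a * u₁ * u₅) *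
        term51 q a (b * q) u₁ u₂ u₃ u₄ u₅ n := by
  have hA : (1 - b / (a * u₂)) * (1 - b / (a * u₃)) * (1 - b / (a * u₄)) * (1 - b / (a * u₅)) =
      1 - (u₂ * u₃ * u₄ + u₂ * u₃ * u₅ + u₂ * u₄ * u₅ + u₃ * u₄ * u₅) / (u₂ * u₃ * u₄ * u₅) *
        (b / a) + (u₂ * u₃ + u₂ * u₄ + u₂ * u₅ + u₃ * u₄ + u₃ * u₅ + u₄ * u₅) /
        (u₂ * u₃ * u₄ * u₅) * (b / a) ^ 2 - (u₂ + u₃ + u₄ + u₅) / (u₂ * u₃ * u₄ * u₅) *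
        (b / a) ^ 3 + (b / a) ^ 4 / (u₂ * u₃ * u₄ * u₅) := by
    field_simp
    ring
  have hid := contiguous_identity (u := u₁) (e₁ := u₂ + u₃ + u₄ + u₅)
    (e₂ := u₂ * u₃ + u₂ * u₄ + u₂ * u₅ + u₃ * u₄ + u₃ * u₅ + u₄ * u₅)
    (e₃ := u₂ * u₃ * u₄ + u₂ * u₃ * u₅ + u₂ * u₄ * u₅ + u₃ * u₄ * u₅)
    (e₄ := u₂ * u₃ * u₄ * u₅) (b := b) ha (by positivity) (zpow_ne_zero n hq0) (by rw [hbu]; ring)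
  rw [← hA] at hid
  rw [tele51_eq hq0 hq _ _ _ _ _ hb, tele51_sub_one hq0 hq _ _ _ _ _ ha hba,
    term51_div_q hq0 hq, term51_mul_q hq0 hq _ _ _ _ _ hb hba]
  linear_combination core51 q a b u₁ u₂ u₃ u₄ u₅ n * hid

theorem scaled_quotient {R A U₁ U₂ U₃ U₄ U₅ : ℂ} (hR : R ≠ 0) (hA : A ≠ 0) (h₁ : U₁ ≠ 0)
    (h₂ : U₂ ≠ 0) (h₃ : U₃ ≠ 0) (h₄ : U₄ ≠ 0) (h₅ : U₅ ≠ 0)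
    (x₁ x₂ x₃ x₄ x₅ y₁ y₂ y₃ y₄ y₅ s t : ℂ) :
    x₁ * R / U₁ * y₁ * (x₂ * R / U₂ * y₂) * (x₃ * R / U₃ * y₃) * (x₄ * R / U₄ * y₄) *
        (x₅ * R / U₅ * y₅) / (s * R / (A * (U₁ * U₂ * U₃ * U₄ * U₅)) * t) =
      A * R ^ 4 * (x₁ * y₁ * (x₂ * y₂) * (x₃ * y₃) * (x₄ * y₄) * (x₅ * y₅)) / (t * s) := by
  have e : s * R / (A * (U₁ * U₂ * U₃ * U₄ * U₅)) * t =
      R / (A * (U₁ * U₂ * U₃ * U₄ * U₅)) * (t * s) := by ring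
  rw [e, ← div_div]
  congr 1
  field_simp

/-- Each of the five kernels contributes a theta function and the denominator contributes one. The
powers of `q` cancel against the Gaussian because `5 - 1 = 4`, and the remaining `n`-th powers
cancel by balancing. Thus the telescoping quantity has a nonzero limit in general, unlike the ₆ψ₆
case. -/
theorem tendsto_tele51 (hq0 : q ≠ 0) (hq : ‖q‖ < 1) {a b u₁ u₂ u₃ u₄ u₅ : ℂ} (ha : a ≠ 0)
    (hb0 : b ≠ 0) (h₁ : u₁ ≠ 0) (h₂ : u₂ ≠ 0) (h₃ : u₃ ≠ 0) (h₄ : u₄ ≠ 0) (h₅ : u₅ ≠ 0)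
    (hbu : b = a ^ 3 * (u₁ * u₂ * u₃ * u₄ * u₅)) (hth : theta q (b / a) ≠ 0) :
    Tendsto (fun n : ℕ => tele51 q a b u₁ u₂ u₃ u₄ u₅ n) atTop (𝓝 (theta q u₁ * theta q u₂ *
      theta q u₃ * theta q u₄ * theta q u₅ / theta q (b / a))) := by
  have g1 : ∀ u, Tendsto (fun n : ℕ => qInf q (a * u * q ^ (1 + n))) atTop (𝓝 1) := fun u => by
    refine (tendsto_qInf_mul_pow hq (a * u * q)).congr fun n => ?_
    rw [pow_add, pow_one, mul_assoc]
  have g2 : Tendsto (fun n : ℕ => qInf q (b * q ^ (n + 1))) atTop (𝓝 1) := by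
    refine (tendsto_qInf_mul_pow hq (b * q)).congr fun n => ?_
    rw [pow_succ', mul_assoc]
  have g3 := fun {u : ℂ} (hu : u ≠ 0) => (tendsto_qInf_div_pow hq0 hq hu).mul (g1 u)
  have g4 := (((((g3 h₁).mul (g3 h₂)).mul (g3 h₃)).mul (g3 h₄)).mul (g3 h₅)).div
    ((tendsto_qInf_div_pow hq0 hq (div_ne_zero hb0 ha)).mul g2) (by simpa using hth)
  simp only [mul_one] at g4
  refine g4.congr fun n => ?_
  have hk : ∀ u, ker q (a * q) (u / q) n = qInf q (u / q ^ n) * qInf q (a * u * q ^ (1 + n)) := by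
    intro u
    rw [ker, zpow_sub₀ hq0, zpow_natCast, zpow_one,
      show (1 + (n : ℤ)) = ((1 + n : ℕ) : ℤ) by push_cast; ring, zpow_natCast]
    congr 2 <;> field_simp
  have hpow : (a * q) ^ (2 * (n : ℤ)) * q ^ (2 * (n : ℤ) ^ 2) =
      a ^ (2 * n) * (q ^ (∑ i ∈ Finset.range (n + 1), i)) ^ 4 := by
    have h4 : (∑ i ∈ Finset.range (n + 1), i) * 4 = 2 * n + 2 * n ^ 2 := by
      have := Finset.sum_range_id_mul_two (n + 1)
      simp only [add_tsub_cancel_right] at this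
      nlinarith
    rw [← pow_mul, h4, show 2 * (n : ℤ) = ((2 * n : ℕ) : ℤ) by push_cast; ring,
      show 2 * (n : ℤ) ^ 2 = ((2 * n ^ 2 : ℕ) : ℤ) by push_cast; ring, zpow_natCast,
      zpow_natCast, mul_pow, pow_add]
    ring
  have hb' : (-(b / a)) ^ n = a ^ (2 * n) * ((-u₁) ^ n * (-u₂) ^ n * (-u₃) ^ n *
      (-u₄) ^ n * (-u₅) ^ n) := by
    rw [pow_mul, ← mul_pow, ← mul_pow, ← mul_pow, ← mul_pow, ← mul_pow, hbu]
    congr 1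
    field_simp
  have hqn : q ^ (∑ i ∈ Finset.range (n + 1), i) ≠ 0 := pow_ne_zero _ hq0
  have hneg : ∀ {x : ℂ}, x ≠ 0 → (-x) ^ n ≠ 0 := fun h => pow_ne_zero _ (neg_ne_zero.2 h)
  have hd1 : b / a * q ^ (-(n : ℤ)) = b / a / q ^ n := by
    rw [zpow_neg, zpow_natCast, div_eq_mul_inv (b / a)]
  have hd2 : b * q ^ ((n : ℤ) + 1) = b * q ^ (n + 1) := by
    rw [← zpow_natCast, Nat.cast_add_one]
  simp only [Pi.div_apply, tele51, hk, hd1, hd2]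
  rw [hpow]
  rw [hb']
  exact scaled_quotient hqn (pow_ne_zero (2 * n) ha) (hneg h₁) (hneg h₂) (hneg h₃) (hneg h₄)
    (hneg h₅) _ _ _ _ _ _ _ _ _ _ _ _

/-- If `a u₄` or `a u₅` is a power of `q`, then far to the left the second factor of the
corresponding kernel is `(q^{-k};q)_∞ = 0`. The only boundary contribution is therefore the one at
`+∞`. -/
theorem eventually_tele51_eq_zero (hq0 : q ≠ 0) (hq : ‖q‖ < 1) {a u₄ u₅ : ℂ} (b u₁ u₂ u₃ : ℂ)
    (hm : ∃ m : ℤ, a * u₄ = q ^ m ∨ a * u₅ = q ^ m) :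
    ∀ᶠ n : ℕ in atTop, tele51 q a b u₁ u₂ u₃ u₄ u₅ (-n) = 0 := by
  obtain ⟨m, hm⟩ := hm
  have hk : ∀ u, a * u = q ^ m → ∀ᶠ n : ℕ in atTop, ker q (a * q) (u / q) (-n) = 0 := by
    intro u hu
    filter_upwards [eventually_ge_atTop (m + 1).toNat] with n hn
    obtain ⟨k, hk⟩ : ∃ k : ℕ, (k : ℤ) = n - 1 - m := ⟨(n - 1 - m).toNat, by omega⟩
    have e : a * q * (u / q) = q ^ m := by
      rw [← hu]
      field_simp
    rw [ker, e, qInf_eq_zero (x := q ^ m * _) (k := k) hq, mul_zero]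
    rw [← zpow_add₀ hq0, ← zpow_natCast, ← zpow_add₀ hq0, hk]
    ring_nf
    simp
  rcases hm with hm | hm
  · filter_upwards [hk _ hm] with n hn
    simp [tele51, hn]
  · filter_upwards [hk _ hm] with n hn
    simp [tele51, hn]

theorem sum51_contiguous (hq0 : q ≠ 0) (hq : ‖q‖ < 1) {a b u₁ u₂ u₃ u₄ u₅ : ℂ} (ha : a ≠ 0)
    (h₁ : u₁ ≠ 0) (h₂ : u₂ ≠ 0) (h₃ : u₃ ≠ 0) (h₄ : u₄ ≠ 0) (h₅ : u₅ ≠ 0)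
    (hbu : b = a ^ 3 * (u₁ * u₂ * u₃ * u₄ * u₅))
    (hb : ∀ k : ℤ, b ≠ q ^ k) (hba : ∀ k : ℤ, b / a ≠ q ^ k)
    (hm : ∃ m : ℤ, a * u₄ = q ^ m ∨ a * u₅ = q ^ m) :
    (1 - b / (a * u₂)) * (1 - b / (a * u₃)) * (1 - b / (a * u₄)) * (1 - b / (a * u₅)) *
        sum51 q a b (u₁ / q) u₂ u₃ u₄ u₅ -
      (1 - a * u₁ * u₂) * (1 - a * u₁ * u₃) * (1 - a * u₁ * u₄) * (1 - a * u₁ * u₅) *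
        sum51 q a (b * q) u₁ u₂ u₃ u₄ u₅ =
    a ^ 2 * u₁ * (1 - b * u₁) * (theta q u₁ * theta q u₂ * theta q u₃ * theta q u₄ * theta q u₅ /
      theta q (b / a)) := by
  have hb0 : b ≠ 0 := by
    rw [hbu]
    positivity
  have haq : a * q ≠ 0 := mul_ne_zero ha hq0
  have hbq : ∀ k : ℤ, b * q ≠ q ^ k := fun k h => hb (k - 1) (by
    rw [zpow_sub_one₀ hq0, ← h]
    field_simp)
  have hbqa : ∀ k : ℤ, b * q / a ≠ q ^ k := fun k h => hba (k - 1) (by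
    rw [zpow_sub_one₀ hq0, ← h]
    field_simp)
  have s1 := summable_term51 hq0 hq (u₁ := u₁ / q) ha (div_ne_zero h₁ hq0) h₂ h₃ h₄ h₅
    (b := b) (by rw [hbu]; field_simp) hb hba
  have s2 := summable_term51 hq0 hq (u₁ := u₁) ha h₁ h₂ h₃ h₄ h₅
    (b := b * q) (by rw [hbu]; ring) hbq hbqa
  have key := term51_contiguous hq0 hq ha h₂ h₃ h₄ h₅ hbu hb hba
  set T := tele51 q a b u₁ u₂ u₃ u₄ u₅ with hTdef
  -- Summability of the differences is deduced from that of the two series, which needs a nonzero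
  -- prefactor. If the prefactor is zero, both sides of `hsum` vanish.
  have hT : a ^ 2 * u₁ * (1 - b * u₁) ≠ 0 → Summable fun n => T n - T (n - 1) := fun h => by
    refine (summable_mul_left_iff h).1 ?_
    simp only [key]
    exact (s1.mul_left _).sub (s2.mul_left _)
  have hth : theta q (b / a) ≠ 0 := theta_ne_zero hq0 hq (div_ne_zero hb0 ha) hba
  have hsum : ∑' n, a ^ 2 * u₁ * (1 - b * u₁) * (T n - T (n - 1)) =
      a ^ 2 * u₁ * (1 - b * u₁) * (theta q u₁ * theta q u₂ * theta q u₃ * theta q u₄ * theta q u₅ /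
      theta q (b / a)) := by
    by_cases h : a ^ 2 * u₁ * (1 - b * u₁) = 0
    · simp [h]
    · rw [tsum_mul_left, tsum_sub_shift_eq (hT h)
        (tendsto_tele51 hq0 hq ha hb0 h₁ h₂ h₃ h₄ h₅ hbu hth)
        (eventually_tele51_eq_zero hq0 hq _ _ _ _ hm)]
  rw [tsum_congr key, (s1.mul_left _).tsum_sub (s2.mul_left _), tsum_mul_left,
    tsum_mul_left] at hsum
  exact hsum

theorem mul_q_ne_zpow (hq0 : q ≠ 0) {x : ℂ} (h : ∀ k : ℤ, x ≠ q ^ k) (k : ℤ) : x * q ≠ q ^ k :=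
  fun h' => h (k - 1) (by
    rw [zpow_sub_one₀ hq0, ← h']
    field_simp)

theorem sum51_shift (hq0 : q ≠ 0) (hq : ‖q‖ < 1) {a b u₁ u₂ u₃ u₄ u₅ : ℂ} (ha : a ≠ 0)
    (h₁ : u₁ ≠ 0) (h₂ : u₂ ≠ 0) (h₃ : u₃ ≠ 0) (h₄ : u₄ ≠ 0) (h₅ : u₅ ≠ 0)
    (hbu : b = a ^ 3 * q * (u₁ * u₂ * u₃ * u₄ * u₅))
    (hb : ∀ k : ℤ, b ≠ q ^ k) (hba : ∀ k : ℤ, b / a ≠ q ^ k)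
    (hm : ∃ m : ℤ, a * u₄ = q ^ m ∨ a * u₅ = q ^ m) :
    (1 - b / (a * u₂)) * (1 - b / (a * u₃)) * (1 - b / (a * u₄)) * (1 - b / (a * u₅)) *
        sum51 q a b u₁ u₂ u₃ u₄ u₅ -
      (1 - a * q * u₁ * u₂) * (1 - a * q * u₁ * u₃) * (1 - a * q * u₁ * u₄) *
        (1 - a * q * u₁ * u₅) * sum51 q a (b * q) (u₁ * q) u₂ u₃ u₄ u₅ =
    -(a ^ 2 * q * (1 - b * q * u₁) * (theta q u₁ * theta q u₂ * theta q u₃ * theta q u₄ *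
      theta q u₅ / theta q (b / a))) := by
  have h := sum51_contiguous hq0 hq ha (mul_ne_zero h₁ hq0) h₂ h₃ h₄ h₅ (b := b)
    (by rw [hbu]; ring) hb hba hm
  rw [mul_div_cancel_right₀ _ hq0, theta_mul_q hq0 hq h₁] at h
  have e : ∀ u, a * (u₁ * q) * u = a * q * u₁ * u := fun u => by ring
  simp only [e] at h
  rw [h]
  field_simp

/-! ### The nonterminating ₈φ₇ summation -/

/-- A combination of two `sum51`, related by `(a, b, u) ↦ (a / z², b / z, z u)`. -/
def comb51 (q a z b c u₁ u₂ u₃ u₄ u₅ : ℂ) : ℂ :=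
  sum51 q a b u₁ u₂ u₃ u₄ u₅ -
    c * sum51 q (a / z ^ 2) (b / z) (z * u₁) (z * u₂) (z * u₃) (z * u₄) (z * u₅)

/-- The map `(a, b, u) ↦ (a/z², b/z, zu)` preserves the balancing condition and every coefficient of
`sum51_shift`, except the factor `a²` and the theta quotient on the right. The condition `hc` makes
the two boundary terms cancel, leaving a homogeneous recursion. -/
theorem comb51_shift (hq0 : q ≠ 0) (hq : ‖q‖ < 1) {a z b c u₁ u₂ u₃ u₄ u₅ : ℂ} (ha : a ≠ 0)
    (hz : z ≠ 0) (h₁ : u₁ ≠ 0) (h₂ : u₂ ≠ 0) (h₃ : u₃ ≠ 0) (h₄ : u₄ ≠ 0) (h₅ : u₅ ≠ 0)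
    (hbu : b = a ^ 3 * q * (u₁ * u₂ * u₃ * u₄ * u₅))
    (hb : ∀ k : ℤ, b ≠ q ^ k) (hba : ∀ k : ℤ, b / a ≠ q ^ k)
    (hbz : ∀ k : ℤ, b / z ≠ q ^ k) (hbza : ∀ k : ℤ, b * z / a ≠ q ^ k)
    (hm : ∃ m : ℤ, a * u₄ = q ^ m ∨ a * u₅ = q ^ m)
    (hmz : ∃ m : ℤ, a * u₄ / z = q ^ m ∨ a * u₅ / z = q ^ m)
    (hc : c * (theta q (z * u₁) * theta q (z * u₂) * theta q (z * u₃) * theta q (z * u₄) *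
        theta q (z * u₅)) * theta q (b / a) =
      z ^ 4 * (theta q u₁ * theta q u₂ * theta q u₃ * theta q u₄ * theta q u₅) *
        theta q (b * z / a)) :
    (1 - b / (a * u₂)) * (1 - b / (a * u₃)) * (1 - b / (a * u₄)) * (1 - b / (a * u₅)) *
        comb51 q a z b c u₁ u₂ u₃ u₄ u₅ =
      (1 - a * q * u₁ * u₂) * (1 - a * q * u₁ * u₃) * (1 - a * q * u₁ * u₄) *
        (1 - a * q * u₁ * u₅) * comb51 q a z (b * q) c (u₁ * q) u₂ u₃ u₄ u₅ := by
  have hb0 : b ≠ 0 := by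
    rw [hbu]
    positivity
  have e0 : b / z / (a / z ^ 2) = b * z / a := by field_simp
  have k1 := sum51_shift hq0 hq ha h₁ h₂ h₃ h₄ h₅ hbu hb hba hm
  have k2 := sum51_shift hq0 hq (a := a / z ^ 2) (b := b / z) (by positivity)
    (mul_ne_zero hz h₁) (mul_ne_zero hz h₂) (mul_ne_zero hz h₃) (mul_ne_zero hz h₄)
    (mul_ne_zero hz h₅) (by rw [hbu]; field_simp) hbz (by rwa [e0]) (by
      obtain ⟨m, hm⟩ := hmz
      refine ⟨m, hm.imp (fun h => ?_) (fun h => ?_)⟩ <;>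
      · rw [← h]
        field_simp)
  have e1 : ∀ u, b / z / (a / z ^ 2 * (z * u)) = b / (a * u) := fun u => by field_simp
  have e2 : ∀ u, a / z ^ 2 * q * (z * u₁) * (z * u) = a * q * u₁ * u := fun u => by field_simp
  have e3 : b / z * q = b * q / z := by ring
  have e4 : b * q / z * (z * u₁) = b * q * u₁ := by field_simp
  simp only [e0, e1, e2, e3, e4, mul_assoc z] at k2
  have t1 := theta_ne_zero hq0 hq (div_ne_zero hb0 ha) hba
  have t2 := theta_ne_zero hq0 hq (div_ne_zero (mul_ne_zero hb0 hz) ha) hbza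
  have hr : theta q u₁ * theta q u₂ * theta q u₃ * theta q u₄ * theta q u₅ / theta q (b / a) =
      c / z ^ 4 * (theta q (z * u₁) * theta q (z * u₂) * theta q (z * u₃) * theta q (z * u₄) *
        theta q (z * u₅) / theta q (b * z / a)) := by
    rw [div_mul_div_comm, div_eq_div_iff t1 (by positivity)]
    linear_combination -hc
  rw [hr] at k1
  rw [comb51, comb51]
  linear_combination k1 - c * k2

/-- By quasi-periodicity both sides of the condition on `c` acquire the same factor `a/(z u₁ b)`.
The same `c` thus serves along the whole iteration. -/
theorem comb51_coef_shift (hq0 : q ≠ 0) (hq : ‖q‖ < 1) {a z b c u₁ u₂ u₃ u₄ u₅ : ℂ} (ha : a ≠ 0)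
    (hz : z ≠ 0) (hb0 : b ≠ 0) (h₁ : u₁ ≠ 0)
    (hc : c * (theta q (z * u₁) * theta q (z * u₂) * theta q (z * u₃) * theta q (z * u₄) *
        theta q (z * u₅)) * theta q (b / a) =
      z ^ 4 * (theta q u₁ * theta q u₂ * theta q u₃ * theta q u₄ * theta q u₅) *
        theta q (b * z / a)) :
    c * (theta q (z * (u₁ * q)) * theta q (z * u₂) * theta q (z * u₃) * theta q (z * u₄) *
        theta q (z * u₅)) * theta q (b * q / a) =
      z ^ 4 * (theta q (u₁ * q) * theta q u₂ * theta q u₃ * theta q u₄ * theta q u₅) *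
        theta q (b * q * z / a) := by
  rw [← mul_assoc z, theta_mul_q hq0 hq h₁, theta_mul_q hq0 hq (mul_ne_zero hz h₁),
    show b * q / a = b / a * q by ring, show b * q * z / a = b * z / a * q by ring,
    theta_mul_q hq0 hq (div_ne_zero hb0 ha),
    theta_mul_q hq0 hq (div_ne_zero (mul_ne_zero hb0 hz) ha)]
  simp only [div_div_eq_mul_div]
  linear_combination a / (z * u₁ * b) * hc

theorem comb51_iterate (hq0 : q ≠ 0) (hq : ‖q‖ < 1) {a z b c u₁ u₂ u₃ u₄ u₅ : ℂ} (ha : a ≠ 0)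
    (hz : z ≠ 0) (h₁ : u₁ ≠ 0) (h₂ : u₂ ≠ 0) (h₃ : u₃ ≠ 0) (h₄ : u₄ ≠ 0) (h₅ : u₅ ≠ 0)
    (hbu : b = a ^ 3 * q * (u₁ * u₂ * u₃ * u₄ * u₅))
    (hb : ∀ k : ℤ, b ≠ q ^ k) (hba : ∀ k : ℤ, b / a ≠ q ^ k)
    (hbz : ∀ k : ℤ, b / z ≠ q ^ k) (hbza : ∀ k : ℤ, b * z / a ≠ q ^ k)
    (hm : ∃ m : ℤ, a * u₄ = q ^ m ∨ a * u₅ = q ^ m)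
    (hmz : ∃ m : ℤ, a * u₄ / z = q ^ m ∨ a * u₅ / z = q ^ m)
    (hc : c * (theta q (z * u₁) * theta q (z * u₂) * theta q (z * u₃) * theta q (z * u₄) *
        theta q (z * u₅)) * theta q (b / a) =
      z ^ 4 * (theta q u₁ * theta q u₂ * theta q u₃ * theta q u₄ * theta q u₅) *
        theta q (b * z / a)) (N : ℕ) :
    (∏ k ∈ Finset.range N, (1 - b / (a * u₂) * q ^ k)) *
      (∏ k ∈ Finset.range N, (1 - b / (a * u₃) * q ^ k)) *
      (∏ k ∈ Finset.range N, (1 - b / (a * u₄) * q ^ k)) *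
      (∏ k ∈ Finset.range N, (1 - b / (a * u₅) * q ^ k)) * comb51 q a z b c u₁ u₂ u₃ u₄ u₅ =
    (∏ k ∈ Finset.range N, (1 - a * q * u₁ * u₂ * q ^ k)) *
      (∏ k ∈ Finset.range N, (1 - a * q * u₁ * u₃ * q ^ k)) *
      (∏ k ∈ Finset.range N, (1 - a * q * u₁ * u₄ * q ^ k)) *
      (∏ k ∈ Finset.range N, (1 - a * q * u₁ * u₅ * q ^ k)) *
      comb51 q a z (b * q ^ N) c (u₁ * q ^ N) u₂ u₃ u₄ u₅ := by
  have hb0 : b ≠ 0 := by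
    rw [hbu]
    positivity
  have inv : ∀ N : ℕ, (∀ k : ℤ, b * q ^ N ≠ q ^ k) ∧ (∀ k : ℤ, b * q ^ N / a ≠ q ^ k) ∧
      (∀ k : ℤ, b * q ^ N / z ≠ q ^ k) ∧ (∀ k : ℤ, b * q ^ N * z / a ≠ q ^ k) ∧
      c * (theta q (z * (u₁ * q ^ N)) * theta q (z * u₂) * theta q (z * u₃) * theta q (z * u₄) *
        theta q (z * u₅)) * theta q (b * q ^ N / a) =
      z ^ 4 * (theta q (u₁ * q ^ N) * theta q u₂ * theta q u₃ * theta q u₄ * theta q u₅) *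
        theta q (b * q ^ N * z / a) := by
    intro N
    induction N with
    | zero => simpa using ⟨hb, hba, hbz, hbza, hc⟩
    | succ N ih =>
      obtain ⟨i1, i2, i3, i4, i5⟩ := ih
      have hN : q ^ N ≠ 0 := pow_ne_zero _ hq0
      simp only [pow_succ, ← mul_assoc b, ← mul_assoc u₁]
      refine ⟨mul_q_ne_zpow hq0 i1, ?_, ?_, ?_,
        comb51_coef_shift hq0 hq ha hz (by positivity) (by positivity) i5⟩
      · simpa only [div_mul_eq_mul_div] using mul_q_ne_zpow hq0 i2
      · simpa only [div_mul_eq_mul_div] using mul_q_ne_zpow hq0 i3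
      · have := mul_q_ne_zpow hq0 i4
        rwa [show b * q ^ N * z / a * q = b * q ^ N * q * z / a by ring] at this
  induction N with
  | zero => simp
  | succ N ih =>
    obtain ⟨i1, i2, i3, i4, i5⟩ := inv N
    have hN : q ^ N ≠ 0 := pow_ne_zero _ hq0
    have s := comb51_shift hq0 hq ha hz (by positivity) h₂ h₃ h₄ h₅ (b := b * q ^ N)
      (u₁ := u₁ * q ^ N) (by rw [hbu]; ring) i1 i2 i3 i4 hm hmz i5
    have e1 : ∀ u, b * q ^ N / (a * u) = b / (a * u) * q ^ N := fun u => by ring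
    have e2 : ∀ u, a * q * (u₁ * q ^ N) * u = a * q * u₁ * u * q ^ N := fun u => by ring
    simp only [e1, e2] at s
    simp only [Finset.prod_range_succ, pow_succ, ← mul_assoc b, ← mul_assoc u₁]
    calc _ = (1 - b / (a * u₂) * q ^ N) * (1 - b / (a * u₃) * q ^ N) *
          (1 - b / (a * u₄) * q ^ N) * (1 - b / (a * u₅) * q ^ N) * _ := by
          rw [mul_comm ((1 - b / (a * u₂) * q ^ N) * _ * _ * _), show ∀ p₁ p₂ p₃ p₄ x₁ x₂ x₃ x₄ D : ℂ, p₁ * x₁ * (p₂ * x₂) * (p₃ * x₃) * (p₄ * x₄) * D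
            = (p₁ * p₂ * p₃ * p₄ * D) * (x₁ * x₂ * x₃ * x₄) from fun _ _ _ _ _ _ _ _ _ => by ring]
      _ = _ := by
          rw [ih]
          linear_combination (∏ k ∈ Finset.range N, (1 - a * q * u₁ * u₂ * q ^ k)) *
            (∏ k ∈ Finset.range N, (1 - a * q * u₁ * u₃ * q ^ k)) *
            (∏ k ∈ Finset.range N, (1 - a * q * u₁ * u₄ * q ^ k)) *
            (∏ k ∈ Finset.range N, (1 - a * q * u₁ * u₅ * q ^ k)) * s

/-- As `N → ∞` the factors with `u₁ q^N` and `b q^N` tend to `1` in each term, leaving a ₆ψ₆. The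
norm hypothesis is the convergence condition of that limit and also provides the dominating series.
-/
theorem tendsto_sum51 (hq0 : q ≠ 0) (hq : ‖q‖ < 1) {a b u₁ u₂ u₃ u₄ u₅ : ℂ} (ha : a ≠ 0)
    (h₁ : u₁ ≠ 0) (h₂ : u₂ ≠ 0) (h₃ : u₃ ≠ 0) (h₄ : u₄ ≠ 0) (h₅ : u₅ ≠ 0)
    (hbu : b = a ^ 3 * q * (u₁ * u₂ * u₃ * u₄ * u₅))
    (hb : ∀ k : ℤ, b ≠ q ^ k) (hba : ∀ k : ℤ, b / a ≠ q ^ k)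
    (h : ‖a ^ 2 * q * (u₂ * u₃ * u₄ * u₅)‖ < 1) :
    Tendsto (fun N : ℕ => sum51 q a (b * q ^ N) (u₁ * q ^ N) u₂ u₃ u₄ u₅) atTop
      (𝓝 (sum4 q a u₂ u₃ u₄ u₅)) := by
  have hb0 : b ≠ 0 := by
    rw [hbu]
    positivity
  obtain ⟨C, hC0, hC⟩ := exists_norm_term51_le hq0 hq ha hb0 h₁ h₂ h₃ h₄ h₅ hb hba
  have e : a ^ 2 * q * (u₂ * u₃ * u₄ * u₅) * (a * q * u₁ / b) = q := by
    rw [hbu]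
    field_simp
  have hl : Real.log ‖a ^ 2 * q * (u₂ * u₃ * u₄ * u₅)‖ + Real.log ‖a * q * u₁ / b‖ =
      Real.log ‖q‖ := by
    rw [← Real.log_mul, ← norm_mul, e]
    · exact norm_ne_zero_iff.2 (by positivity)
    · exact norm_ne_zero_iff.2 (by positivity)
  have hl1 := Real.log_neg (norm_pos_iff.2 (by positivity)) h
  have hl2 := Real.log_neg (norm_pos_iff.2 hq0) hq
  set L := Real.log ‖a ^ 2 * q * (u₂ * u₃ * u₄ * u₅)‖
  set M := Real.log ‖a * q * u₁ / b‖
  refine tendsto_tsum_of_dominated_convergence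
    ((summable_exp_neg_abs (max_lt hl1 hl2)).mul_left C) (fun n => ?_)
    (Eventually.of_forall fun N n => (hC N n).trans ?_)
  · have g : ∀ x : ℂ, Tendsto (fun N : ℕ => qInf q (x * q ^ N)) atTop (𝓝 1) :=
      tendsto_qInf_mul_pow hq
    have g' := ((((g (u₁ * q ^ (1 - n))).div (g (b / a * q ^ (-n))) one_ne_zero).mul
      ((g (a * u₁ * q ^ (1 + n))).div (g (b * q ^ n)) one_ne_zero))).const_mul
      (term4 q a u₂ u₃ u₄ u₅ n)
    rw [div_one, mul_one, mul_one] at g'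
    refine g'.congr fun N => ?_
    rw [term51_eq]
    simp only [Pi.div_apply]
    ring_nf
  · gcongr
    have m1 : max ((n : ℝ) - N) 0 + max (-(n : ℝ) - N) 0 ≤ |(n : ℝ)| := by
      have hN : (0 : ℝ) ≤ N := Nat.cast_nonneg N
      rcases le_total 0 (n : ℝ) with h0 | h0
      · rw [max_eq_right (by linarith : -(n : ℝ) - N ≤ 0), abs_of_nonneg h0, add_zero]
        exact max_le (by linarith) h0
      · rw [max_eq_right (by linarith : (n : ℝ) - N ≤ 0), abs_of_nonpos h0, zero_add]
        exact max_le (by linarith) (by linarith)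
    have m0 : 0 ≤ max ((n : ℝ) - N) 0 + max (-(n : ℝ) - N) 0 := by positivity
    rcases le_total M 0 with hM | hM
    · nlinarith [le_max_left L (Real.log ‖q‖), abs_nonneg (n : ℝ)]
    · nlinarith [le_max_right L (Real.log ‖q‖), abs_nonneg (n : ℝ)]

/-- Iterating the recursion to the limit gives two ₆ψ₆ sums. Their pair products agree, since `a q u
v` is unchanged when `(a, u, v)` becomes `(a/z², zu, zv)`; they differ only in the theta factor,
hence `θ(a) - c θ(a/z²)`. -/
theorem comb51_eq_of_norm_lt (hq0 : q ≠ 0) (hq : ‖q‖ < 1) {a z b c u₁ u₂ u₃ u₄ u₅ : ℂ}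
    (ha : a ≠ 0) (hz : z ≠ 0) (h₁ : u₁ ≠ 0) (h₂ : u₂ ≠ 0) (h₃ : u₃ ≠ 0) (h₄ : u₄ ≠ 0)
    (h₅ : u₅ ≠ 0) (hbu : b = a ^ 3 * q * (u₁ * u₂ * u₃ * u₄ * u₅))
    (hb : ∀ k : ℤ, b ≠ q ^ k) (hba : ∀ k : ℤ, b / a ≠ q ^ k)
    (hbz : ∀ k : ℤ, b / z ≠ q ^ k) (hbza : ∀ k : ℤ, b * z / a ≠ q ^ k)
    (hm : ∃ m : ℤ, a * u₄ = q ^ m ∨ a * u₅ = q ^ m)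
    (hmz : ∃ m : ℤ, a * u₄ / z = q ^ m ∨ a * u₅ / z = q ^ m)
    (hc : c * (theta q (z * u₁) * theta q (z * u₂) * theta q (z * u₃) * theta q (z * u₄) *
        theta q (z * u₅)) * theta q (b / a) =
      z ^ 4 * (theta q u₁ * theta q u₂ * theta q u₃ * theta q u₄ * theta q u₅) *
        theta q (b * z / a)) (h : ‖b / (a * u₁)‖ < 1) :
    qInf q (b / (a * u₁)) * qInf q (b / (a * u₂)) * qInf q (b / (a * u₃)) *
      qInf q (b / (a * u₄)) * qInf q (b / (a * u₅)) * comb51 q a z b c u₁ u₂ u₃ u₄ u₅ =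
    qInf q q * (theta q a - c * theta q (a / z ^ 2)) *
      (qInf q (a * q * u₁ * u₂) * qInf q (a * q * u₁ * u₃) * qInf q (a * q * u₁ * u₄) *
      qInf q (a * q * u₁ * u₅) * (qInf q (a * q * u₂ * u₃) * qInf q (a * q * u₂ * u₄) *
      qInf q (a * q * u₂ * u₅) * qInf q (a * q * u₃ * u₄) * qInf q (a * q * u₃ * u₅) *
      qInf q (a * q * u₄ * u₅))) := by
  have e0 : b / z / (a / z ^ 2) = b * z / a := by field_simp
  have e1 : a ^ 2 * q * (u₂ * u₃ * u₄ * u₅) = b / (a * u₁) := by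
    rw [hbu]
    field_simp
  have e2 : (a / z ^ 2) ^ 2 * q * (z * u₂ * (z * u₃) * (z * u₄) * (z * u₅)) = b / (a * u₁) := by
    rw [hbu]
    field_simp
  have l1 := tendsto_sum51 hq0 hq ha h₁ h₂ h₃ h₄ h₅ hbu hb hba (by rwa [e1])
  have l2 := tendsto_sum51 hq0 hq (a := a / z ^ 2) (b := b / z) (by positivity)
    (mul_ne_zero hz h₁) (mul_ne_zero hz h₂) (mul_ne_zero hz h₃) (mul_ne_zero hz h₄)
    (mul_ne_zero hz h₅) (by rw [hbu]; field_simp) hbz (by rwa [e0]) (by rwa [e2])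
  have l3 : Tendsto (fun N : ℕ => comb51 q a z (b * q ^ N) c (u₁ * q ^ N) u₂ u₃ u₄ u₅) atTop
      (𝓝 (sum4 q a u₂ u₃ u₄ u₅ -
        c * sum4 q (a / z ^ 2) (z * u₂) (z * u₃) (z * u₄) (z * u₅))) := by
    refine l1.sub (l2.const_mul c |>.congr fun N => ?_)
    rw [mul_assoc z, div_mul_eq_mul_div]
  have p := tendsto_prod_qInf hq
  have key := tendsto_nhds_unique
    ((((p _).mul (p _)).mul (p _)).mul (p _) |>.mul_const (comb51 q a z b c u₁ u₂ u₃ u₄ u₅))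
    (((((p _).mul (p _)).mul (p _)).mul (p _) |>.mul l3).congr fun N =>
      (comb51_iterate hq0 hq ha hz h₁ h₂ h₃ h₄ h₅ hbu hb hba hbz hbza hm hmz hc N).symm)
  have s1 := sum4_eq hq0 hq ha (u₁ := u₂) (u₂ := u₃) (u₃ := u₄) (u₄ := u₅) (by rwa [e1])
  have s2 := sum4_eq hq0 hq (a := a / z ^ 2) (by positivity) (u₁ := z * u₂) (u₂ := z * u₃)
    (u₃ := z * u₄) (u₄ := z * u₅) (by rwa [e2])
  have e3 : ∀ u v, a / z ^ 2 * q * (z * u) * (z * v) = a * q * u * v := fun u v => by field_simp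
  rw [e1] at s1
  simp only [e2, e3] at s2
  set P := qInf q (a * q * u₁ * u₂) * qInf q (a * q * u₁ * u₃) * qInf q (a * q * u₁ * u₄) *
      qInf q (a * q * u₁ * u₅)
  linear_combination qInf q (b / (a * u₁)) * key + P * s1 - P * c * s2

theorem sum51_swap (q a b u₁ u₂ u₃ u₄ u₅ : ℂ) :
    sum51 q a b u₁ u₂ u₃ u₄ u₅ = sum51 q a b u₂ u₁ u₃ u₄ u₅ := by
  simp only [sum51, term51, mul_comm (ker q a u₁ _) (ker q a u₂ _)]

/-- A nonterminating form of the very-well-poised `₈φ₇` summation. -/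
theorem comb51_eq (hq0 : q ≠ 0) (hq : ‖q‖ < 1) {a z b c u₁ u₂ u₃ u₄ u₅ : ℂ}
    (ha : a ≠ 0) (hz : z ≠ 0) (h₁ : u₁ ≠ 0) (h₂ : u₂ ≠ 0) (h₃ : u₃ ≠ 0) (h₄ : u₄ ≠ 0)
    (h₅ : u₅ ≠ 0) (hbu : b = a ^ 3 * q * (u₁ * u₂ * u₃ * u₄ * u₅))
    (hb : ∀ k : ℤ, b ≠ q ^ k) (hba : ∀ k : ℤ, b / a ≠ q ^ k)
    (hbz : ∀ k : ℤ, b / z ≠ q ^ k) (hbza : ∀ k : ℤ, b * z / a ≠ q ^ k)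
    (hm : ∃ m : ℤ, a * u₄ = q ^ m ∨ a * u₅ = q ^ m)
    (hmz : ∃ m : ℤ, a * u₄ / z = q ^ m ∨ a * u₅ / z = q ^ m)
    (hc : c * (theta q (z * u₁) * theta q (z * u₂) * theta q (z * u₃) * theta q (z * u₄) *
        theta q (z * u₅)) * theta q (b / a) =
      z ^ 4 * (theta q u₁ * theta q u₂ * theta q u₃ * theta q u₄ * theta q u₅) *
        theta q (b * z / a)) :
    qInf q (b / (a * u₁)) * qInf q (b / (a * u₂)) * qInf q (b / (a * u₃)) *
      qInf q (b / (a * u₄)) * qInf q (b / (a * u₅)) * comb51 q a z b c u₁ u₂ u₃ u₄ u₅ =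
    qInf q q * (theta q a - c * theta q (a / z ^ 2)) *
      (qInf q (a * q * u₁ * u₂) * qInf q (a * q * u₁ * u₃) * qInf q (a * q * u₁ * u₄) *
      qInf q (a * q * u₁ * u₅) * (qInf q (a * q * u₂ * u₃) * qInf q (a * q * u₂ * u₄) *
      qInf q (a * q * u₂ * u₅) * qInf q (a * q * u₃ * u₄) * qInf q (a * q * u₃ * u₅) *
      qInf q (a * q * u₄ * u₅))) := by
  -- The restriction `‖b/(a u₁)‖ < 1` is removed by induction on `N`. Shifting `u₂` instead of `u₁`
  -- multiplies `b` by `q` while `u₁` stays fixed, so `b/(a u₁)` shrinks by a factor `q`.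
  obtain ⟨N, hN⟩ : ∃ N : ℕ, ‖b * q ^ N / (a * u₁)‖ < 1 := by
    have h := ((tendsto_pow_atTop_nhds_zero_of_norm_lt_one hq).const_mul (b / (a * u₁))).norm
    rw [mul_zero, norm_zero] at h
    obtain ⟨N, hN⟩ := (h.eventually_lt_const one_pos).exists
    exact ⟨N, by rwa [mul_div_right_comm]⟩
  induction N generalizing b u₂ with
  | zero =>
    rw [pow_zero, mul_one] at hN
    exact comb51_eq_of_norm_lt hq0 hq ha hz h₁ h₂ h₃ h₄ h₅ hbu hb hba hbz hbza hm hmz hc hN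
  | succ N ih =>
    have hb0 : b ≠ 0 := by
      rw [hbu]
      positivity
    have hc' : c * (theta q (z * u₂) * theta q (z * u₁) * theta q (z * u₃) * theta q (z * u₄) *
        theta q (z * u₅)) * theta q (b / a) =
      z ^ 4 * (theta q u₂ * theta q u₁ * theta q u₃ * theta q u₄ * theta q u₅) *
        theta q (b * z / a) := by linear_combination hc
    have s := comb51_shift hq0 hq ha hz h₂ h₁ h₃ h₄ h₅ (b := b) (by rw [hbu]; ring)
      hb hba hbz hbza hm hmz hc'
    have k := ih (b := b * q) (u₂ := u₂ * q) (by positivity) (by rw [hbu]; ring)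
      (mul_q_ne_zpow hq0 hb)
      (by simpa only [div_mul_eq_mul_div] using mul_q_ne_zpow hq0 hba)
      (by simpa only [div_mul_eq_mul_div] using mul_q_ne_zpow hq0 hbz)
      (by
        have := mul_q_ne_zpow hq0 hbza
        rwa [show b * z / a * q = b * q * z / a by ring] at this)
      (by linear_combination comb51_coef_shift hq0 hq ha hz hb0 h₂ hc')
      (by rwa [mul_assoc b, ← pow_succ'])
    have e : ∀ u v b, comb51 q a z b c u v u₃ u₄ u₅ = comb51 q a z b c v u u₃ u₄ u₅ :=
      fun u v b => by rw [comb51, comb51, sum51_swap q a b u, sum51_swap q _ _ (z * u)]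
    rw [e u₂, e (u₂ * q)] at s
    have e1 : ∀ u, b * q / (a * u) = b / (a * u) * q := fun u => by ring
    have e2 : b * q / (a * (u₂ * q)) = b / (a * u₂) := by field_simp
    have e3 : ∀ u, a * q * (u₂ * q) * u = a * q * u₂ * u * q := fun u => by ring
    have e4 : a * q * u₁ * (u₂ * q) = a * q * u₂ * u₁ * q := by ring
    simp only [e2, e1, e3, e4] at k
    have r1 := qInf_eq_mul q (b / (a * u₁)) hq
    have r3 := qInf_eq_mul q (b / (a * u₃)) hq
    have r4 := qInf_eq_mul q (b / (a * u₄)) hq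
    have r5 := qInf_eq_mul q (b / (a * u₅)) hq
    have t1 := qInf_eq_mul q (a * q * u₂ * u₁) hq
    have t3 := qInf_eq_mul q (a * q * u₂ * u₃) hq
    have t4 := qInf_eq_mul q (a * q * u₂ * u₄) hq
    have t5 := qInf_eq_mul q (a * q * u₂ * u₅) hq
    rw [r1, r3, r4, r5, show a * q * u₁ * u₂ = a * q * u₂ * u₁ by ring, t1, t3, t4, t5]
    linear_combination qInf q (b / (a * u₁) * q) * qInf q (b / (a * u₃) * q) *
      qInf q (b / (a * u₄) * q) * qInf q (b / (a * u₅) * q) * qInf q (b / (a * u₂)) * s +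
      (1 - a * q * u₂ * u₁) * (1 - a * q * u₂ * u₃) * (1 - a * q * u₂ * u₄) *
        (1 - a * q * u₂ * u₅) * k

/-! ### The normalised ₈ψ₈ series and its discrete family -/

/-- The general term of the normalised very-well-poised `₈ψ₈` series with parameters `1/uᵢ`. -/
def term6 (q a u₁ u₂ u₃ u₄ u₅ u₆ : ℂ) (n : ℤ) : ℂ :=
  (1 - a * q ^ (2 * n)) * q ^ (-n) * (a ^ (3 * n) * q ^ (3 * n ^ 2)) *
    (ker q a u₁ n * ker q a u₂ n * ker q a u₃ n * ker q a u₄ n * (ker q a u₅ n * ker q a u₆ n))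

/-- The normalised very-well-poised `₈ψ₈` series with parameters `1/uᵢ`. -/
def sum6 (q a u₁ u₂ u₃ u₄ u₅ u₆ : ℂ) : ℂ := ∑' n : ℤ, term6 q a u₁ u₂ u₃ u₄ u₅ u₆ n

/-- Four kernels against the Gaussian `a^{3n} q^{3n²}` leave an excess `nA + n² log|q|`. It is
cancelled either by two further kernels of base `a` or, in the double series, by
`exists_norm_ker_swap_le`. -/
theorem exists_norm_ker_mul4_le (hq0 : q ≠ 0) (hq : ‖q‖ < 1) (A U₁ U₂ U₃ U₄ : ℝ) :
    ∃ C, 0 ≤ C ∧ ∀ a u₁ u₂ u₃ u₄ : ℂ, ‖a‖ = Real.exp A → ‖u₁‖ ≤ Real.exp U₁ →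
      ‖u₂‖ ≤ Real.exp U₂ → ‖u₃‖ ≤ Real.exp U₃ → ‖u₄‖ ≤ Real.exp U₄ → ∀ n : ℤ,
      ‖(1 - a * q ^ (2 * n)) * q ^ (-n) * (a ^ (3 * n) * q ^ (3 * n ^ 2)) *
        (ker q a u₁ n * ker q a u₂ n * ker q a u₃ n * ker q a u₄ n)‖ ≤
      C * Real.exp ((U₁ + U₂ + U₃ + U₄ + 2 * A + Real.log ‖q‖) * |(n : ℝ)| + n * A +
        n ^ 2 * Real.log ‖q‖) := by
  obtain ⟨C₁, p₁, h₁⟩ := exists_norm_term4_le hq0 hq A U₁ U₂ U₃ U₄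
  refine ⟨C₁ * (1 * 1), by positivity, fun a u₁ u₂ u₃ u₄ ha k₁ k₂ k₃ k₄ n => ?_⟩
  have ha0 : a ≠ 0 := norm_ne_zero_iff.1 (by rw [ha]; exact (Real.exp_pos A).ne')
  have b1 := (norm_zpow_eq_exp ha n).le.trans_eq (one_mul _).symm
  have b2 := (norm_zpow_eq_exp (norm_eq_exp_log hq0) (n ^ 2)).le.trans_eq (one_mul _).symm
  have e : (1 - a * q ^ (2 * n)) * q ^ (-n) * (a ^ (3 * n) * q ^ (3 * n ^ 2)) *
        (ker q a u₁ n * ker q a u₂ n * ker q a u₃ n * ker q a u₄ n) =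
      term4 q a u₁ u₂ u₃ u₄ n * (a ^ n * q ^ (n ^ 2)) := by
    rw [term4, show 3 * n = 2 * n + n by ring, show 3 * n ^ 2 = 2 * n ^ 2 + n ^ 2 by ring,
      zpow_add₀ ha0, zpow_add₀ hq0 (2 * n ^ 2)]
    ring
  rw [e]
  refine (norm_mul_le_exp p₁ (h₁ a u₁ u₂ u₃ u₄ ha k₁ k₂ k₃ k₄ n)
    (norm_mul_le_exp (by positivity) b1 b2)).trans_eq ?_
  congr 2
  push_cast
  ring

theorem exists_norm_term6_le (hq0 : q ≠ 0) (hq : ‖q‖ < 1) (A U₁ U₂ U₃ U₄ U₅ U₆ : ℝ) :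
    ∃ C, 0 ≤ C ∧ ∀ a u₁ u₂ u₃ u₄ u₅ u₆ : ℂ, ‖a‖ = Real.exp A → ‖u₁‖ ≤ Real.exp U₁ →
      ‖u₂‖ ≤ Real.exp U₂ → ‖u₃‖ ≤ Real.exp U₃ → ‖u₄‖ ≤ Real.exp U₄ → ‖u₅‖ ≤ Real.exp U₅ →
      ‖u₆‖ ≤ Real.exp U₆ → ∀ n : ℤ, ‖term6 q a u₁ u₂ u₃ u₄ u₅ u₆ n‖ ≤
      C * Real.exp ((U₁ + U₂ + U₃ + U₄ + U₅ + U₆ + 3 * A + 2 * Real.log ‖q‖) * |(n : ℝ)|) := by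
  obtain ⟨C, p, h⟩ := exists_norm_ker_mul4_le hq0 hq A U₁ U₂ U₃ U₄
  obtain ⟨C₁, p₁, h₁⟩ := exists_norm_ker_le hq0 hq A U₅
  obtain ⟨C₂, p₂, h₂⟩ := exists_norm_ker_le hq0 hq A U₆
  refine ⟨C * (C₁ * C₂), by positivity, fun a u₁ u₂ u₃ u₄ u₅ u₆ ha k₁ k₂ k₃ k₄ k₅ k₆ n => ?_⟩
  rw [term6, ← mul_assoc]
  refine (norm_mul_le_exp p (h a u₁ u₂ u₃ u₄ ha k₁ k₂ k₃ k₄ n)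
    (norm_mul_le_exp p₁ (h₁ a u₅ ha k₅ n) (h₂ a u₆ ha k₆ n))).trans_eq ?_
  congr 2
  ring

theorem log_norm_term6_ratio (hq0 : q ≠ 0) {a u₁ u₂ u₃ u₄ u₅ u₆ : ℂ} (ha : a ≠ 0)
    (h₁ : u₁ ≠ 0) (h₂ : u₂ ≠ 0) (h₃ : u₃ ≠ 0) (h₄ : u₄ ≠ 0) (h₅ : u₅ ≠ 0) (h₆ : u₆ ≠ 0) :
    Real.log ‖u₁‖ + Real.log ‖u₂‖ + Real.log ‖u₃‖ + Real.log ‖u₄‖ + Real.log ‖u₅‖ +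
      Real.log ‖u₆‖ + 3 * Real.log ‖a‖ + 2 * Real.log ‖q‖ =
    Real.log ‖a ^ 3 * q ^ 2 * (u₁ * u₂ * u₃ * u₄ * u₅ * u₆)‖ := by
  simp only [norm_mul, norm_pow]
  have := norm_ne_zero_iff.2 ha
  have := norm_ne_zero_iff.2 hq0
  have := norm_ne_zero_iff.2 h₁
  have := norm_ne_zero_iff.2 h₂
  have := norm_ne_zero_iff.2 h₃
  have := norm_ne_zero_iff.2 h₄
  have := norm_ne_zero_iff.2 h₅
  have := norm_ne_zero_iff.2 h₆
  rw [Real.log_mul (by positivity) (by positivity), Real.log_mul (by positivity) (by positivity),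
    Real.log_mul (by positivity) (by positivity), Real.log_mul (by positivity) (by positivity),
    Real.log_mul (by positivity) (by positivity), Real.log_mul (by positivity) (by positivity),
    Real.log_mul (by positivity) (by positivity), Real.log_pow, Real.log_pow]
  push_cast
  ring

theorem summable_term6 (hq0 : q ≠ 0) (hq : ‖q‖ < 1) {a u₁ u₂ u₃ u₄ u₅ u₆ : ℂ} (ha : a ≠ 0)
    (h₁ : u₁ ≠ 0) (h₂ : u₂ ≠ 0) (h₃ : u₃ ≠ 0) (h₄ : u₄ ≠ 0) (h₅ : u₅ ≠ 0) (h₆ : u₆ ≠ 0)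
    (h : ‖a ^ 3 * q ^ 2 * (u₁ * u₂ * u₃ * u₄ * u₅ * u₆)‖ < 1) :
    Summable (term6 q a u₁ u₂ u₃ u₄ u₅ u₆) := by
  obtain ⟨C, -, hC⟩ := exists_norm_term6_le hq0 hq (Real.log ‖a‖) (Real.log ‖u₁‖)
    (Real.log ‖u₂‖) (Real.log ‖u₃‖) (Real.log ‖u₄‖) (Real.log ‖u₅‖) (Real.log ‖u₆‖)
  rw [log_norm_term6_ratio hq0 ha h₁ h₂ h₃ h₄ h₅ h₆] at hC
  exact Summable.of_norm_bounded ((summable_exp_neg_abs (Real.log_neg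
    (norm_pos_iff.2 (by positivity)) h)).mul_left C)
    (hC a u₁ u₂ u₃ u₄ u₅ u₆ (norm_eq_exp_log ha) (norm_eq_exp_log h₁).le (norm_eq_exp_log h₂).le
      (norm_eq_exp_log h₃).le (norm_eq_exp_log h₄).le (norm_eq_exp_log h₅).le
      (norm_eq_exp_log h₆).le)

/-- The kernel of `b⁻¹` consists of the complementary factors of `θ(b qⁿ) θ((b/a) q⁻ⁿ)`. By
quasi-periodicity this theta product is `θ(b) θ(b/a) a⁻ⁿ q^{-n²}`, so the kernel moves to the
denominator and the Gaussian drops from exponent three to two. -/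
theorem sum6_eq_sum51 (hq0 : q ≠ 0) (hq : ‖q‖ < 1) {a b : ℂ} (u₁ u₂ u₃ u₄ u₅ : ℂ) (ha : a ≠ 0)
    (hb0 : b ≠ 0) (hb : ∀ k : ℤ, b ≠ q ^ k) (hba : ∀ k : ℤ, b / a ≠ q ^ k) :
    sum6 q a u₁ u₂ u₃ b⁻¹ u₄ u₅ = theta q b * theta q (b / a) * sum51 q a b u₁ u₂ u₃ u₄ u₅ := by
  rw [sum6, sum51, ← tsum_mul_left]
  refine tsum_congr fun n => ?_
  have hn : q ^ n ≠ 0 := zpow_ne_zero _ hq0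
  have n1 : qInf q (b * q ^ n) ≠ 0 := qInf_ne_zero hq fun k h => hb (-n - k) (by
    rw [zpow_sub₀ hq0, zpow_natCast, zpow_neg]
    have := pow_ne_zero k hq0
    field_simp
    linear_combination h)
  have n2 : qInf q (b / a * q ^ (-n)) ≠ 0 := qInf_ne_zero hq fun k h => hba (n - k) (by
    rw [zpow_sub₀ hq0, zpow_natCast, eq_div_iff (pow_ne_zero k hq0)]
    rw [zpow_neg] at h
    field_simp at h ⊢
    linear_combination h)
  have t := theta_mul_theta_zpow hq0 hq (div_ne_zero hb0 ha) hb0 n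
  have e1 : q / (b * q ^ n) = b⁻¹ * q ^ (1 - n) := by
    rw [zpow_sub₀ hq0]
    field_simp
  have e2 : q / (b / a * q ^ (-n)) = a * b⁻¹ * q ^ (1 + n) := by
    rw [zpow_add₀ hq0, zpow_neg]
    field_simp
  have e3 : (b / a / b) ^ n * q ^ (-n ^ 2) * (a ^ (3 * n) * q ^ (3 * n ^ 2)) =
      a ^ (2 * n) * q ^ (2 * n ^ 2) := by
    rw [show b / a / b = a⁻¹ by field_simp, show 3 * n = n + 2 * n by ring,
      show 3 * n ^ 2 = n ^ 2 + 2 * n ^ 2 by ring, zpow_add₀ ha, zpow_add₀ hq0, inv_zpow, zpow_neg]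
    have := zpow_ne_zero n ha
    have := zpow_ne_zero (n ^ 2) hq0
    field_simp
  have hk : ker q a b⁻¹ n = (b / a / b) ^ n * q ^ (-n ^ 2) * (theta q (b / a) * theta q b) /
      (qInf q (b * q ^ n) * qInf q (b / a * q ^ (-n))) := by
    rw [← t, theta, theta, e1, e2, ker, eq_div_iff (mul_ne_zero n1 n2)]
    ring
  rw [term6, term51, hk, ← e3]
  ring

/-- The product of `(aq uᵢuⱼ; q)_∞` over the pairs `i < j` of four indices. -/
def pairs4 (q a u₁ u₂ u₃ u₄ : ℂ) : ℂ :=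
  qInf q (a * q * u₁ * u₂) * qInf q (a * q * u₁ * u₃) * qInf q (a * q * u₁ * u₄) *
    (qInf q (a * q * u₂ * u₃) * qInf q (a * q * u₂ * u₄) * qInf q (a * q * u₃ * u₄))

/-- With last parameters `(z/a) q^m` and `a⁻¹ q^{-m}`, the infinite products of `comb51_eq` that
involve them become kernels of base `z` and index `m`. The products with argument `b/(a uᵢ)`, `(b/z)
q^{-m}` and `b q^m` are completed to theta functions. -/
theorem comb51_mul_pairs4 (hq0 : q ≠ 0) (hq : ‖q‖ < 1) {a z b c u₁ u₂ u₃ : ℂ}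
    (ha : a ≠ 0) (hz : z ≠ 0) (h₁ : u₁ ≠ 0) (h₂ : u₂ ≠ 0) (h₃ : u₃ ≠ 0)
    (hbu : b = a * z * q * (u₁ * u₂ * u₃)) (m : ℤ)
    (hb : ∀ k : ℤ, b ≠ q ^ k) (hba : ∀ k : ℤ, b / a ≠ q ^ k)
    (hbz : ∀ k : ℤ, b / z ≠ q ^ k) (hbza : ∀ k : ℤ, b * z / a ≠ q ^ k)
    (hc : c * (theta q (z * u₁) * theta q (z * u₂) * theta q (z * u₃) *
        theta q (z * (z / a * q ^ m)) * theta q (z * (a⁻¹ * q ^ (-m)))) * theta q (b / a) =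
      z ^ 4 * (theta q u₁ * theta q u₂ * theta q u₃ * theta q (z / a * q ^ m) *
        theta q (a⁻¹ * q ^ (-m))) * theta q (b * z / a)) :
    theta q (b / (a * u₁)) * theta q (b / (a * u₂)) * theta q (b / (a * u₃)) *
      ((z⁻¹) ^ m * q ^ (-m ^ 2) * (theta q (b / z) * theta q b)) *
      comb51 q a z b c u₁ u₂ u₃ (z / a * q ^ m) (a⁻¹ * q ^ (-m)) =
    qInf q q * qInf q (q * z / a) * (theta q a - c * theta q (a / z ^ 2)) *
      pairs4 q a u₁ u₂ u₃ b⁻¹ *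
      (ker q z u₁ m * ker q z u₂ m * ker q z u₃ m * ker q z b⁻¹ m) := by
  have hb0 : b ≠ 0 := by
    rw [hbu]
    positivity
  have hm : q ^ m ≠ 0 := zpow_ne_zero _ hq0
  have hm' : q ^ (-m) ≠ 0 := zpow_ne_zero _ hq0
  -- The choice of `u₄`, `u₅` truncates both series on the left: `a u₅ = q^{-m}` for base `a`, and
  -- `a u₄/z = q^m` for base `a/z²`. It also turns balancing into `b = a z q u₁u₂u₃`.
  have h := comb51_eq hq0 hq ha hz h₁ h₂ h₃ (u₄ := z / a * q ^ m) (u₅ := a⁻¹ * q ^ (-m))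
    (by positivity) (by positivity) (b := b) (by
      rw [hbu, zpow_neg]
      field_simp) hb hba hbz hbza ⟨-m, Or.inr (mul_inv_cancel_left₀ ha _)⟩
    ⟨m, Or.inl (by field_simp)⟩ hc
  have e4 : b / (a * (z / a * q ^ m)) = b / z * q ^ (-m) := by
    rw [zpow_neg]
    field_simp
  have e5 : b / (a * (a⁻¹ * q ^ (-m))) = b * q ^ m := by
    rw [zpow_neg]
    field_simp
  have f4 : ∀ u, a * q * u * (z / a * q ^ m) = z * u * q ^ (1 + m) := fun u => by
    rw [zpow_add₀ hq0, zpow_one]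
    field_simp
  have f5 : ∀ u, a * q * u * (a⁻¹ * q ^ (-m)) = u * q ^ (1 - m) := fun u => by
    rw [zpow_sub₀ hq0, zpow_one, zpow_neg]
    field_simp
  have g45 : z / a * q ^ m * q ^ (1 - m) = q * z / a := by
    rw [zpow_sub₀ hq0, zpow_one]
    field_simp
  simp only [e4, e5, f4, f5, g45] at h
  have t := theta_mul_theta_zpow hq0 hq (div_ne_zero hb0 hz) hb0 m
  rw [show b / z / b = z⁻¹ by field_simp] at t
  have d1 : ∀ u, u ≠ 0 → q / (b / (a * u)) = a * q * u * b⁻¹ := fun u hu => by field_simp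
  have d2 : q / (b / z * q ^ (-m)) = z * b⁻¹ * q ^ (1 + m) := by
    rw [zpow_add₀ hq0, zpow_neg, zpow_one]
    field_simp
  have d3 : q / (b * q ^ m) = b⁻¹ * q ^ (1 - m) := by
    rw [zpow_sub₀ hq0, zpow_one]
    field_simp
  rw [← t]
  simp only [theta, d1 u₁ h₁, d1 u₂ h₂, d1 u₃ h₃, d2, d3]
  simp only [theta] at h
  rw [pairs4]
  simp only [ker]
  linear_combination qInf q (a * q * u₁ * b⁻¹) * qInf q (a * q * u₂ * b⁻¹) *
    qInf q (a * q * u₃ * b⁻¹) * (qInf q (b⁻¹ * q ^ (1 - m)) * qInf q (z * b⁻¹ * q ^ (1 + m))) * h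

/-- The factor combining the theta functions in the closed form of `comb51`. -/
theorem theta_combination (hq0 : q ≠ 0) (hq : ‖q‖ < 1) {a z b u₁ u₂ u₃ : ℂ}
    (ha : a ≠ 0) (hz : z ≠ 0) (h₁ : u₁ ≠ 0) (h₂ : u₂ ≠ 0) (h₃ : u₃ ≠ 0)
    (hbu : b = a * z * q * (u₁ * u₂ * u₃)) :
    theta q (z * u₁) * theta q (z * u₂) * theta q (z * u₃) * theta q (b / a) -
      z ^ 2 * (theta q u₁ * theta q u₂ * theta q u₃) * theta q (b * z / a) =
    theta q z * (z ^ 2 * (u₁ * u₂ * u₃)) *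
      (theta q (b / (a * u₁)) * theta q (b / (a * u₂)) * theta q (b / (a * u₃))) := by
  have t := theta_addition hq0 hq hz h₁ h₂ h₃
  have hU : u₁ * u₂ * u₃ ≠ 0 := by positivity
  have e1 : b / a = z * (u₁ * u₂ * u₃) * q := by
    rw [hbu]
    field_simp
  have e2 : b * z / a = z ^ 2 * (u₁ * u₂ * u₃) * q := by
    rw [hbu]
    field_simp
  have e3 : b / (a * u₁) = z * (u₂ * u₃) * q := by
    rw [hbu]
    field_simp
  have e4 : b / (a * u₂) = z * (u₁ * u₃) * q := by
    rw [hbu]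
    field_simp
  have e5 : b / (a * u₃) = z * (u₁ * u₂) * q := by
    rw [hbu]
    field_simp
  rw [e1, e2, e3, e4, e5, theta_mul_q hq0 hq (by positivity), theta_mul_q hq0 hq (by positivity),
    theta_mul_q hq0 hq (by positivity), theta_mul_q hq0 hq (by positivity),
    theta_mul_q hq0 hq (by positivity)]
  generalize theta q (z * (u₁ * u₂ * u₃)) = A at *
  generalize theta q (z ^ 2 * (u₁ * u₂ * u₃)) = B at *
  generalize theta q (z * (u₁ * u₂)) = T₁ at *
  generalize theta q (z * (u₁ * u₃)) = T₂ at *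
  generalize theta q (z * (u₂ * u₃)) = T₃ at *
  generalize theta q (z * u₁) = V₁ at *
  generalize theta q (z * u₂) = V₂ at *
  generalize theta q (z * u₃) = V₃ at *
  field_simp
  linear_combination -t

/-- The combination of the two sums on the discrete family has a closed form. Up to factors free of
`m`, it is what `head4 q z x y m` needs to become, with the two kernels of `x` and `y`, the `m`-th
term of the ₈ψ₈ of base `z`. -/
theorem comb6_eq (hq0 : q ≠ 0) (hq : ‖q‖ < 1) {a z b c u₁ u₂ u₃ : ℂ}
    (ha : a ≠ 0) (hz : z ≠ 0) (h₁ : u₁ ≠ 0) (h₂ : u₂ ≠ 0) (h₃ : u₃ ≠ 0)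
    (hbu : b = a * z * q * (u₁ * u₂ * u₃))
    (hb : ∀ k : ℤ, b ≠ q ^ k) (hba : ∀ k : ℤ, b / a ≠ q ^ k)
    (hbz : ∀ k : ℤ, b / z ≠ q ^ k) (hbza : ∀ k : ℤ, b * z / a ≠ q ^ k)
    (hbu₁ : theta q (b / (a * u₁)) ≠ 0) (hbu₂ : theta q (b / (a * u₂)) ≠ 0)
    (hbu₃ : theta q (b / (a * u₃)) ≠ 0)
    (hc : c * (theta q (z * u₁) * theta q (z * u₂) * theta q (z * u₃) * theta q (z * b⁻¹)) *
        theta q (z ^ 2 / a) =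
      z ^ 5 * (theta q u₁ * theta q u₂ * theta q u₃ * theta q b⁻¹) * theta q a⁻¹) (m : ℤ) :
    theta q (z * u₁) * theta q (z * u₂) * theta q (z * u₃) * theta q (z * b⁻¹) *
      (sum6 q a u₁ u₂ u₃ b⁻¹ (z / a * q ^ m) (a⁻¹ * q ^ (-m)) -
        c * sum6 q (a / z ^ 2) (z * u₁) (z * u₂) (z * u₃) (z * b⁻¹) (z * (z / a * q ^ m))
          (z * (a⁻¹ * q ^ (-m)))) =
    -(z ^ 2 / (a * q)) * (qInf q q * qInf q (q * z / a) * theta q a * theta q z) *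
      pairs4 q a u₁ u₂ u₃ b⁻¹ * (z ^ m * q ^ (m ^ 2)) *
      (ker q z u₁ m * ker q z u₂ m * ker q z u₃ m * ker q z b⁻¹ m) := by
  have hb0 : b ≠ 0 := by
    rw [hbu]
    positivity
  have e0 : b / z / (a / z ^ 2) = b * z / a := by field_simp
  have t1 := theta_ne_zero hq0 hq hb0 hb
  have t2 := theta_ne_zero hq0 hq (div_ne_zero hb0 ha) hba
  have i1 := theta_inv hq hb0
  have i2 := theta_inv hq (div_ne_zero hb0 hz)
  have i3 := theta_inv hq ha
  have i4 := theta_inv hq (x := a / z ^ 2) (by positivity)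
  have ezb : (b / z)⁻¹ = z * b⁻¹ := by
    rw [inv_div]
    rfl
  rw [ezb] at i2
  rw [inv_div] at i4
  have x1 := theta_mul_theta_zpow hq0 hq (x := a⁻¹) (y := z / a) (by positivity) (by positivity) m
  have x2 := theta_mul_theta_zpow hq0 hq (x := z * a⁻¹) (y := z * (z / a)) (by positivity)
    (by positivity) m
  rw [show a⁻¹ / (z / a) = z⁻¹ by field_simp] at x1
  rw [show z * a⁻¹ / (z * (z / a)) = z⁻¹ by field_simp, show z * (z / a) = z ^ 2 / a by ring] at x2
  have s1 := sum6_eq_sum51 hq0 hq u₁ u₂ u₃ (z / a * q ^ m) (a⁻¹ * q ^ (-m)) ha hb0 hb hba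
  have s2 := sum6_eq_sum51 hq0 hq (a := a / z ^ 2) (b := b / z) (z * u₁) (z * u₂) (z * u₃)
    (z * (z / a * q ^ m)) (z * (a⁻¹ * q ^ (-m))) (by positivity) (by positivity) hbz
    (by rwa [e0])
  rw [ezb, e0] at s2
  -- Passing from `sum6` to `sum51` extracts different theta factors for the two bases; `c'` is `c`
  -- corrected by their ratio.
  set c' := c * (theta q (b / z) * theta q (b * z / a)) / (theta q b * theta q (b / a)) with hc'
  have hcm : c' * (theta q b * theta q (b / a)) = c * (theta q (b / z) * theta q (b * z / a)) :=
    div_mul_cancel₀ _ (mul_ne_zero t1 t2)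
  rw [i1, i2] at hc
  have hc1 : c * (theta q (z * u₁) * theta q (z * u₂) * theta q (z * u₃)) * theta q (b / z) *
      theta q (z ^ 2 / a) = z ^ 4 * (theta q u₁ * theta q u₂ * theta q u₃) * theta q b *
      theta q a⁻¹ := by
    generalize theta q (z * u₁) = V₁ at *
    generalize theta q (z * u₂) = V₂ at *
    generalize theta q (z * u₃) = V₃ at *
    generalize theta q (b / z) = V₄ at *
    generalize theta q (z ^ 2 / a) = V₅ at *
    generalize theta q a⁻¹ = V₆ at *
    field_simp at hc
    linear_combination -hc
  have hc2 : c * (theta q (z * u₁) * theta q (z * u₂) * theta q (z * u₃)) * theta q (b / z) *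
      theta q (a / z ^ 2) = z ^ 2 * (theta q u₁ * theta q u₂ * theta q u₃) * theta q b *
      theta q a := by
    rw [i3, i4] at hc1
    generalize theta q (z * u₁) = V₁ at *
    generalize theta q (z * u₂) = V₂ at *
    generalize theta q (z * u₃) = V₃ at *
    generalize theta q (b / z) = V₄ at *
    generalize theta q (a / z ^ 2) = V₅ at *
    field_simp at hc1
    linear_combination -hc1
  set g := (z⁻¹) ^ m * q ^ (-m ^ 2) with hg
  have hgG : g * (z ^ m * q ^ (m ^ 2)) = 1 := by
    rw [hg, inv_zpow, zpow_neg]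
    have := zpow_ne_zero m hz
    have := zpow_ne_zero (m ^ 2) hq0
    field_simp
  -- By `x1` and `x2` the theta functions containing `q^m` carry the same factor `z^{-m} q^{-m²}` on
  -- both sides of the coefficient condition. It cancels, which is why `c` can be independent of
  -- `m`.
  have K := comb51_mul_pairs4 hq0 hq (c := c') ha hz h₁ h₂ h₃ hbu m hb hba hbz hbza (by
    rw [← mul_assoc z, show z * (z / a) = z ^ 2 / a by ring, ← mul_assoc z]
    refine mul_right_cancel₀ t1 ?_
    rw [← div_eq_mul_inv z] at x2 ⊢
    linear_combination (theta q (z * u₁) * theta q (z * u₂) * theta q (z * u₃)) *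
      (theta q (z ^ 2 / a * q ^ m) * theta q (z / a * q ^ (-m))) * hcm +
      c * (theta q (z * u₁) * theta q (z * u₂) * theta q (z * u₃)) *
        (theta q (b / z) * theta q (b * z / a)) * x2 +
      g * theta q (z / a) * theta q (b * z / a) * hc1 -
      z ^ 4 * (theta q u₁ * theta q u₂ * theta q u₃) * theta q (b * z / a) * theta q b * x1)
  have tc := theta_combination hq0 hq ha hz h₁ h₂ h₃ hbu
  have hL : sum6 q a u₁ u₂ u₃ b⁻¹ (z / a * q ^ m) (a⁻¹ * q ^ (-m)) -
        c * sum6 q (a / z ^ 2) (z * u₁) (z * u₂) (z * u₃) (z * b⁻¹) (z * (z / a * q ^ m))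
          (z * (a⁻¹ * q ^ (-m))) = theta q b * theta q (b / a) *
      comb51 q a z b c' u₁ u₂ u₃ (z / a * q ^ m) (a⁻¹ * q ^ (-m)) := by
    rw [s1, s2, comb51]
    linear_combination sum51 q (a / z ^ 2) (b / z) (z * u₁) (z * u₂) (z * u₃)
      (z * (z / a * q ^ m)) (z * (a⁻¹ * q ^ (-m))) * hcm
  rw [hL, i2]
  rw [← hg] at K
  clear hL s1 s2 x1 x2 i1 i2 i3 i4 hc hc1
  clear_value c' g
  generalize comb51 q a z b c' u₁ u₂ u₃ (z / a * q ^ m) (a⁻¹ * q ^ (-m)) = X at *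
  generalize ker q z u₁ m * ker q z u₂ m * ker q z u₃ m * ker q z b⁻¹ m = k at *
  generalize pairs4 q a u₁ u₂ u₃ b⁻¹ = P at *
  generalize qInf q q * qInf q (q * z / a) = R at *
  have hΘ : theta q (b / (a * u₁)) * theta q (b / (a * u₂)) * theta q (b / (a * u₃)) ≠ 0 :=
    mul_ne_zero (mul_ne_zero hbu₁ hbu₂) hbu₃
  generalize theta q (b / (a * u₁)) * theta q (b / (a * u₂)) * theta q (b / (a * u₃)) = Θ at *
  generalize z ^ m * q ^ (m ^ 2) = G at *
  generalize theta q (z * u₁) * theta q (z * u₂) * theta q (z * u₃) = V at *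
  generalize theta q u₁ * theta q u₂ * theta q u₃ = V' at *
  generalize theta q (a / z ^ 2) = x₁ at *
  generalize theta q a = x₂ at *
  generalize theta q z = x₃ at *
  generalize theta q (b * z / a) = x₄ at *
  generalize theta q (b / a) = x₅ at *
  generalize theta q (b / z) = x₆ at *
  generalize theta q b = x₇ at *
  -- Multiplied by theta factors, `θ(a) - c' θ(a/z²)` becomes the difference factored by
  -- `theta_combination`. The triple product `Θ` then occurs on both sides and cancels.
  have main : x₆ * V * (x₇ * x₅ * X) = G * R * P * k * x₂ * x₃ * (z ^ 2 * (u₁ * u₂ * u₃)) := by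
    refine mul_right_cancel₀ (mul_ne_zero hΘ t1) ?_
    linear_combination G * V * x₅ * x₇ * K - x₆ * V * x₇ * x₅ * X * Θ * x₇ * hgG -
      G * R * P * k * V * x₁ * hcm - G * R * P * k * x₄ * hc2 + G * R * P * k * x₂ * x₇ * tc
  have hbz' : b / z = a * q * (u₁ * u₂ * u₃) := by
    rw [hbu]
    field_simp
  rw [hbz']
  field_simp
  linear_combination -main

/-! ### Averaging an ₈ψ₈ over a ₆ψ₆ -/

/-- The factor of `term6` that involves its first four parameters. -/
def head6 (q a u₁ u₂ u₃ u₄ : ℂ) (n : ℤ) : ℂ :=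
  (1 - a * q ^ (2 * n)) * q ^ (-n) * (a ^ (3 * n) * q ^ (3 * n ^ 2)) *
    (ker q a u₁ n * ker q a u₂ n * ker q a u₃ n * ker q a u₄ n)

/-- The factor of `term4` that involves its first two parameters. -/
def head4 (q a u₁ u₂ : ℂ) (n : ℤ) : ℂ :=
  (1 - a * q ^ (2 * n)) * q ^ (-n) * (a ^ (2 * n) * q ^ (2 * n ^ 2)) * (ker q a u₁ n * ker q a u₂ n)

theorem term6_eq_head6 (q a u₁ u₂ u₃ u₄ u₅ u₆ : ℂ) (n : ℤ) :
    term6 q a u₁ u₂ u₃ u₄ u₅ u₆ n =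
      head6 q a u₁ u₂ u₃ u₄ n * (ker q a u₅ n * ker q a u₆ n) := by
  rw [term6, head6]
  ring

theorem term4_eq_head4 (q a u₁ u₂ u₃ u₄ : ℂ) (n : ℤ) :
    term4 q a u₁ u₂ u₃ u₄ n = head4 q a u₁ u₂ n * (ker q a u₃ n * ker q a u₄ n) := by
  rw [term4, head4]
  ring

theorem exists_norm_head4_le (hq0 : q ≠ 0) (hq : ‖q‖ < 1) {a u₁ u₂ : ℂ} (ha : a ≠ 0)
    (h₁ : u₁ ≠ 0) (h₂ : u₂ ≠ 0) :
    ∃ C, 0 ≤ C ∧ ∀ n : ℤ, ‖head4 q a u₁ u₂ n‖ ≤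
      C * Real.exp ((Real.log ‖u₁‖ + Real.log ‖u₂‖ + Real.log ‖a‖) * |(n : ℝ)| +
        n * Real.log ‖a‖ + n ^ 2 * Real.log ‖q‖) := by
  obtain ⟨C₁, p₁, k₁⟩ := exists_norm_ker_le hq0 hq (Real.log ‖a‖) (Real.log ‖u₁‖)
  obtain ⟨C₂, p₂, k₂⟩ := exists_norm_ker_le hq0 hq (Real.log ‖a‖) (Real.log ‖u₂‖)
  refine ⟨(1 + Real.exp (Real.log ‖a‖)) * (1 * 1) * (C₁ * C₂), by positivity, fun n => ?_⟩
  have b0 := norm_vwp_factor_le hq0 hq (norm_eq_exp_log ha) n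
  have b1 := (norm_zpow_eq_exp (norm_eq_exp_log ha) (2 * n)).le.trans_eq (one_mul _).symm
  have b2 := (norm_zpow_eq_exp (norm_eq_exp_log hq0) (2 * n ^ 2)).le.trans_eq (one_mul _).symm
  rw [head4]
  refine (norm_mul_le_exp (by positivity) (norm_mul_le_exp (by positivity) b0
    (norm_mul_le_exp (by positivity) b1 b2)) (norm_mul_le_exp p₁
    (k₁ a u₁ (norm_eq_exp_log ha) (norm_eq_exp_log h₁).le n)
    (k₂ a u₂ (norm_eq_exp_log ha) (norm_eq_exp_log h₂).le n))).trans_eq ?_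
  congr 2
  push_cast
  ring

theorem abs_sub_add_abs_add (x y : ℝ) : |x - y| + |x + y| = 2 * max |x| |y| := by
  rcases le_total 0 x with hx | hx <;> rcases le_total 0 y with hy | hy <;>
    rcases le_total |x| |y| with h | h <;>
    simp only [abs_of_nonneg, abs_of_nonpos, hx, hy] at h <;>
    simp only [max_def, abs_of_nonneg, abs_of_nonpos, hx, hy] <;>
    rcases abs_cases (x - y) with ⟨h1, h2⟩ | ⟨h1, h2⟩ <;>
    rcases abs_cases (x + y) with ⟨h3, h4⟩ | ⟨h3, h4⟩ <;> rw [h1, h3] <;> split_ifs <;> linarith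

/-- The four infinite products regroup into two kernels with indices `n - m` and `n + m`. Their
growth combines through `|n - m| + |n + m| = 2 max(|n|, |m|)`, and the quadratic parts sum to `n² +
m²`. -/
theorem exists_norm_ker_swap_le (hq0 : q ≠ 0) (hq : ‖q‖ < 1) {z s t : ℂ} (hz : z ≠ 0)
    (hs : s ≠ 0) (ht : t ≠ 0) :
    ∃ C, 0 ≤ C ∧ ∀ n m : ℤ, ‖ker q z (s * q ^ n) m * ker q z (t * q ^ (-n)) m‖ ≤
      C * Real.exp ((Real.log ‖z‖ + Real.log ‖s‖ + Real.log ‖t‖ + Real.log ‖q‖) *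
        max |(n : ℝ)| |(m : ℝ)| - n * Real.log ‖s / t‖ - m * Real.log ‖z‖ -
        (n ^ 2 + m ^ 2) * Real.log ‖q‖) := by
  obtain ⟨C₁, p₁, k₁⟩ := exists_norm_ker_le hq0 hq (Real.log ‖s / (z * t)‖) (Real.log ‖z * t‖)
  obtain ⟨C₂, p₂, k₂⟩ := exists_norm_ker_le hq0 hq (Real.log ‖z * s / t‖) (Real.log ‖t‖)
  refine ⟨C₁ * C₂, by positivity, fun n m => ?_⟩
  have hzt : z * t ≠ 0 := mul_ne_zero hz ht
  have hzst : z * s / t ≠ 0 := div_ne_zero (mul_ne_zero hz hs) ht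
  have hszt : s / (z * t) ≠ 0 := div_ne_zero hs hzt
  have hn : q ^ n ≠ 0 := zpow_ne_zero _ hq0
  have hm : q ^ m ≠ 0 := zpow_ne_zero _ hq0
  have e : ker q z (s * q ^ n) m * ker q z (t * q ^ (-n)) m =
      ker q (s / (z * t)) (z * t) (n - m) * ker q (z * s / t) t (n + m) := by
    have e1 : s * q ^ n * q ^ (1 - m) = s / (z * t) * (z * t) * q ^ (1 + (n - m)) := by
      rw [div_mul_cancel₀ _ hzt, mul_assoc, ← zpow_add₀ hq0]
      ring_nf
    have e2 : z * (s * q ^ n) * q ^ (1 + m) = z * s / t * t * q ^ (1 + (n + m)) := by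
      rw [div_mul_cancel₀ _ ht, ← mul_assoc, mul_assoc _ (q ^ n), ← zpow_add₀ hq0]
      ring_nf
    have e3 : t * q ^ (-n) * q ^ (1 - m) = t * q ^ (1 - (n + m)) := by
      rw [mul_assoc, ← zpow_add₀ hq0]
      ring_nf
    have e4 : z * (t * q ^ (-n)) * q ^ (1 + m) = z * t * q ^ (1 - (n - m)) := by
      rw [← mul_assoc, mul_assoc _ (q ^ (-n)), ← zpow_add₀ hq0]
      ring_nf
    rw [ker, ker, ker, ker, e1, e2, e3, e4]
    ring
  rw [e]
  refine (norm_mul_le_exp p₁ (k₁ _ _ (norm_eq_exp_log hszt) (norm_eq_exp_log hzt).le (n - m))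
    (k₂ _ _ (norm_eq_exp_log hzst) (norm_eq_exp_log ht).le (n + m))).trans_eq ?_
  have nz := norm_ne_zero_iff.2 hz
  have ns := norm_ne_zero_iff.2 hs
  have nt := norm_ne_zero_iff.2 ht
  simp only [norm_mul, norm_div]
  rw [Real.log_div ns (by positivity), Real.log_mul nz nt, Real.log_div (by positivity) nt,
    Real.log_mul nz ns, Real.log_div ns nt]
  congr 2
  have h := abs_sub_add_abs_add n m
  push_cast
  linear_combination (Real.log ‖z‖ + Real.log ‖s‖ + Real.log ‖t‖ + Real.log ‖q‖) / 2 * h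

/-- After cancellation of the Gaussians the exponent is `e₁|n| + e₂|m| + e₃ max(|n|, |m|)`, which is
linear between the rays `m = 0`, `n = 0` and `|n| = |m|`. The three hypotheses say exactly that it
is negative on these rays. -/
theorem summable_double (hq0 : q ≠ 0) (hq : ‖q‖ < 1) {z s t x y u₁ u₂ u₃ u₄ : ℂ} (hz : z ≠ 0)
    (hs : s ≠ 0) (ht : t ≠ 0) (hx : x ≠ 0) (hy : y ≠ 0)
    (h₁ : u₁ ≠ 0) (h₂ : u₂ ≠ 0) (h₃ : u₃ ≠ 0) (h₄ : u₄ ≠ 0)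
    (c₁ : ‖(s / t) ^ 2 * q ^ 2 * z * (s * t) * (u₁ * u₂ * u₃ * u₄)‖ < 1)
    (c₂ : ‖z ^ 2 * q * (x * y * s * t)‖ < 1)
    (c₃ : ‖(s / t) ^ 2 * q ^ 2 * z ^ 2 * (s * t) * (u₁ * u₂ * u₃ * u₄) * (x * y)‖ < 1) :
    Summable fun p : ℤ × ℤ => head6 q (s / t) u₁ u₂ u₃ u₄ p.1 *
      term4 q z x y (s * q ^ p.1) (t * q ^ (-p.1)) p.2 := by
  have hA : s / t ≠ 0 := div_ne_zero hs ht
  obtain ⟨C₁, p₁, k₁⟩ := exists_norm_ker_mul4_le hq0 hq (Real.log ‖s / t‖) (Real.log ‖u₁‖)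
    (Real.log ‖u₂‖) (Real.log ‖u₃‖) (Real.log ‖u₄‖)
  obtain ⟨C₂, p₂, k₂⟩ := exists_norm_head4_le hq0 hq hz hx hy
  obtain ⟨C₃, p₃, k₃⟩ := exists_norm_ker_swap_le hq0 hq hz hs ht
  have k₁ := k₁ (s / t) u₁ u₂ u₃ u₄ (norm_eq_exp_log hA) (norm_eq_exp_log h₁).le
    (norm_eq_exp_log h₂).le (norm_eq_exp_log h₃).le (norm_eq_exp_log h₄).le
  have l₁ := Real.log_neg (norm_pos_iff.2 (by positivity)) c₁
  have l₂ := Real.log_neg (norm_pos_iff.2 (by positivity)) c₂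
  have l₃ := Real.log_neg (norm_pos_iff.2 (by positivity)) c₃
  have := norm_ne_zero_iff.2 hq0
  have := norm_ne_zero_iff.2 hz
  have := norm_ne_zero_iff.2 hs
  have := norm_ne_zero_iff.2 ht
  have := norm_ne_zero_iff.2 hx
  have := norm_ne_zero_iff.2 hy
  have := norm_ne_zero_iff.2 h₁
  have := norm_ne_zero_iff.2 h₂
  have := norm_ne_zero_iff.2 h₃
  have := norm_ne_zero_iff.2 h₄
  have := norm_ne_zero_iff.2 hA
  simp only [norm_mul, norm_pow] at l₁ l₂ l₃
  have mul_log : ∀ {r w : ℝ}, r ≠ 0 → w ≠ 0 → Real.log (r * w) = Real.log r + Real.log w :=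
    fun h h' => Real.log_mul h h'
  rw [mul_log (by positivity) (by positivity), mul_log (by positivity) (by positivity),
    mul_log (by positivity) (by positivity), mul_log (by positivity) (by positivity),
    mul_log (by positivity) (by positivity), mul_log (by positivity) (by positivity),
    mul_log (by positivity) (by positivity), mul_log (by positivity) (by positivity),
    Real.log_pow, Real.log_pow] at l₁
  rw [mul_log (by positivity) (by positivity), mul_log (by positivity) (by positivity),
    mul_log (by positivity) (by positivity), mul_log (by positivity) (by positivity),
    mul_log (by positivity) (by positivity), Real.log_pow] at l₂
  rw [mul_log (by positivity) (by positivity), mul_log (by positivity) (by positivity),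
    mul_log (by positivity) (by positivity), mul_log (by positivity) (by positivity),
    mul_log (by positivity) (by positivity), mul_log (by positivity) (by positivity),
    mul_log (by positivity) (by positivity), mul_log (by positivity) (by positivity),
    mul_log (by positivity) (by positivity), mul_log (by positivity) (by positivity),
    Real.log_pow, Real.log_pow, Real.log_pow] at l₃
  push_cast at l₁ l₂ l₃
  set e₁ := Real.log ‖u₁‖ + Real.log ‖u₂‖ + Real.log ‖u₃‖ + Real.log ‖u₄‖ +
    2 * Real.log ‖s / t‖ + Real.log ‖q‖ with he₁
  set e₂ := Real.log ‖x‖ + Real.log ‖y‖ + Real.log ‖z‖ with he₂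
  set e₃ := Real.log ‖z‖ + Real.log ‖s‖ + Real.log ‖t‖ + Real.log ‖q‖ with he₃
  obtain ⟨δ, hδ, d₁, d₂, d₃⟩ : ∃ δ < 0, e₁ + e₃ ≤ 2 * δ ∧ e₂ + e₃ ≤ 2 * δ ∧
      e₁ + e₂ + e₃ ≤ 2 * δ := by
    refine ⟨max (max (e₁ + e₃) (e₂ + e₃)) (e₁ + e₂ + e₃) / 2, ?_, ?_, ?_, ?_⟩
    · have : max (max (e₁ + e₃) (e₂ + e₃)) (e₁ + e₂ + e₃) < 0 :=
        max_lt (max_lt (by linarith) (by linarith)) (by linarith)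
      linarith
    · have := (le_max_left (e₁ + e₃) (e₂ + e₃)).trans (le_max_left _ (e₁ + e₂ + e₃))
      linarith
    · have := (le_max_right (e₁ + e₃) (e₂ + e₃)).trans (le_max_left _ (e₁ + e₂ + e₃))
      linarith
    · have := le_max_right (max (e₁ + e₃) (e₂ + e₃)) (e₁ + e₂ + e₃)
      linarith
  have hsum := (summable_exp_neg_abs hδ).mul_of_nonneg (summable_exp_neg_abs hδ)
    (fun _ => (Real.exp_pos _).le) (fun _ => (Real.exp_pos _).le)
  refine Summable.of_norm_bounded (hsum.mul_left (C₁ * (C₂ * C₃))) fun ⟨n, m⟩ => ?_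
  rw [term4_eq_head4]
  refine (norm_mul_le_exp p₁ (k₁ n) (norm_mul_le_exp p₂ (k₂ m) (k₃ n m))).trans ?_
  rw [← Real.exp_add]
  refine mul_le_mul_of_nonneg_left (Real.exp_le_exp.2 ?_) (by positivity)
  have hN := abs_nonneg (n : ℝ)
  have hM := abs_nonneg (m : ℝ)
  have : e₁ * |(n : ℝ)| + e₂ * |(m : ℝ)| + e₃ * max |(n : ℝ)| |(m : ℝ)| ≤
      δ * |(n : ℝ)| + δ * |(m : ℝ)| := by
    rcases le_total |(n : ℝ)| |(m : ℝ)| with h | h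
    · rw [max_eq_right h]
      nlinarith
    · rw [max_eq_left h]
      nlinarith
  dsimp only
  linarith

/-- This duality exchanges index and parameter shift: the same four infinite products are read as
kernels in `m` of base `z` or as kernels in `n` of base `s/t`. -/
theorem ker_mul_ker_swap (hq0 : q ≠ 0) {z s t : ℂ} (ht : t ≠ 0) (n m : ℤ) :
    ker q z (s * q ^ n) m * ker q z (t * q ^ (-n)) m =
      ker q (s / t) (z * t * q ^ m) n * ker q (s / t) (t * q ^ (-m)) n := by
  have e1 : s * q ^ n * q ^ (1 - m) = s / t * (t * q ^ (-m)) * q ^ (1 + n) := by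
    rw [← mul_assoc, div_mul_cancel₀ _ ht, mul_assoc, mul_assoc, ← zpow_add₀ hq0, ← zpow_add₀ hq0]
    ring_nf
  have e2 : z * (s * q ^ n) * q ^ (1 + m) = s / t * (z * t * q ^ m) * q ^ (1 + n) := by
    rw [show s / t * (z * t * q ^ m) = s / t * t * z * q ^ m by ring, div_mul_cancel₀ _ ht,
      ← mul_assoc, mul_assoc _ (q ^ n), mul_assoc _ (q ^ m), ← zpow_add₀ hq0, ← zpow_add₀ hq0]
    ring_nf
  have e3 : t * q ^ (-n) * q ^ (1 - m) = t * q ^ (-m) * q ^ (1 - n) := by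
    rw [mul_assoc, mul_assoc, ← zpow_add₀ hq0, ← zpow_add₀ hq0]
    ring_nf
  have e4 : z * (t * q ^ (-n)) * q ^ (1 + m) = z * t * q ^ m * q ^ (1 - n) := by
    rw [← mul_assoc, mul_assoc _ (q ^ (-n)), mul_assoc _ (q ^ m), ← zpow_add₀ hq0, ← zpow_add₀ hq0]
    ring_nf
  rw [ker, ker, ker, ker, e1, e2, e3, e4]
  ring

/-- Duality turns the double sum into one whose inner sum over `m` is a ₆ψ₆ with parameters `x, y, s
qⁿ, t q⁻ⁿ`. Of its six pair products, the four mixed ones form the kernels of `zxt` and `zyt`, and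
the other two do not depend on `n`. -/
theorem sum6_average (hq0 : q ≠ 0) (hq : ‖q‖ < 1) {z s t x y u₁ u₂ u₃ u₄ : ℂ} (hz : z ≠ 0)
    (hs : s ≠ 0) (ht : t ≠ 0) (hx : x ≠ 0) (hy : y ≠ 0)
    (h₁ : u₁ ≠ 0) (h₂ : u₂ ≠ 0) (h₃ : u₃ ≠ 0) (h₄ : u₄ ≠ 0)
    (c₁ : ‖(s / t) ^ 2 * q ^ 2 * z * (s * t) * (u₁ * u₂ * u₃ * u₄)‖ < 1)
    (c₂ : ‖z ^ 2 * q * (x * y * s * t)‖ < 1)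
    (c₃ : ‖(s / t) ^ 2 * q ^ 2 * z ^ 2 * (s * t) * (u₁ * u₂ * u₃ * u₄) * (x * y)‖ < 1) :
    (Summable fun m : ℤ => head4 q z x y m *
      sum6 q (s / t) u₁ u₂ u₃ u₄ (z * t * q ^ m) (t * q ^ (-m))) ∧
    qInf q (z ^ 2 * q * (x * y * s * t)) * ∑' m : ℤ, head4 q z x y m *
      sum6 q (s / t) u₁ u₂ u₃ u₄ (z * t * q ^ m) (t * q ^ (-m)) =
    qInf q q * theta q z * (qInf q (z * q * x * y) * qInf q (z * q * s * t)) *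
      sum6 q (s / t) u₁ u₂ u₃ u₄ (z * x * t) (z * y * t) := by
  have hsum := summable_double hq0 hq hz hs ht hx hy h₁ h₂ h₃ h₄ c₁ c₂ c₃
  have inner : ∀ m : ℤ, head4 q z x y m *
      sum6 q (s / t) u₁ u₂ u₃ u₄ (z * t * q ^ m) (t * q ^ (-m)) =
      ∑' n : ℤ, head6 q (s / t) u₁ u₂ u₃ u₄ n * term4 q z x y (s * q ^ n) (t * q ^ (-n)) m := by
    intro m
    rw [sum6, ← tsum_mul_left]
    refine tsum_congr fun n => ?_
    rw [term6_eq_head6, term4_eq_head4, ker_mul_ker_swap (z := z) (s := s) hq0 ht]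
    ring
  have hswap : Summable fun p : ℤ × ℤ => head6 q (s / t) u₁ u₂ u₃ u₄ p.2 *
      term4 q z x y (s * q ^ p.2) (t * q ^ (-p.2)) p.1 :=
    (Equiv.prodComm ℤ ℤ).summable_iff.2 hsum
  refine ⟨?_, ?_⟩
  · simp only [inner]
    exact hswap.prod
  · simp only [inner]
    rw [Summable.tsum_comm (f := fun n m => head6 q (s / t) u₁ u₂ u₃ u₄ n *
      term4 q z x y (s * q ^ n) (t * q ^ (-n)) m) hsum, sum6, ← tsum_mul_left, ← tsum_mul_left]
    refine tsum_congr fun n => ?_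
    have hn : q ^ n ≠ 0 := zpow_ne_zero _ hq0
    have en : z ^ 2 * q * (x * y * (s * q ^ n) * (t * q ^ (-n))) =
        z ^ 2 * q * (x * y * s * t) := by
      rw [zpow_neg]
      field_simp
    have h := sum4_eq hq0 hq hz (u₁ := x) (u₂ := y) (u₃ := s * q ^ n) (u₄ := t * q ^ (-n))
      (by rwa [en])
    have f1 : ∀ x, z * q * x * (s * q ^ n) = s / t * (z * x * t) * q ^ (1 + n) := fun x => by
      rw [zpow_add₀ hq0, zpow_one]
      field_simp
    have f2 : ∀ x, z * q * x * (t * q ^ (-n)) = z * x * t * q ^ (1 - n) := fun x => by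
      rw [zpow_sub₀ hq0, zpow_one, zpow_neg]
      field_simp
    have f3 : z * q * (s * q ^ n) * (t * q ^ (-n)) = z * q * s * t := by
      rw [zpow_neg]
      field_simp
    rw [en, f3, f1, f1, f2, f2] at h
    rw [tsum_mul_left, ← sum4, term6_eq_head6, ker, ker]
    linear_combination head6 q (s / t) u₁ u₂ u₃ u₄ n * h

/-! ### The three-term relation and removal of genericity -/

/-- The three-term relation in normalised form, for parameters in general position. -/
theorem sum6_three_term_of_generic (hq0 : q ≠ 0) (hq : ‖q‖ < 1) {a z b c u₁ u₂ u₃ u v : ℂ}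
    (ha : a ≠ 0) (hz : z ≠ 0) (h₁ : u₁ ≠ 0) (h₂ : u₂ ≠ 0) (h₃ : u₃ ≠ 0) (hu : u ≠ 0) (hv : v ≠ 0)
    (hbu : b = a * z * q * (u₁ * u₂ * u₃))
    (hb : ∀ k : ℤ, b ≠ q ^ k) (hba : ∀ k : ℤ, b / a ≠ q ^ k)
    (hbz : ∀ k : ℤ, b / z ≠ q ^ k) (hbza : ∀ k : ℤ, b * z / a ≠ q ^ k)
    (hbu₁ : theta q (b / (a * u₁)) ≠ 0) (hbu₂ : theta q (b / (a * u₂)) ≠ 0)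
    (hbu₃ : theta q (b / (a * u₃)) ≠ 0) (hz' : theta q z ≠ 0) (hza : qInf q (q * z / a) ≠ 0)
    (hc : c * (theta q (z * u₁) * theta q (z * u₂) * theta q (z * u₃) * theta q (z * b⁻¹)) *
        theta q (z ^ 2 / a) =
      z ^ 5 * (theta q u₁ * theta q u₂ * theta q u₃ * theta q b⁻¹) * theta q a⁻¹)
    (c₁ : ‖a * q * (u * v)‖ < 1) (c₂ : ‖a ^ 2 * q * (u * v) / z‖ < 1) :
    theta q (z * u₁) * theta q (z * u₂) * theta q (z * u₃) * theta q (z * b⁻¹) *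
      qInf q (a ^ 2 * q * (u * v) / z) *
      (sum6 q a u₁ u₂ u₃ b⁻¹ u v -
        c * sum6 q (a / z ^ 2) (z * u₁) (z * u₂) (z * u₃) (z * b⁻¹) (z * u) (z * v)) =
    -(z ^ 2 / (a * q)) * theta q a * pairs4 q a u₁ u₂ u₃ b⁻¹ * qInf q (a * q * (u * v)) *
      sum6 q z u₁ u₂ u₃ b⁻¹ (u * a / z) (v * a / z) := by
  have hb0 : b ≠ 0 := by
    rw [hbu]
    positivity
  have hqq : qInf q q ≠ 0 := qInf_ne_zero_of_norm_lt hq hq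
  have i0 : b⁻¹ ≠ 0 := inv_ne_zero hb0
  -- The values of `s`, `t` give the bases `s/t = a` here and `s/t = a/z²` below, and `z x t`, `z y
  -- t` become `u`, `v` and `zu`, `zv`. The three convergence conditions reduce to `‖q‖ < 1`, `c₁`
  -- and `c₂`.
  obtain ⟨sA, hA⟩ := sum6_average hq0 hq (z := z) (s := 1) (t := a⁻¹) (x := u * a / z)
    (y := v * a / z) (u₁ := u₁) (u₂ := u₂) (u₃ := u₃) (u₄ := b⁻¹) hz one_ne_zero
    (inv_ne_zero ha) (by positivity) (by positivity) h₁ h₂ h₃ i0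
    (by convert hq using 2; rw [hbu]; field_simp) (by convert c₁ using 2; field_simp)
    (by convert c₂ using 2; rw [hbu]; field_simp)
  obtain ⟨sB, hB⟩ := sum6_average hq0 hq (z := z) (s := z⁻¹) (t := z * a⁻¹) (x := u * a / z)
    (y := v * a / z) (u₁ := z * u₁) (u₂ := z * u₂) (u₃ := z * u₃) (u₄ := z * b⁻¹) hz
    (inv_ne_zero hz) (by positivity) (by positivity) (by positivity) (by positivity)
    (by positivity) (by positivity) (by positivity)
    (by convert hq using 2; rw [hbu]; field_simp) (by convert c₁ using 2; field_simp)
    (by convert c₂ using 2; rw [hbu]; field_simp)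
  have n1 : z ^ 2 * q * (u * a / z * (v * a / z) * 1 * a⁻¹) = a * q * (u * v) := by field_simp
  have n2 : z * q * (u * a / z) * (v * a / z) = a ^ 2 * q * (u * v) / z := by field_simp
  have n3 : z * q * 1 * a⁻¹ = q * z / a := by ring
  have n4 : ∀ u, z * (u * a / z) * a⁻¹ = u := fun u => by field_simp
  have n5 : z ^ 2 * q * (u * a / z * (v * a / z) * z⁻¹ * (z * a⁻¹)) = a * q * (u * v) := by
    field_simp
  have n6 : z * q * z⁻¹ * (z * a⁻¹) = q * z / a := by field_simp
  have n7 : ∀ u, z * (u * a / z) * (z * a⁻¹) = z * u := fun u => by field_simp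
  have n8 : z⁻¹ / (z * a⁻¹) = a / z ^ 2 := by field_simp
  have n9 : (1 : ℂ) / a⁻¹ = a := by simp
  have n10 : ∀ m : ℤ, z * (z * a⁻¹) * q ^ m = z * (z / a * q ^ m) := fun m => by ring
  have n11 : ∀ m : ℤ, z * a⁻¹ * q ^ (-m) = z * (a⁻¹ * q ^ (-m)) := fun m => by ring
  have n12 : ∀ m : ℤ, z * a⁻¹ * q ^ m = z / a * q ^ m := fun m => by ring
  rw [n9] at hA sA
  simp only [n1, n2, n3, n4, n12] at hA sA
  rw [n8] at hB sB
  simp only [n5, n2, n6, n7, n10, n11] at hB sB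
  have hm := comb6_eq hq0 hq ha hz h₁ h₂ h₃ hbu hb hba hbz hbza hbu₁ hbu₂ hbu₃ hc
  have hS : theta q (z * u₁) * theta q (z * u₂) * theta q (z * u₃) * theta q (z * b⁻¹) *
      (∑' m : ℤ, head4 q z (u * a / z) (v * a / z) m *
        sum6 q a u₁ u₂ u₃ b⁻¹ (z / a * q ^ m) (a⁻¹ * q ^ (-m)) -
      c * ∑' m : ℤ, head4 q z (u * a / z) (v * a / z) m *
        sum6 q (a / z ^ 2) (z * u₁) (z * u₂) (z * u₃) (z * b⁻¹) (z * (z / a * q ^ m))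
          (z * (a⁻¹ * q ^ (-m)))) =
      -(z ^ 2 / (a * q)) * (qInf q q * qInf q (q * z / a) * theta q a * theta q z) *
        pairs4 q a u₁ u₂ u₃ b⁻¹ * sum6 q z u₁ u₂ u₃ b⁻¹ (u * a / z) (v * a / z) := by
    rw [← tsum_mul_left, ← sA.tsum_sub (sB.mul_left c), ← tsum_mul_left, sum6, ← tsum_mul_left]
    refine tsum_congr fun m => ?_
    have e3 : z ^ (3 * m) * q ^ (3 * m ^ 2) = z ^ (2 * m) * q ^ (2 * m ^ 2) *
        (z ^ m * q ^ (m ^ 2)) := by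
      rw [show 3 * m = 2 * m + m by ring, show 3 * m ^ 2 = 2 * m ^ 2 + m ^ 2 by ring,
        zpow_add₀ hz, zpow_add₀ hq0]
      ring
    rw [term6, e3]
    have := hm m
    rw [head4]
    linear_combination ((1 - z * q ^ (2 * m)) * q ^ (-m) * (z ^ (2 * m) * q ^ (2 * m ^ 2)) *
      (ker q z (u * a / z) m * ker q z (v * a / z) m)) * this
  refine mul_left_cancel₀ (mul_ne_zero (mul_ne_zero hqq hz') hza) ?_
  linear_combination -(theta q (z * u₁) * theta q (z * u₂) * theta q (z * u₃) *
    theta q (z * b⁻¹)) * hA + c * (theta q (z * u₁) * theta q (z * u₂) * theta q (z * u₃) *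
    theta q (z * b⁻¹)) * hB + qInf q (a * q * (u * v)) * hS

theorem tendsto_sum6 (hq0 : q ≠ 0) (hq : ‖q‖ < 1) {X : Type*} {l : Filter X}
    [l.IsCountablyGenerated] {A U₁ U₂ U₃ U₄ U₅ U₆ : X → ℂ} {a u₁ u₂ u₃ u₄ u₅ u₆ : ℂ} (ha : a ≠ 0)
    (h₁ : u₁ ≠ 0) (h₂ : u₂ ≠ 0) (h₃ : u₃ ≠ 0) (h₄ : u₄ ≠ 0) (h₅ : u₅ ≠ 0) (h₆ : u₆ ≠ 0)
    (h : ‖a ^ 3 * q ^ 2 * (u₁ * u₂ * u₃ * u₄ * u₅ * u₆)‖ < 1)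
    (lA : Tendsto A l (𝓝 a)) (l₁ : Tendsto U₁ l (𝓝 u₁)) (l₂ : Tendsto U₂ l (𝓝 u₂))
    (l₃ : Tendsto U₃ l (𝓝 u₃)) (l₄ : Tendsto U₄ l (𝓝 u₄)) (l₅ : Tendsto U₅ l (𝓝 u₅))
    (l₆ : Tendsto U₆ l (𝓝 u₆)) (nA : ∀ x, ‖A x‖ = ‖a‖) (n₁ : ∀ x, ‖U₁ x‖ = ‖u₁‖)
    (n₂ : ∀ x, ‖U₂ x‖ = ‖u₂‖) (n₃ : ∀ x, ‖U₃ x‖ = ‖u₃‖) (n₄ : ∀ x, ‖U₄ x‖ = ‖u₄‖)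
    (n₅ : ∀ x, ‖U₅ x‖ = ‖u₅‖) (n₆ : ∀ x, ‖U₆ x‖ = ‖u₆‖) :
    Tendsto (fun x => sum6 q (A x) (U₁ x) (U₂ x) (U₃ x) (U₄ x) (U₅ x) (U₆ x)) l
      (𝓝 (sum6 q a u₁ u₂ u₃ u₄ u₅ u₆)) := by
  obtain ⟨C, -, hC⟩ := exists_norm_term6_le hq0 hq (Real.log ‖a‖) (Real.log ‖u₁‖)
    (Real.log ‖u₂‖) (Real.log ‖u₃‖) (Real.log ‖u₄‖) (Real.log ‖u₅‖) (Real.log ‖u₆‖)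
  rw [log_norm_term6_ratio hq0 ha h₁ h₂ h₃ h₄ h₅ h₆] at hC
  refine tendsto_tsum_of_dominated_convergence ((summable_exp_neg_abs (Real.log_neg
    (norm_pos_iff.2 (by positivity)) h)).mul_left C) (fun n => ?_)
    (Eventually.of_forall fun x => hC _ _ _ _ _ _ _
      ((nA x).trans (norm_eq_exp_log ha)) ((n₁ x).trans (norm_eq_exp_log h₁)).le
      ((n₂ x).trans (norm_eq_exp_log h₂)).le ((n₃ x).trans (norm_eq_exp_log h₃)).le
      ((n₄ x).trans (norm_eq_exp_log h₄)).le ((n₅ x).trans (norm_eq_exp_log h₅)).le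
      ((n₆ x).trans (norm_eq_exp_log h₆)).le)
  refine Tendsto.mul (Tendsto.mul ?_ ?_) ?_
  · exact (tendsto_const_nhds.sub (lA.mul_const _)).mul_const _
  · exact (lA.zpow₀ _ (Or.inl ha)).mul_const _
  · exact ((((tendsto_ker hq lA l₁ n).mul (tendsto_ker hq lA l₂ n)).mul
      (tendsto_ker hq lA l₃ n)).mul (tendsto_ker hq lA l₄ n)).mul
      ((tendsto_ker hq lA l₅ n).mul (tendsto_ker hq lA l₆ n))

/-- The circle through `x` contains at most one power of `q`. The path moves along that circle with
nonzero speed at `t = 0`, so it avoids this point for small `t ≠ 0`. -/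
theorem eventually_mul_exp_ne_zpow (hq0 : q ≠ 0) (hq : ‖q‖ < 1) {x : ℂ} (hx : x ≠ 0) {j : ℕ}
    (hj : j ≠ 0) :
    ∀ᶠ t : ℝ in 𝓝[≠] 0, ∀ k : ℤ, x * Complex.exp (t * Complex.I) ^ j ≠ q ^ k := by
  have hn : ∀ t : ℝ, ‖x * Complex.exp (t * Complex.I) ^ j‖ = ‖x‖ := fun t => by
    rw [norm_mul, norm_pow, Complex.norm_exp_ofReal_mul_I, one_pow, mul_one]
  by_cases h : ∃ k : ℤ, ‖x‖ = ‖q‖ ^ k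
  · obtain ⟨k₀, hk₀⟩ := h
    have hd : HasDerivAt (fun t : ℝ => Complex.exp (t * Complex.I) ^ j) (j * Complex.I) 0 := by
      have h1 : HasDerivAt (fun t : ℝ => (t : ℂ) * Complex.I) Complex.I 0 := by
        simpa using (Complex.ofRealCLM.hasDerivAt (x := (0 : ℝ))).mul_const Complex.I
      have h2 := h1.cexp.pow j
      simp only [Complex.ofReal_zero, zero_mul, Complex.exp_zero, one_pow, mul_one, one_mul] at h2
      exact h2
    have hev := hd.eventually_ne (c := q ^ k₀ / x)
      (mul_ne_zero (Nat.cast_ne_zero.2 hj) Complex.I_ne_zero)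
    filter_upwards [hev] with t ht k hk
    have h2 := hn t
    rw [hk, norm_zpow, hk₀] at h2
    have h3 := zpow_right_injective₀ (norm_pos_iff.2 hq0) hq.ne h2
    rw [h3] at hk
    exact ht (by rw [← hk, mul_div_cancel_left₀ _ hx])
  · refine Eventually.of_forall fun t k hk => h ⟨k, ?_⟩
    rw [← hn t, hk, norm_zpow]

theorem sum6_three_term_of_theta_ne_zero (hq0 : q ≠ 0) (hq : ‖q‖ < 1)
    {a z b u₁ u₂ u₃ u v : ℂ}
    (ha : a ≠ 0) (hz : z ≠ 0) (h₁ : u₁ ≠ 0) (h₂ : u₂ ≠ 0) (h₃ : u₃ ≠ 0) (hu : u ≠ 0) (hv : v ≠ 0)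
    (hbu : b = a * z * q * (u₁ * u₂ * u₃))
    (hb : ∀ k : ℤ, b ≠ q ^ k) (hba : ∀ k : ℤ, b / a ≠ q ^ k)
    (hbz : ∀ k : ℤ, b / z ≠ q ^ k) (hbza : ∀ k : ℤ, b * z / a ≠ q ^ k)
    (hbu₁ : theta q (b / (a * u₁)) ≠ 0) (hbu₂ : theta q (b / (a * u₂)) ≠ 0)
    (hbu₃ : theta q (b / (a * u₃)) ≠ 0) (hz' : theta q z ≠ 0) (hza : qInf q (q * z / a) ≠ 0)
    (t₁ : theta q (z * u₁) ≠ 0) (t₂ : theta q (z * u₂) ≠ 0) (t₃ : theta q (z * u₃) ≠ 0)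
    (t₄ : theta q (z * b⁻¹) ≠ 0) (t₅ : theta q (z ^ 2 / a) ≠ 0)
    (c₁ : ‖a * q * (u * v)‖ < 1) (c₂ : ‖a ^ 2 * q * (u * v) / z‖ < 1) :
    qInf q (a ^ 2 * q * (u * v) / z) *
      (theta q (z * u₁) * theta q (z * u₂) * theta q (z * u₃) * theta q (z * b⁻¹) *
        theta q (z ^ 2 / a) * sum6 q a u₁ u₂ u₃ b⁻¹ u v -
      z ^ 5 * (theta q u₁ * theta q u₂ * theta q u₃ * theta q b⁻¹) * theta q a⁻¹ *
        sum6 q (a / z ^ 2) (z * u₁) (z * u₂) (z * u₃) (z * b⁻¹) (z * u) (z * v)) =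
    -(z ^ 2 / (a * q)) * theta q a * theta q (z ^ 2 / a) * pairs4 q a u₁ u₂ u₃ b⁻¹ *
      qInf q (a * q * (u * v)) * sum6 q z u₁ u₂ u₃ b⁻¹ (u * a / z) (v * a / z) := by
  have hV : theta q (z * u₁) * theta q (z * u₂) * theta q (z * u₃) * theta q (z * b⁻¹) *
      theta q (z ^ 2 / a) ≠ 0 := by positivity
  have hc := div_mul_cancel₀
    (z ^ 5 * (theta q u₁ * theta q u₂ * theta q u₃ * theta q b⁻¹) * theta q a⁻¹) hV
  rw [← mul_assoc] at hc
  have h := sum6_three_term_of_generic hq0 hq ha hz h₁ h₂ h₃ hu hv hbu hb hba hbz hbza hbu₁ hbu₂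
    hbu₃ hz' hza hc c₁ c₂
  linear_combination theta q (z ^ 2 / a) * h + qInf q (a ^ 2 * q * (u * v) / z) *
    sum6 q (a / z ^ 2) (z * u₁) (z * u₂) (z * u₃) (z * b⁻¹) (z * u) (z * v) * hc

/-- The three-term relation in normalised form. -/
theorem sum6_three_term (hq0 : q ≠ 0) (hq : ‖q‖ < 1) {a z b u₁ u₂ u₃ u v : ℂ}
    (ha : a ≠ 0) (hz : z ≠ 0) (h₁ : u₁ ≠ 0) (h₂ : u₂ ≠ 0) (h₃ : u₃ ≠ 0) (hu : u ≠ 0) (hv : v ≠ 0)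
    (hbu : b = a * z * q * (u₁ * u₂ * u₃)) (hbz : ∀ k : ℤ, b / z ≠ q ^ k)
    (c₁ : ‖a * q * (u * v)‖ < 1) (c₂ : ‖a ^ 2 * q * (u * v) / z‖ < 1) :
    qInf q (a ^ 2 * q * (u * v) / z) *
      (theta q (z * u₁) * theta q (z * u₂) * theta q (z * u₃) * theta q (z * b⁻¹) *
        theta q (z ^ 2 / a) * sum6 q a u₁ u₂ u₃ b⁻¹ u v -
      z ^ 5 * (theta q u₁ * theta q u₂ * theta q u₃ * theta q b⁻¹) * theta q a⁻¹ *
        sum6 q (a / z ^ 2) (z * u₁) (z * u₂) (z * u₃) (z * b⁻¹) (z * u) (z * v)) =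
    -(z ^ 2 / (a * q)) * theta q a * theta q (z ^ 2 / a) * pairs4 q a u₁ u₂ u₃ b⁻¹ *
      qInf q (a * q * (u * v)) * sum6 q z u₁ u₂ u₃ b⁻¹ (u * a / z) (v * a / z) := by
  have hb0 : b ≠ 0 := by
    rw [hbu]
    positivity
  -- Rotating `z` and `b` by the same unit preserves the balancing condition, the quotient `b/z` and
  -- all moduli. The generic relation thus holds for small `t ≠ 0`, and one dominating series
  -- controls each of the three sums as `t → 0`.
  set E : ℝ → ℂ := fun t => Complex.exp (t * Complex.I) with hE
  have nE : ∀ t, ‖E t‖ = 1 := Complex.norm_exp_ofReal_mul_I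
  have E0 : ∀ t, E t ≠ 0 := fun t => Complex.exp_ne_zero _
  have lE : Tendsto E (𝓝[≠] 0) (𝓝 1) := by
    have : Continuous E := by fun_prop
    have h := this.tendsto 0
    simp only [hE, Complex.ofReal_zero, zero_mul, Complex.exp_zero] at h
    exact h.mono_left nhdsWithin_le_nhds
  have ev : ∀ {x : ℂ}, x ≠ 0 → ∀ᶠ t in 𝓝[≠] (0 : ℝ), ∀ k : ℤ, x * E t ≠ q ^ k := fun hx => by
    simpa only [pow_one] using eventually_mul_exp_ne_zpow hq0 hq hx one_ne_zero
  have ev2 : ∀ {x : ℂ}, x ≠ 0 → ∀ᶠ t in 𝓝[≠] (0 : ℝ), ∀ k : ℤ, x * E t ^ 2 ≠ q ^ k := fun hx =>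
    eventually_mul_exp_ne_zpow hq0 hq hx two_ne_zero
  have key : ∀ᶠ t in 𝓝[≠] (0 : ℝ), qInf q (a ^ 2 * q * (u * v) / (z * E t)) *
      (theta q (z * E t * u₁) * theta q (z * E t * u₂) * theta q (z * E t * u₃) *
        theta q (z * b⁻¹) * theta q ((z * E t) ^ 2 / a) *
        sum6 q a u₁ u₂ u₃ (b * E t)⁻¹ u v -
      (z * E t) ^ 5 * (theta q u₁ * theta q u₂ * theta q u₃ * theta q (b * E t)⁻¹) * theta q a⁻¹ *
        sum6 q (a / (z * E t) ^ 2) (z * E t * u₁) (z * E t * u₂) (z * E t * u₃) (z * b⁻¹)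
          (z * E t * u) (z * E t * v)) =
    -((z * E t) ^ 2 / (a * q)) * theta q a * theta q ((z * E t) ^ 2 / a) *
      pairs4 q a u₁ u₂ u₃ (b * E t)⁻¹ *
      qInf q (a * q * (u * v)) *
      sum6 q (z * E t) u₁ u₂ u₃ (b * E t)⁻¹ (u * a / (z * E t)) (v * a / (z * E t)) := by
    filter_upwards [ev hb0, ev (div_ne_zero hb0 ha), ev2 (div_ne_zero (mul_ne_zero hb0 hz) ha),
      ev (div_ne_zero hb0 (mul_ne_zero ha h₁)), ev (div_ne_zero hb0 (mul_ne_zero ha h₂)),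
      ev (div_ne_zero hb0 (mul_ne_zero ha h₃)), ev hz, ev (div_ne_zero hz ha),
      ev (mul_ne_zero hz h₁), ev (mul_ne_zero hz h₂), ev (mul_ne_zero hz h₃),
      ev2 (div_ne_zero (pow_ne_zero 2 hz) ha)] with t g1 g2 g3 g4 g5 g6 g7 g8 g9 g10 g11 g12
    have hEt := E0 t
    have ezb : z * E t * (b * E t)⁻¹ = z * b⁻¹ := by field_simp
    have tz : theta q (z * b⁻¹) ≠ 0 := by
      refine theta_ne_zero hq0 hq (by positivity) fun k hk => hbz (-k) ?_
      rw [zpow_neg, ← hk]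
      field_simp
    have r1 : ∀ x w : ℂ, x / w * E t = x * E t / w := fun x w => by ring
    have t9 : theta q (z * E t * u₁) ≠ 0 := theta_ne_zero hq0 hq (by positivity)
      (by rwa [mul_right_comm])
    have t10 : theta q (z * E t * u₂) ≠ 0 := theta_ne_zero hq0 hq (by positivity)
      (by rwa [mul_right_comm])
    have t11 : theta q (z * E t * u₃) ≠ 0 := theta_ne_zero hq0 hq (by positivity)
      (by rwa [mul_right_comm])
    have t12 : theta q ((z * E t) ^ 2 / a) ≠ 0 := theta_ne_zero hq0 hq (by positivity)
      (by rwa [show (z * E t) ^ 2 / a = z ^ 2 / a * E t ^ 2 by ring])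
    have tza : qInf q (q * (z * E t) / a) ≠ 0 := by
      refine qInf_ne_zero hq fun k hk => g8 (-(k + 1 : ℕ)) ?_
      rw [zpow_neg, zpow_natCast]
      refine eq_inv_of_mul_eq_one_left ?_
      rw [← hk, pow_succ]
      ring
    have h := sum6_three_term_of_theta_ne_zero hq0 hq (a := a) (z := z * E t) (b := b * E t)
      (u₁ := u₁) (u₂ := u₂) (u₃ := u₃)
      (u := u) (v := v) ha (by positivity) h₁ h₂ h₃ hu hv (by rw [hbu]; ring) g1
      (by rwa [← r1]) (by rwa [mul_div_mul_right _ _ hEt])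
      (by rwa [show b * E t * (z * E t) / a = b * z / a * E t ^ 2 by ring])
      (theta_ne_zero hq0 hq (by positivity) (by rwa [← r1]))
      (theta_ne_zero hq0 hq (by positivity) (by rwa [← r1]))
      (theta_ne_zero hq0 hq (by positivity) (by rwa [← r1]))
      (theta_ne_zero hq0 hq (by positivity) g7) tza t9 t10 t11 (by rwa [ezb]) t12 c₁ (by
        rw [← div_div, norm_div, nE, div_one]
        exact c₂)
    rw [ezb] at h
    exact h
  have lz : Tendsto (fun t => z * E t) (𝓝[≠] 0) (𝓝 z) := by simpa using lE.const_mul z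
  have lb : Tendsto (fun t => (b * E t)⁻¹) (𝓝[≠] 0) (𝓝 b⁻¹) := by
    have h := lE.const_mul b
    rw [mul_one] at h
    exact h.inv₀ hb0
  have lzd : ∀ x, Tendsto (fun t => x / (z * E t)) (𝓝[≠] 0) (𝓝 (x / z)) := fun x =>
    tendsto_const_nhds.div lz hz
  have lth : ∀ {f : ℝ → ℂ} {x : ℂ}, Tendsto f (𝓝[≠] 0) (𝓝 x) → x ≠ 0 →
      Tendsto (fun t => theta q (f t)) (𝓝[≠] 0) (𝓝 (theta q x)) := fun hf hx =>
    (continuousAt_theta hq hx).tendsto.comp hf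
  have lq : ∀ {f : ℝ → ℂ} {x : ℂ}, Tendsto f (𝓝[≠] 0) (𝓝 x) →
      Tendsto (fun t => qInf q (f t)) (𝓝[≠] 0) (𝓝 (qInf q x)) := fun hf =>
    ((continuous_qInf hq).tendsto _).comp hf
  have i0 : b⁻¹ ≠ 0 := inv_ne_zero hb0
  have nz : ∀ t, ‖z * E t‖ = ‖z‖ := fun t => by rw [norm_mul, nE, mul_one]
  have nb : ∀ t, ‖(b * E t)⁻¹‖ = ‖b⁻¹‖ := fun t => by rw [norm_inv, norm_mul, nE, mul_one, norm_inv]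
  have nzu : ∀ x t, ‖z * E t * x‖ = ‖z * x‖ := fun x t => by rw [norm_mul, nz, norm_mul]
  have nzd : ∀ x t, ‖x / (z * E t)‖ = ‖x / z‖ := fun x t => by rw [norm_div, nz, norm_div]
  have lz2 : Tendsto (fun t => (z * E t) ^ 2 / a) (𝓝[≠] 0) (𝓝 (z ^ 2 / a)) :=
    (lz.pow 2).div_const a
  have S1 := tendsto_sum6 hq0 hq (l := 𝓝[≠] (0 : ℝ)) ha h₁ h₂ h₃ i0 hu hv
    (by convert c₂ using 2; rw [hbu]; field_simp) tendsto_const_nhds tendsto_const_nhds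
    tendsto_const_nhds tendsto_const_nhds lb tendsto_const_nhds tendsto_const_nhds
    (fun _ => rfl) (fun _ => rfl) (fun _ => rfl) (fun _ => rfl) nb (fun _ => rfl) (fun _ => rfl)
  have S2 := tendsto_sum6 hq0 hq (l := 𝓝[≠] (0 : ℝ)) (A := fun t => a / (z * E t) ^ 2)
    (a := a / z ^ 2) (u₁ := z * u₁)
    (u₂ := z * u₂) (u₃ := z * u₃) (u₄ := z * b⁻¹) (u₅ := z * u) (u₆ := z * v)
    (by positivity) (by positivity) (by positivity) (by positivity) (by positivity)
    (by positivity) (by positivity)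
    (by convert c₂ using 2; rw [hbu]; field_simp) (tendsto_const_nhds.div (lz.pow 2) (by positivity))
    (lz.mul_const u₁) (lz.mul_const u₂) (lz.mul_const u₃) tendsto_const_nhds (lz.mul_const u)
    (lz.mul_const v) (fun t => by rw [norm_div, norm_pow, nz, norm_div, norm_pow])
    (nzu u₁) (nzu u₂) (nzu u₃) (fun _ => rfl) (nzu u) (nzu v)
  have S3 := tendsto_sum6 hq0 hq (l := 𝓝[≠] (0 : ℝ)) (a := z) (u₁ := u₁)
    (u₂ := u₂) (u₃ := u₃) (u₄ := b⁻¹) (u₅ := u * a / z) (u₆ := v * a / z)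
    hz h₁ h₂ h₃ i0 (by positivity) (by positivity)
    (by convert c₁ using 2; rw [hbu]; field_simp) lz tendsto_const_nhds
    tendsto_const_nhds tendsto_const_nhds lb (lzd (u * a)) (lzd (v * a)) nz
    (fun _ => rfl) (fun _ => rfl) (fun _ => rfl) nb (nzd (u * a)) (nzd (v * a))
  have P := ((tendsto_const_nhds (x := qInf q (a * q * u₁ * u₂))).mul
    (tendsto_const_nhds (x := qInf q (a * q * u₁ * u₃)))).mul
    (lq (lb.const_mul (a * q * u₁))) |>.mul (((tendsto_const_nhds
      (x := qInf q (a * q * u₂ * u₃))).mul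
    (lq (lb.const_mul (a * q * u₂)))).mul (lq (lb.const_mul (a * q * u₃))))
  refine tendsto_nhds_unique_of_eventuallyEq (l := 𝓝[≠] (0 : ℝ)) ?_ ?_ key
  · refine (lq (lzd _)).mul (Tendsto.sub ?_ ?_)
    · exact (((((lth (lz.mul_const u₁) (by positivity)).mul (lth (lz.mul_const u₂)
        (by positivity))).mul (lth (lz.mul_const u₃) (by positivity))).mul_const _).mul
        (lth lz2 (by positivity))).mul S1
    · exact (((lz.pow 5).mul ((lth lb i0).const_mul _)).mul_const _).mul S2
  · exact ((((((lz.pow 2).div_const (a * q)).neg.mul_const _).mul (lth lz2 (by positivity))).mul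
      P).mul_const _).mul S3

/-! ### From shifted factorials to the normalised series -/

theorem qPoch_neg_natCast (q x : ℂ) (N : ℕ) :
    qPoch q x (-(N : ℤ)) = (∏ k ∈ Finset.range N, (1 - x / q ^ (k + 1)))⁻¹ := by
  rcases N with _ | N
  · simp [qPoch]
  · rw [show (-((N + 1 : ℕ) : ℤ)) = Int.negSucc N from rfl]
    rfl

theorem prod_mul_qInf_zpow_neg (hq0 : q ≠ 0) (hq : ‖q‖ < 1) (x : ℂ) (N : ℕ) :
    (∏ k ∈ Finset.range N, (1 - x / q ^ (k + 1))) * qInf q x = qInf q (x * q ^ (-(N : ℤ))) := by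
  induction N with
  | zero => simp
  | succ N ih =>
    have e : x * q ^ (-((N + 1 : ℕ) : ℤ)) = x / q ^ (N + 1) := by
      rw [zpow_neg, zpow_natCast]
      rfl
    have e' : x / q ^ (N + 1) * q = x * q ^ (-(N : ℤ)) := by
      rw [zpow_neg, zpow_natCast, pow_succ]
      field_simp
    rw [e, qInf_eq_mul q (x / q ^ (N + 1)) hq, e', ← ih, Finset.prod_range_succ]
    ring

theorem inv_qPoch_mul_qInf (hq0 : q ≠ 0) (hq : ‖q‖ < 1) {y : ℂ} (hy : ∀ k : ℕ, y * q ^ k ≠ 1)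
    (n : ℤ) : (qPoch q y n)⁻¹ * qInf q y = qInf q (y * q ^ n) := by
  obtain ⟨N, rfl | rfl⟩ := n.eq_nat_or_neg
  · have hP : ∏ k ∈ Finset.range N, (1 - y * q ^ k) ≠ 0 :=
      Finset.prod_ne_zero_iff.2 fun k _ => sub_ne_zero.2 (hy k).symm
    rw [← qPoch_mul_qInf_nat q y hq N, zpow_natCast]
    exact inv_mul_cancel_left₀ hP _
  · rw [qPoch_neg_natCast, inv_inv, prod_mul_qInf_zpow_neg hq0 hq]

theorem two_mul_choose_two (n : ℤ) : 2 * (n * (n - 1) / 2) = n * (n - 1) :=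
  Int.two_mul_ediv_two_of_even (Int.even_mul_pred_self n)

/-- Reversing the finite product extracts `(-x)ⁿ q^{n(n-1)/2}` and replaces `x` by `q/x`. In this
form the upper parameter gives the first factor of the kernel of `1/x`. -/
theorem qPoch_mul_qInf_inv (hq0 : q ≠ 0) (hq : ‖q‖ < 1) {x : ℂ} (hx0 : x ≠ 0)
    (hx : ∀ k : ℕ, x ≠ q ^ (k + 1)) (n : ℤ) :
    qPoch q x n * qInf q (q / x) = (-x) ^ n * q ^ (n * (n - 1) / 2) * qInf q (q / x * q ^ (-n)) := by
  have hnx : -x ≠ 0 := neg_ne_zero.2 hx0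
  obtain ⟨N, rfl | rfl⟩ := n.eq_nat_or_neg
  · rw [← prod_mul_qInf_zpow_neg hq0 hq, ← mul_assoc]
    congr 1
    simp only [qPoch]
    induction N with
    | zero => simp
    | succ N ih =>
      have e : ((N + 1 : ℕ) : ℤ) * (((N + 1 : ℕ) : ℤ) - 1) / 2 = (N : ℤ) * ((N : ℤ) - 1) / 2 + N := by
        have h1 := two_mul_choose_two ((N + 1 : ℕ) : ℤ)
        have h2 := two_mul_choose_two (N : ℤ)
        push_cast at h1 ⊢
        linarith
      have ih' : ∏ k ∈ Finset.range N, (1 - x * q ^ k) = (-x) ^ (N : ℤ) *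
          q ^ ((N : ℤ) * ((N : ℤ) - 1) / 2) *
          ∏ k ∈ Finset.range N, (1 - q / x / q ^ (k + 1)) := ih
      change ∏ k ∈ Finset.range (N + 1), (1 - x * q ^ k) = _
      rw [Finset.prod_range_succ, ih', Finset.prod_range_succ, e, zpow_add₀ hq0, zpow_natCast,
        zpow_natCast, zpow_natCast, pow_succ, pow_succ]
      have := pow_ne_zero N hq0
      field_simp
      ring
  · have hP : ∏ k ∈ Finset.range N, (1 - x / q ^ (k + 1)) ≠ 0 :=
      Finset.prod_ne_zero_iff.2 fun k _ => sub_ne_zero.2 fun h => hx k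
        ((div_eq_one_iff_eq (pow_ne_zero _ hq0)).1 h.symm)
    rw [qPoch_neg_natCast, inv_mul_eq_iff_eq_mul₀ hP, neg_neg, zpow_natCast q N,
      ← qPoch_mul_qInf_nat q (q / x) hq N, ← mul_assoc, ← mul_assoc]
    congr 1
    clear hP
    induction N with
    | zero => simp
    | succ N ih =>
      have e : -((N + 1 : ℕ) : ℤ) * (-((N + 1 : ℕ) : ℤ) - 1) / 2 =
          -(N : ℤ) * (-(N : ℤ) - 1) / 2 + (N + 1 : ℕ) := by
        have h1 := two_mul_choose_two (-((N + 1 : ℕ) : ℤ))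
        have h2 := two_mul_choose_two (-(N : ℤ))
        push_cast at h1 ⊢
        linarith
      rw [Finset.prod_range_succ, ih, Finset.prod_range_succ, e, zpow_add₀ hq0 (-(N : ℤ) * _ / 2),
        zpow_natCast, zpow_neg, zpow_neg, zpow_natCast, zpow_natCast, pow_succ, pow_succ (-x)]
      have := pow_ne_zero N hq0
      field_simp
      ring

/-- The normalising factor of the parameter `x` in a very-well-poised series. -/
def norm6 (q a x : ℂ) : ℂ := qInf q (q / x) * qInf q (a * q / x)

theorem qPoch_div_qPoch (hq0 : q ≠ 0) (hq : ‖q‖ < 1) {a x : ℂ} (hx0 : x ≠ 0)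
    (hx : ∀ k : ℕ, x ≠ q ^ (k + 1)) (hy : ∀ k : ℕ, a * q / x * q ^ k ≠ 1) (n : ℤ) :
    qPoch q x n / qPoch q (a * q / x) n * norm6 q a x =
      (-x) ^ n * q ^ (n * (n - 1) / 2) * ker q a x⁻¹ n := by
  have h1 := qPoch_mul_qInf_inv hq0 hq hx0 hx n
  have h2 := inv_qPoch_mul_qInf hq0 hq hy n
  have e1 : q / x * q ^ (-n) = x⁻¹ * q ^ (1 - n) := by
    rw [zpow_sub₀ hq0, zpow_one, zpow_neg]
    ring
  have e2 : a * q / x * q ^ n = a * x⁻¹ * q ^ (1 + n) := by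
    rw [zpow_add₀ hq0, zpow_one]
    ring
  rw [e1] at h1
  rw [e2] at h2
  rw [norm6, ker, div_eq_mul_inv]
  linear_combination (qPoch q (a * q / x) n)⁻¹ * qInf q (a * q / x) * h1 +
    (-x) ^ n * q ^ (n * (n - 1) / 2) * qInf q (x⁻¹ * q ^ (1 - n)) * h2

theorem norm6_ne_zero (hq : ‖q‖ < 1) {a x : ℂ} (hx0 : x ≠ 0)
    (hx : ∀ k : ℕ, x ≠ q ^ (k + 1)) (hy : ∀ k : ℕ, a * q / x * q ^ k ≠ 1) : norm6 q a x ≠ 0 := by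
  refine mul_ne_zero (qInf_ne_zero hq fun k h => hx k ?_) (qInf_ne_zero hq hy)
  rw [pow_succ']
  field_simp at h
  exact h.symm

theorem qPoch_shift_div_qPoch (hq0 : q ≠ 0) {r : ℂ} (h₁ : ∀ k : ℕ, q * r ≠ q ^ (k + 1))
    (h₂ : ∀ k : ℕ, r * q ^ k ≠ 1) (n : ℤ) :
    qPoch q (q * r) n / qPoch q r n * (1 - r) = 1 - r * q ^ n := by
  obtain ⟨N, rfl | rfl⟩ := n.eq_nat_or_neg
  · have hP : ∏ k ∈ Finset.range N, (1 - r * q ^ k) ≠ 0 :=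
      Finset.prod_ne_zero_iff.2 fun k _ => sub_ne_zero.2 (h₂ k).symm
    have e := (Finset.prod_range_succ (fun k => 1 - r * q ^ k) N).symm.trans
      (Finset.prod_range_succ' (fun k => 1 - r * q ^ k) N)
    have e' : ∏ k ∈ Finset.range N, (1 - r * q ^ (k + 1)) =
        ∏ k ∈ Finset.range N, (1 - q * r * q ^ k) :=
      Finset.prod_congr rfl fun k _ => by ring
    rw [e', pow_zero, mul_one] at e
    change (∏ k ∈ Finset.range N, (1 - q * r * q ^ k)) /
      (∏ k ∈ Finset.range N, (1 - r * q ^ k)) * (1 - r) = _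
    rw [div_mul_eq_mul_div, ← e, mul_div_cancel_left₀ _ hP, zpow_natCast]
  · have hP : ∏ k ∈ Finset.range N, (1 - q * r / q ^ (k + 1)) ≠ 0 :=
      Finset.prod_ne_zero_iff.2 fun k _ => sub_ne_zero.2 fun h => h₁ k
        ((div_eq_one_iff_eq (pow_ne_zero _ hq0)).1 h.symm)
    have e := (Finset.prod_range_succ (fun k => 1 - q * r / q ^ (k + 1)) N).symm.trans
      (Finset.prod_range_succ' (fun k => 1 - q * r / q ^ (k + 1)) N)
    have e' : ∏ k ∈ Finset.range N, (1 - q * r / q ^ (k + 1 + 1)) =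
        ∏ k ∈ Finset.range N, (1 - r / q ^ (k + 1)) :=
      Finset.prod_congr rfl fun k _ => by
        rw [pow_succ q (k + 1)]
        field_simp
    have e0 : q * r / q ^ (N + 1) = r * q ^ (-(N : ℤ)) := by
      rw [zpow_neg, zpow_natCast, pow_succ]
      field_simp
    have e1 : q * r / q ^ (0 + 1) = r := by
      rw [zero_add, pow_one, mul_div_cancel_left₀ _ hq0]
    rw [e', e0, e1] at e
    rw [qPoch_neg_natCast, qPoch_neg_natCast, div_inv_eq_mul, mul_assoc, ← e,
      inv_mul_cancel_left₀ hP]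

/-- Under `n ↦ -n` the two factors of each kernel change places, which inverts the base. It links
the base `a/z²` of the normalised relation with the base `z²/a` of the theorem. -/
theorem sum6_reflect (hq0 : q ≠ 0) {a : ℂ} (ha : a ≠ 0) (u₁ u₂ u₃ u₄ u₅ u₆ : ℂ) :
    sum6 q a u₁ u₂ u₃ u₄ u₅ u₆ =
      -a * sum6 q a⁻¹ (a * u₁) (a * u₂) (a * u₃) (a * u₄) (a * u₅) (a * u₆) := by
  rw [sum6, sum6, ← (Equiv.neg ℤ).tsum_eq, ← tsum_mul_left]
  refine tsum_congr fun n => ?_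
  have hn : q ^ n ≠ 0 := zpow_ne_zero _ hq0
  have e : (1 - a * q ^ (2 * -n)) * q ^ (-(-n)) = -a * ((1 - a⁻¹ * q ^ (2 * n)) * q ^ (-n)) := by
    rw [show 2 * -n = -(n * 2) by ring, show 2 * n = n * 2 by ring, neg_neg, zpow_neg, zpow_neg,
      zpow_mul, zpow_ofNat]
    field_simp
    ring
  have e2 : a ^ (3 * -n) = a⁻¹ ^ (3 * n) := by rw [inv_zpow, ← zpow_neg, mul_neg]
  rw [Equiv.neg_apply, term6, term6, ker_neg ha, ker_neg ha, ker_neg ha, ker_neg ha, ker_neg ha,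
    ker_neg ha, e, e2, neg_sq]
  ring

/-- The pair `±q√a` yields `(1 - a q^{2n})/(1 - a)`, and each other parameter yields a kernel
divided by its `norm6`. The nonvanishing of the total factor comes from the definedness of the
series. -/
theorem vwpTerm_mul (hq0 : q ≠ 0) (hq : ‖q‖ < 1) {a x₁ x₂ x₃ x₄ x₅ x₆ w : ℂ} (ha : a ≠ 0)
    (h₁ : x₁ ≠ 0) (h₂ : x₂ ≠ 0) (h₃ : x₃ ≠ 0) (h₄ : x₄ ≠ 0) (h₅ : x₅ ≠ 0) (h₆ : x₆ ≠ 0)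
    (hd : VwpDefined q a [x₁, x₂, x₃, x₄, x₅, x₆])
    (hw : x₁ * x₂ * x₃ * x₄ * x₅ * x₆ * w = a ^ 3 * q ^ 2) :
    (1 - a) * (norm6 q a x₁ * norm6 q a x₂ * norm6 q a x₃ * norm6 q a x₄ *
        (norm6 q a x₅ * norm6 q a x₆)) ≠ 0 ∧
    ∀ n, vwpTerm q a [x₁, x₂, x₃, x₄, x₅, x₆] w n * ((1 - a) * (norm6 q a x₁ * norm6 q a x₂ *
      norm6 q a x₃ * norm6 q a x₄ * (norm6 q a x₅ * norm6 q a x₆))) =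
    term6 q a x₁⁻¹ x₂⁻¹ x₃⁻¹ x₄⁻¹ x₅⁻¹ x₆⁻¹ n := by
  obtain ⟨r, hr⟩ : ∃ r, r = Complex.sqrt a := ⟨_, rfl⟩
  have hr2 : r ^ 2 = a := by
    rw [hr, Complex.sqrt]
    exact_mod_cast Complex.cpow_nat_inv_pow a two_ne_zero
  have hr0 : r ≠ 0 := by
    rintro rfl
    exact ha (by rw [← hr2]; simp)
  simp only [VwpDefined, PsiDefined, vwpLower, vwpUpper, ← hr, List.map_cons, List.map_nil,
    List.forall_mem_cons, List.not_mem_nil, IsEmpty.forall_iff, implies_true, and_true] at hd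
  obtain ⟨⟨p0, p0', p1, p2, p3, p4, p5, p6⟩, m0, m0', m1, m2, m3, m4, m5, m6⟩ := hd
  have er : a * q / (q * r) = r := by
    rw [← hr2]
    field_simp
  have er' : a * q / (-(q * r)) = -r := by
    rw [← hr2]
    field_simp
  rw [er] at m0
  rw [er'] at m0'
  rw [← mul_neg] at p0'
  refine ⟨?_, fun n => ?_⟩
  · have hr1 : 1 - a ≠ 0 := by
      rw [← hr2, show 1 - r ^ 2 = (1 - r) * (1 - -r) by ring]
      refine mul_ne_zero (sub_ne_zero.2 fun h => m0 0 ?_) (sub_ne_zero.2 fun h => m0' 0 ?_)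
      · rw [← h, pow_zero, mul_one]
      · rw [← h, pow_zero, mul_one]
    have := norm6_ne_zero hq h₁ p1 m1
    have := norm6_ne_zero hq h₂ p2 m2
    have := norm6_ne_zero hq h₃ p3 m3
    have := norm6_ne_zero hq h₄ p4 m4
    have := norm6_ne_zero hq h₅ p5 m5
    have := norm6_ne_zero hq h₆ p6 m6
    positivity
  have k0 := qPoch_shift_div_qPoch hq0 p0 m0 n
  have k0' := qPoch_shift_div_qPoch hq0 p0' m0' n
  have k1 := qPoch_div_qPoch hq0 hq h₁ p1 m1 n
  have k2 := qPoch_div_qPoch hq0 hq h₂ p2 m2 n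
  have k3 := qPoch_div_qPoch hq0 hq h₃ p3 m3 n
  have k4 := qPoch_div_qPoch hq0 hq h₄ p4 m4 n
  have k5 := qPoch_div_qPoch hq0 hq h₅ p5 m5 n
  have k6 := qPoch_div_qPoch hq0 hq h₆ p6 m6 n
  have hv : vwpTerm q a [x₁, x₂, x₃, x₄, x₅, x₆] w n =
      qPoch q (q * r) n / qPoch q r n * (qPoch q (q * -r) n / qPoch q (-r) n) *
      (qPoch q x₁ n / qPoch q (a * q / x₁) n * (qPoch q x₂ n / qPoch q (a * q / x₂) n) *
      (qPoch q x₃ n / qPoch q (a * q / x₃) n) * (qPoch q x₄ n / qPoch q (a * q / x₄) n) *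
      (qPoch q x₅ n / qPoch q (a * q / x₅) n * (qPoch q x₆ n / qPoch q (a * q / x₆) n))) *
      w ^ n := by
    simp only [vwpTerm, psiTerm, qPochs, vwpLower, vwpUpper, ← hr, List.map_cons, List.map_nil,
      List.prod_cons, List.prod_nil, er, er', mul_neg]
    simp only [div_eq_mul_inv, mul_inv, inv_one]
    ring
  -- The six signs cancel, and the argument satisfies `x₁⋯x₆ w = a³q²`. The exponent of `q` is then
  -- `3n(n-1) + 2n = 3n² - n`.
  have hpow : (-x₁) ^ n * (-x₂) ^ n * (-x₃) ^ n * (-x₄) ^ n * ((-x₅) ^ n * (-x₆) ^ n) * w ^ n *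
      (q ^ (n * (n - 1) / 2)) ^ 6 = q ^ (-n) * (a ^ (3 * n) * q ^ (3 * n ^ 2)) := by
    rw [← mul_zpow, ← mul_zpow, ← mul_zpow, ← mul_zpow, ← mul_zpow, ← mul_zpow,
      show -x₁ * -x₂ * -x₃ * -x₄ * (-x₅ * -x₆) * w = a ^ 3 * q ^ 2 by rw [← hw]; ring,
      mul_zpow, ← zpow_natCast, ← zpow_natCast, ← zpow_natCast, ← zpow_mul, ← zpow_mul, ← zpow_mul,
      mul_assoc, ← zpow_add₀ hq0, mul_left_comm, ← zpow_add₀ hq0]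
    have := two_mul_choose_two n
    congr 2
    push_cast
    linarith
  have hr' : 1 - a * q ^ (2 * n) = (1 - r * q ^ n) * (1 - -r * q ^ n) := by
    rw [mul_comm 2 n, zpow_mul, zpow_ofNat, ← hr2]
    ring
  rw [hv, term6, mul_assoc (1 - a * q ^ (2 * n)), ← hpow, hr', ← k0, ← k0']
  calc _ = qPoch q (q * r) n / qPoch q r n * (1 - r) * (qPoch q (q * -r) n / qPoch q (-r) n *
        (1 - -r)) * w ^ n * (qPoch q x₁ n / qPoch q (a * q / x₁) n * norm6 q a x₁ *
        (qPoch q x₂ n / qPoch q (a * q / x₂) n * norm6 q a x₂) *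
        (qPoch q x₃ n / qPoch q (a * q / x₃) n * norm6 q a x₃) *
        (qPoch q x₄ n / qPoch q (a * q / x₄) n * norm6 q a x₄) *
        (qPoch q x₅ n / qPoch q (a * q / x₅) n * norm6 q a x₅ *
        (qPoch q x₆ n / qPoch q (a * q / x₆) n * norm6 q a x₆))) := by
        rw [← hr2]
        ring
    _ = _ := by
        rw [k1, k2, k3, k4, k5, k6]
        ring

theorem vwpPsi_mul (hq0 : q ≠ 0) (hq : ‖q‖ < 1) {a x₁ x₂ x₃ x₄ x₅ x₆ w : ℂ} (ha : a ≠ 0)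
    (h₁ : x₁ ≠ 0) (h₂ : x₂ ≠ 0) (h₃ : x₃ ≠ 0) (h₄ : x₄ ≠ 0) (h₅ : x₅ ≠ 0) (h₆ : x₆ ≠ 0)
    (hd : VwpDefined q a [x₁, x₂, x₃, x₄, x₅, x₆])
    (hw : x₁ * x₂ * x₃ * x₄ * x₅ * x₆ * w = a ^ 3 * q ^ 2) (hw1 : ‖w‖ < 1) :
    Summable (vwpTerm q a [x₁, x₂, x₃, x₄, x₅, x₆] w) ∧
    (1 - a) * (norm6 q a x₁ * norm6 q a x₂ * norm6 q a x₃ * norm6 q a x₄ *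
        (norm6 q a x₅ * norm6 q a x₆)) ≠ 0 ∧
    vwpPsi q a [x₁, x₂, x₃, x₄, x₅, x₆] w * ((1 - a) * (norm6 q a x₁ * norm6 q a x₂ *
      norm6 q a x₃ * norm6 q a x₄ * (norm6 q a x₅ * norm6 q a x₆))) =
    sum6 q a x₁⁻¹ x₂⁻¹ x₃⁻¹ x₄⁻¹ x₅⁻¹ x₆⁻¹ := by
  obtain ⟨hne, ht⟩ := vwpTerm_mul hq0 hq ha h₁ h₂ h₃ h₄ h₅ h₆ hd hw
  have e : a ^ 3 * q ^ 2 * (x₁⁻¹ * x₂⁻¹ * x₃⁻¹ * x₄⁻¹ * x₅⁻¹ * x₆⁻¹) = w := by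
    rw [← hw]
    field_simp
  have hs := summable_term6 hq0 hq ha (inv_ne_zero h₁) (inv_ne_zero h₂) (inv_ne_zero h₃)
    (inv_ne_zero h₄) (inv_ne_zero h₅) (inv_ne_zero h₆) (by rwa [e])
  refine ⟨(summable_mul_right_iff hne).1 (hs.congr fun n => (ht n).symm), hne, ?_⟩
  rw [vwpPsi, ← tsum_mul_right, sum6]
  exact tsum_congr ht

/-! ### Solving for the first series -/

/-- The infinite products are treated as independent symbols, with `k = 1 - a`, `m = 1 - z²/a`, so
that the passage from the normalised relation to the stated coefficients is plain field algebra. -/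
theorem solve_three_term {a q z W B Z Q A C D P F k m T X N₁ N₂ M₁ M₂ p₁ p₂ p₃ : ℂ}
    (ha : a ≠ 0) (hq : q ≠ 0) (hz : z ≠ 0) (hW : W ≠ 0) (hB : B ≠ 0) (hZ : Z ≠ 0) (hQ : Q ≠ 0)
    (hA : A ≠ 0) (hm : m ≠ 0) (hT : T ≠ 0) (hN₁ : N₁ ≠ 0) (hN₂ : N₂ ≠ 0) (hk : k ≠ 0)
    (h : W * (z ^ 3 / (a * q) * (B * Z) * (m * T) * (p₁ * (k * (Q * A * (N₁ * N₂)))) -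
        z ^ 5 * (D * Q / (a * z * q)) * (-(k * X) / a) *
          (-(a / z ^ 2) * (p₃ * (m * (C * Z * (M₁ * M₂)))))) =
      -(z ^ 2 / (a * q)) * (k * X) * (m * T) * P * F * (p₂ * ((1 - z) * (Q * Z * (M₁ * N₂))))) :
    p₁ = (1 - 1 / z) * (X / N₁) * (P * (F * M₁) / (A * (B * W))) * p₂ +
      1 / z * (X / T) * (M₁ * M₂ / (N₁ * N₂)) * (D * C / (B * A)) * p₃ := by
  have hK : k * m * Z * Q * (z ^ 2 / (a * q)) ≠ 0 := by positivity
  have h1 : W * (z * B * T * (p₁ * (A * (N₁ * N₂))) - D * X * (p₃ * (C * (M₁ * M₂)))) =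
      (z - 1) * X * T * P * F * p₂ * (M₁ * N₂) := by
    refine mul_left_cancel₀ hK ?_
    rw [show z ^ 5 * (D * Q / (a * z * q)) * (-(k * X) / a) *
          (-(a / z ^ 2) * (p₃ * (m * (C * Z * (M₁ * M₂))))) = k * m * Z * Q * (z ^ 2 / (a * q)) *
          (D * X * (p₃ * (C * (M₁ * M₂)))) by field_simp] at h
    linear_combination h
  rw [one_sub_div hz]
  field_simp
  linear_combination h1

/-- The three-term relation in terms of infinite products. -/
theorem sum6_three_term_qInf (hq0 : q ≠ 0) (hq : ‖q‖ < 1) {a b c d e f g z : ℂ} (ha : a ≠ 0)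
    (hb : b ≠ 0) (hc : c ≠ 0) (hd : d ≠ 0) (he : e ≠ 0) (hf : f ≠ 0) (hg : g ≠ 0) (hz0 : z ≠ 0)
    (hbcde : b * c * d * e = a * z * q) (hez : ∀ k : ℤ, e / z ≠ q ^ k)
    (hw : ‖a ^ 2 * q / (f * g * z)‖ < 1) (hw' : ‖a * q / (f * g)‖ < 1) :
    qInf q (a ^ 2 * q / (f * g * z)) *
      (z ^ 3 / (a * q) * (qInf q (b / z) * (qInf q (c / z) * (qInf q (d / z) * qInf q (e / z))) *
        (qInf q (z * q / b) * qInf q (z * q / c) * qInf q (z * q / d) * qInf q (z * q / e))) *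
        ((1 - z ^ 2 / a) * (qInf q (a * q / z ^ 2) * qInf q (z ^ 2 * q / a))) *
        sum6 q a b⁻¹ c⁻¹ d⁻¹ e⁻¹ f⁻¹ g⁻¹ -
      z ^ 5 * (qInf q b * (qInf q c * (qInf q d * qInf q e)) *
        (qInf q (q / b) * qInf q (q / c) * qInf q (q / d) * qInf q (q / e)) / (a * z * q)) *
        (-((1 - a) * (qInf q (a * q) * qInf q (q / a))) / a) *
        (-(a / z ^ 2) * sum6 q (z ^ 2 / a) (b * z / a)⁻¹ (c * z / a)⁻¹ (d * z / a)⁻¹ (e * z / a)⁻¹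
          (f * z / a)⁻¹ (g * z / a)⁻¹)) =
    -(z ^ 2 / (a * q)) * ((1 - a) * (qInf q (a * q) * qInf q (q / a))) *
      ((1 - z ^ 2 / a) * (qInf q (a * q / z ^ 2) * qInf q (z ^ 2 * q / a))) *
      (qInf q (a * q / (b * c)) * (qInf q (a * q / (b * d)) * (qInf q (a * q / (b * e)) *
        (qInf q (a * q / (c * d)) * (qInf q (a * q / (c * e)) * qInf q (a * q / (d * e))))))) *
      qInf q (a * q / (f * g)) *
      sum6 q z b⁻¹ c⁻¹ d⁻¹ e⁻¹ (f * z / a)⁻¹ (g * z / a)⁻¹ := by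
  have T := sum6_three_term hq0 hq (z := z) (b := e) (u₁ := b⁻¹) (u₂ := c⁻¹) (u₃ := d⁻¹)
    (u := f⁻¹) (v := g⁻¹) ha hz0 (inv_ne_zero hb) (inv_ne_zero hc) (inv_ne_zero hd)
    (inv_ne_zero hf) (inv_ne_zero hg) (by
      field_simp
      linear_combination hbcde) hez
    (by convert hw' using 2; field_simp) (by convert hw using 2; field_simp)
  have t1 : ∀ x, x ≠ 0 → theta q (z * x⁻¹) = -(z / x) * (qInf q (x / z) * qInf q (z * q / x)) :=
    fun x hx => by
      have h := theta_inv hq (div_ne_zero hx hz0)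
      rw [theta, theta, show q / (x / z) = z * q / x by field_simp] at h
      rw [show z * x⁻¹ = (x / z)⁻¹ by field_simp, theta, h]
      field_simp
  have t2 : ∀ x, x ≠ 0 → theta q x⁻¹ = -(1 / x) * (qInf q x * qInf q (q / x)) := fun x hx => by
    rw [theta_inv hq hx, theta]
    ring
  have t3 : theta q a = (1 - a) * (qInf q (a * q) * qInf q (q / a)) := by
    rw [theta, qInf_eq_mul q a hq, mul_assoc]
  have t4 : theta q (z ^ 2 / a) =
      (1 - z ^ 2 / a) * (qInf q (z ^ 2 * q / a) * qInf q (a * q / z ^ 2)) := by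
    rw [theta, qInf_eq_mul q _ hq, mul_assoc, show z ^ 2 / a * q = z ^ 2 * q / a by ring,
      show q / (z ^ 2 / a) = a * q / z ^ 2 by field_simp]
  have t5 : theta q a⁻¹ = -((1 - a) * (qInf q (a * q) * qInf q (q / a))) / a := by
    rw [theta_inv hq ha, t3]
  have v1 : ∀ x, x ≠ 0 → a / z ^ 2 * (z * x⁻¹) = (x * z / a)⁻¹ := fun x hx => by field_simp
  have v2 : ∀ x, x ≠ 0 → x⁻¹ * a / z = (x * z / a)⁻¹ := fun x hx => by field_simp
  have v3 : ∀ x y, x ≠ 0 → y ≠ 0 → a * q * x⁻¹ * y⁻¹ = a * q / (x * y) := fun x y hx hy => by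
    field_simp
  have v4 : a * q * (f⁻¹ * g⁻¹) = a * q / (f * g) := by field_simp
  have v5 : a ^ 2 * q * (f⁻¹ * g⁻¹) / z = a ^ 2 * q / (f * g * z) := by field_simp
  rw [sum6_reflect hq0 (a := a / z ^ 2) (by positivity), v1 b hb, v1 c hc, v1 d hd, v1 e he,
    v1 f hf, v1 g hg, inv_div, v2 f hf, v2 g hg, pairs4, v3 b c hb hc,
    v3 b d hb hd, v3 b e hb he, v3 c d hc hd, v3 c e hc he, v3 d e hd he, v4, v5,
    t1 b hb, t1 c hc, t1 d hd, t1 e he, t2 b hb, t2 c hc, t2 d hd, t2 e he, t5, t3, t4] at T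
  have w1 : ∀ x₁ x₂ x₃ x₄ : ℂ, -(z / b) * x₁ * (-(z / c) * x₂) * (-(z / d) * x₃) *
      (-(z / e) * x₄) = z ^ 3 / (a * q) * (x₁ * x₂ * x₃ * x₄) := fun x₁ x₂ x₃ x₄ => by
    have : z ^ 3 / (a * q) = z ^ 4 / (b * c * d * e) := by
      rw [hbcde]
      field_simp
    rw [this]
    field_simp
  have w2 : ∀ x₁ x₂ x₃ x₄ : ℂ, -(1 / b) * x₁ * (-(1 / c) * x₂) * (-(1 / d) * x₃) *
      (-(1 / e) * x₄) = x₁ * x₂ * x₃ * x₄ / (a * z * q) := fun x₁ x₂ x₃ x₄ => by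
    rw [← hbcde]
    field_simp
  rw [w1, w2] at T
  linear_combination T

end QSeries

end

theorem mainTheorem1 (q a b c d e f g z : ℂ)
    (hq0 : 0 < ‖q‖) (hq1 : ‖q‖ < 1)
    (ha : a ≠ 0) (hb : b ≠ 0) (hc : c ≠ 0) (hd : d ≠ 0) (he : e ≠ 0) (hf : f ≠ 0) (hg : g ≠ 0)
    (hz : z = b * c * d * e / (a * q))
    (hw : ‖a ^ 2 * q / (f * g * z)‖ < 1) (hw' : ‖a * q / (f * g)‖ < 1)
    -- no zero denominators in the terms of the three series
    (h₁ : VwpDefined q a [b, c, d, e, f, g])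
    (h₂ : VwpDefined q z [b, c, d, e, f * z / a, g * z / a])
    (h₃ : VwpDefined q (z ^ 2 / a)
      [b * z / a, c * z / a, d * z / a, e * z / a, f * z / a, g * z / a])
    -- no zero denominators in the coefficients (the other factors are nonzero by `hw` and `h₁`)
    (h₄ : Omega q [1 / z] [1 / b, 1 / c, 1 / d, 1 / e] ≠ 0)
    (h₅ : qInfs q [a * q / z ^ 2, z ^ 2 * q / a] ≠ 0) :
    Summable (vwpTerm q a [b, c, d, e, f, g] (a ^ 2 * q / (f * g * z))) ∧
    Summable (vwpTerm q z [b, c, d, e, f * z / a, g * z / a] (a * q / (f * g))) ∧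
    Summable (vwpTerm q (z ^ 2 / a)
      [b * z / a, c * z / a, d * z / a, e * z / a, f * z / a, g * z / a]
      (a ^ 2 * q / (f * g * z))) ∧
    vwpPsi q a [b, c, d, e, f, g] (a ^ 2 * q / (f * g * z)) =
      (1 - 1 / z) * (qInfs q [a * q, q / a] / Omega q [q] [f, g]) *
          (Omega q [a * q] [b * c, b * d, b * e, c * d, c * e, d * e, f * g, f * z, g * z] /
            (Omega q [a * q] [b, c, d, e] *
              Omega q [1 / z] [1 / b, 1 / c, 1 / d, 1 / e, f * g / (a ^ 2 * q)])) *
          vwpPsi q z [b, c, d, e, f * z / a, g * z / a] (a * q / (f * g)) +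
        1 / z * (qInfs q [a * q, q / a] / qInfs q [a * q / z ^ 2, z ^ 2 * q / a]) *
          (Omega q [a * q / z, z * q] [f, g] / Omega q [q, a * q] [f, g]) *
          (qInfs q [b, c, d, e] * Omega q [a * q / z] [b, c, d, e] /
            (Omega q [1 / z] [1 / b, 1 / c, 1 / d, 1 / e] * Omega q [a * q] [b, c, d, e])) *
          vwpPsi q (z ^ 2 / a)
            [b * z / a, c * z / a, d * z / a, e * z / a, f * z / a, g * z / a]
            (a ^ 2 * q / (f * g * z)) := by
  have hq0' : q ≠ 0 := norm_pos_iff.1 hq0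
  have hz0 : z ≠ 0 := by
    rw [hz]
    positivity
  have hbcde : b * c * d * e = a * z * q := by
    rw [hz]
    field_simp
  obtain ⟨s₁, n₁, A₁⟩ := vwpPsi_mul hq0' hq1 ha hb hc hd he hf hg h₁
    (w := a ^ 2 * q / (f * g * z)) (by
      field_simp
      linear_combination hbcde) hw
  obtain ⟨s₂, n₂, A₂⟩ := vwpPsi_mul hq0' hq1 hz0 hb hc hd he (by positivity) (by positivity) h₂
    (w := a * q / (f * g)) (by
      field_simp
      linear_combination hbcde) hw'
  obtain ⟨s₃, n₃, A₃⟩ := vwpPsi_mul hq0' hq1 (a := z ^ 2 / a) (by positivity)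
    (by positivity) (by positivity) (by positivity) (by positivity) (by positivity)
    (by positivity) h₃ (w := a ^ 2 * q / (f * g * z)) (by
      field_simp
      linear_combination hbcde) hw
  refine ⟨s₁, s₂, s₃, ?_⟩
  have r1 : ∀ x, x ≠ 0 → q / (x * z / a) = a * q / z / x := fun x hx => by field_simp
  have r2 : ∀ x, x ≠ 0 → z ^ 2 / a * q / (x * z / a) = z * q / x := fun x hx => by field_simp
  have r3 : ∀ x, x ≠ 0 → z * q / (x * z / a) = a * q / x := fun x hx => by field_simp
  have r4 : ∀ x, x ≠ 0 → a * q / (x * z) = a * q / z / x := fun x hx => by field_simp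
  have r5 : ∀ x, x ≠ 0 → 1 / z / (1 / x) = x / z := fun x hx => by field_simp
  have r6 : 1 / z / (f * g / (a ^ 2 * q)) = a ^ 2 * q / (f * g * z) := by field_simp
  simp only [norm6, r1 b hb, r1 c hc, r1 d hd, r1 e he, r1 f hf, r1 g hg, r2 b hb, r2 c hc,
    r2 d hd, r2 e he, r2 f hf, r2 g hg, r3 f hf, r3 g hg] at A₁ A₂ A₃ n₁ n₂ n₃
  simp only [Omega, qInfs, List.map_cons, List.map_nil, List.prod_cons, List.prod_nil, mul_one,
    r4 f hf, r4 g hg, r5 b hb, r5 c hc, r5 d hd, r5 e he, r6] at h₄ h₅ ⊢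
  simp only [mul_ne_zero_iff] at n₁ n₂ n₃ h₄ h₅
  obtain ⟨a1, ⟨⟨⟨⟨qb, ab⟩, qc, ac⟩, qd, ad⟩, qe, ae⟩, ⟨qf, af⟩, qg, ag⟩ := n₁
  obtain ⟨m1, ⟨⟨⟨⟨-, zb⟩, -, zc⟩, -, zd⟩, -, ze⟩, -⟩ := n₃
  obtain ⟨vb, vc, vd, ve⟩ := h₄
  obtain ⟨ts, tt⟩ := h₅
  have hWne : qInf q (a ^ 2 * q / (f * g * z)) ≠ 0 := qInf_ne_zero_of_norm_lt hq1 hw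
  -- The nonvanishing of `(e/z;q)_∞` comes from the coefficient hypothesis and that of `(zq/e;q)_∞`
  -- from the definedness of the third series. Together they exclude every integer power of `q`.
  have hez : ∀ k : ℤ, e / z ≠ q ^ k := ne_zpow_of_theta_ne_zero hq0' hq1 (by
    rw [theta, show q / (e / z) = z * q / e by field_simp]
    exact mul_ne_zero ve ze)
  have T := sum6_three_term_qInf hq0' hq1 ha hb hc hd he hf hg hz0 hbcde hez hw hw'
  rw [← A₁, ← A₂, ← A₃] at T
  generalize vwpPsi q a _ _ = p₁ at T ⊢
  generalize vwpPsi q z _ _ = p₂ at T ⊢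
  generalize vwpPsi q (z ^ 2 / a) _ _ = p₃ at T ⊢
  clear A₁ A₂ A₃ s₁ s₂ s₃ h₁ h₂ h₃ n₂ r1 r2 r3 r4 r5 r6 hez
  have S := solve_three_term (k := 1 - a) (m := 1 - z ^ 2 / a) (p₁ := p₁) (p₂ := p₂) (p₃ := p₃)
    (W := qInf q (a ^ 2 * q / (f * g * z)))
    (B := qInf q (b / z) * (qInf q (c / z) * (qInf q (d / z) * qInf q (e / z))))
    (Z := qInf q (z * q / b) * qInf q (z * q / c) * qInf q (z * q / d) * qInf q (z * q / e))
    (Q := qInf q (q / b) * qInf q (q / c) * qInf q (q / d) * qInf q (q / e))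
    (A := qInf q (a * q / b) * (qInf q (a * q / c) * (qInf q (a * q / d) * qInf q (a * q / e))))
    (C := qInf q (a * q / z / b) * (qInf q (a * q / z / c) * (qInf q (a * q / z / d) *
      qInf q (a * q / z / e))))
    (D := qInf q b * (qInf q c * (qInf q d * qInf q e)))
    (P := qInf q (a * q / (b * c)) * (qInf q (a * q / (b * d)) * (qInf q (a * q / (b * e)) *
      (qInf q (a * q / (c * d)) * (qInf q (a * q / (c * e)) * qInf q (a * q / (d * e)))))))
    (F := qInf q (a * q / (f * g)))
    (T := qInf q (a * q / z ^ 2) * qInf q (z ^ 2 * q / a)) (X := qInf q (a * q) * qInf q (q / a))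
    (N₁ := qInf q (q / f) * qInf q (q / g)) (N₂ := qInf q (a * q / f) * qInf q (a * q / g))
    (M₁ := qInf q (a * q / z / f) * qInf q (a * q / z / g))
    (M₂ := qInf q (z * q / f) * qInf q (z * q / g)) ha hq0' hz0 hWne
    (by positivity) (by positivity) (by positivity) (by positivity) m1 (by positivity)
    (by positivity) (by positivity) a1 (by linear_combination T)
  rw [S]
  ring
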